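/- A modulus of continuity is a nondecreasing continuous function $\omega:[0,2]\to\mathbb R$ with $\omega(0)=0$, $\omega(1)=1$ and $t\mapsto\omega(t)/t$ nonincreasing on $(0,2]$; put $\omega^*(t):=\inf\{u\in[0,1]:\omega(u)=t\}$ for $t\in[0,1]$ and $\omega_\Gamma(f):=\sup_{z,w\in\Gamma,\,z\ne w}\frac{|f(z)-f(w)|}{\omega(|z-w|)}$. Let $\mathbb D$ be the open unit disk, $\mathbb T$ its boundary, and let $\Lambda_\omega$ be the set of functions $f$ continuous on $\overline{\mathbb D}$, analytic in $\mathbb D$, with $\omega_{\overline{\mathbb D}}(f)<\infty$. Let $\psi$ and $\omega$ be moduli of continuity with $\omega\ge\psi$ on $[0,2]$ and let $\rho\ge1$. Let $h:\mathbb T\to[0,\infty)$ be continuous with nonempty zero set $E_h$, with $\int_{\mathbb T}\log h(\xi)\,|d\xi|>-\infty$ and $\psi_{\mathbb T}(h)<\infty$. For $z\in\mathbb D$ let $$u_h(z)=\frac1{2\pi}\int_{\mathbb T}\operatorname{Re}\Big(\frac{\xi+z}{\xi-z}\Big)\log h(\xi)\,|d\xi|,\qquad v_h(z)=\frac1{2\pi}\int_{\mathbb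 T}\operatorname{Im}\Big(\frac{\xi+z}{\xi-z}\Big)\log h(\xi)\,|d\xi|,$$ and for $e^{i\theta}\in\mathbb T\setminus E_h$ suppose that the limit $$v_h(e^{i\theta})=-\lim_{\varepsilon\to0^+}\frac1{2\pi}\int_{\varepsilon\le|t|\le\pi}\frac{\log h(e^{i(\theta+t)})}{\tan(t/2)}\,dt$$ exists and is finite. Define $O_h^\rho$ on $\overline{\mathbb D}$ by $O_h^\rho=\exp\{\rho(u_h+iv_h)\}$ in $\mathbb D$, $O_h^\rho=h^\rho\exp\{i\rho v_h\}$ on $\mathbb T\setminus E_h$, and $O_h^\rho=0$ on $E_h$. For $\xi\in\mathbb T\setminus E_h$ set $$a_h(\xi)=\int_{\mathbb T\setminus\Psi_\xi}\frac{|\log(h(\zeta)/h(\xi))|}{|\zeta-\xi|^2}\,|d\zeta|,\qquad \Psi_\xi=\Big\{\zeta\in\mathbb T:|\zeta-\xi|\le\psi^*\Big(\frac{h(\xi)}{2\psi_{\mathbb T}(h)}\Big)\Big\}.$$ For $\xi=e^{i\theta}$, $\zeta=e^{i\varphi}$ with $0\le\theta<\varphi<2\pi$ let $[\xi,\zeta]=\{e^{is}:\theta\le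 s\le\varphi\}$, $h(\xi,\zeta)=\inf_{[\xi,\zeta]}h$ and $h^\rho(\xi,\zeta)=h(\xi,\zeta)^\rho$. For $g=h^\rho$ put $\lambda_g(\xi,\zeta)=\inf_{\sigma\in[\xi,\zeta]}\psi^*\big(\frac{g(\sigma)}{2\psi_{\mathbb T}(g)}\big)$ and, when $\lambda_g(\xi,\zeta)>0$, $$A_g(\xi,\zeta)=\Big|\sin\Big\{\lim_{\varepsilon\to0^+}\frac1{2\pi}\int_\varepsilon^{\lambda_g(\xi,\zeta)}\frac{\log\frac{g(e^{i(\theta+t)})}{g(e^{i(\theta-t)})}-\log\frac{g(e^{i(\varphi+t)})}{g(e^{i(\varphi-t)})}}{\tan(t/2)}\,dt\Big\}\Big|$$ (when $\lambda_g(\xi,\zeta)=0$ one has $h(\xi,\zeta)=0$, and the product $h^\rho(\xi,\zeta)A_{h^\rho}(\xi,\zeta)$ is read as $0$). Then $O_h^\rho\in\Lambda_\omega$ if and only if both $$\sup_{\xi\in\mathbb T\setminus E_h}\frac{h^\rho(\xi)}{\omega(\min\{1,1/a_h(\xi)\})}<\infty$$ and $$\sup_{\xi=e^{i\theta},\ \zeta=e^{i\varphi},\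 0\le\theta<\varphi<2\pi}\frac{h^\rho(\xi,\zeta)\,A_{h^\rho}(\xi,\zeta)}{\omega(|\xi-\zeta|)}<\infty .$$ -/

import Mathlib

open Set Filter Topology MeasureTheory

noncomputable section

namespace OuterLip

/-- Modulus of continuity: a nondecreasing continuous real function `ω` on `[0,2]` with
`ω 0 = 0`, `ω 1 = 1` and `t ↦ ω t / t` nonincreasing on `(0,2]`. Only the values of `ω` on
`[0,2]` matter. -/
structure IsModulus (ω : ℝ → ℝ) : Prop where
  monotoneOn : MonotoneOn ω (Icc 0 2)
  continuousOn : ContinuousOn ω (Icc 0 2)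
  map_zero : ω 0 = 0
  map_one : ω 1 = 1
  antitoneOn_div : AntitoneOn (fun t => ω t / t) (Ioc 0 2)

/-- `ω^*(t) = inf {u ∈ [0,1] : ω(u) = t}`, meaningful for `t ∈ [0,1]`. -/
def starInv (ω : ℝ → ℝ) (t : ℝ) : ℝ := sInf {u | u ∈ Icc (0 : ℝ) 1 ∧ ω u = t}

/-- The set of quotients `|f(z) - f(w)| / ω(|z - w|)`, `z ≠ w` in `Γ`. -/
def lipQuotients {X E : Type*} [MetricSpace X] [NormedAddCommGroup E]
    (ω : ℝ → ℝ) (Γ : Set X) (f : X → E) : Set ℝ :=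
  {r | ∃ z ∈ Γ, ∃ w ∈ Γ, z ≠ w ∧ r = ‖f z - f w‖ / ω (dist z w)}

/-- `ω_Γ(f) < +∞`. -/
def FiniteLip {X E : Type*} [MetricSpace X] [NormedAddCommGroup E]
    (ω : ℝ → ℝ) (Γ : Set X) (f : X → E) : Prop :=
  BddAbove (lipQuotients ω Γ f)

/-- `ω_Γ(f)`, the supremum of the quotients (to be used when it is finite). -/
def lipConst {X E : Type*} [MetricSpace X] [NormedAddCommGroup E]
    (ω : ℝ → ℝ) (Γ : Set X) (f : X → E) : ℝ :=
  sSup (lipQuotients ω Γ f)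

/-- The algebra `Λ_ω`, for functions considered on the closed unit disk: analytic in the open
disk, continuous on the closed disk, and `ω`-Lipschitz on the closed disk. -/
def MemLambda (ω : ℝ → ℝ) (f : ℂ → ℂ) : Prop :=
  DifferentiableOn ℂ f (Metric.ball 0 1) ∧
  ContinuousOn f (Metric.closedBall 0 1) ∧
  FiniteLip ω (Metric.closedBall (0 : ℂ) 1) f

/-- `∫_𝕋 log h |dξ| > -∞` for a continuous `h ≥ 0`, with `ξ = e^{is}` and `|dξ| = ds`. Since
`Real.log 0 = 0`, it has to be said separately that the zeros of `h` form a null set. -/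
def LogIntegrable (h : Circle → ℝ) : Prop :=
  (∀ᵐ s ∂volume.restrict (Ioc 0 (2 * Real.pi)), h (Circle.exp s) ≠ 0) ∧
  IntegrableOn (fun s => Real.log (h (Circle.exp s))) (Ioc 0 (2 * Real.pi)) volume

/-- `u_h`, the Poisson integral of `log h`. -/
def uDisk (h : Circle → ℝ) (z : ℂ) : ℝ :=
  1 / (2 * Real.pi) * ∫ s in Ioc 0 (2 * Real.pi),
    (((Circle.exp s : ℂ) + z) / ((Circle.exp s : ℂ) - z)).re * Real.log (h (Circle.exp s))

/-- `v_h` in the open disk, the harmonic conjugate of `u_h`. -/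
def vDisk (h : Circle → ℝ) (z : ℂ) : ℝ :=
  1 / (2 * Real.pi) * ∫ s in Ioc 0 (2 * Real.pi),
    (((Circle.exp s : ℂ) + z) / ((Circle.exp s : ℂ) - z)).im * Real.log (h (Circle.exp s))

/-- The truncated integral whose limit as `ε → 0⁺` is `v_h(ξ)`, `ξ ∈ 𝕋`. -/
def vTrunc (h : Circle → ℝ) (ξ : Circle) (ε : ℝ) : ℝ :=
  -(1 / (2 * Real.pi) * ∫ t in {t : ℝ | ε ≤ |t| ∧ |t| ≤ Real.pi},
      Real.log (h (ξ * Circle.exp t)) / Real.tan (t / 2))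

/-- `|v_h(ξ)| < +∞`: the limit that defines `v_h(ξ)` exists as a real number. -/
def VFinite (h : Circle → ℝ) (ξ : Circle) : Prop :=
  ∃ L : ℝ, Tendsto (vTrunc h ξ) (𝓝[>] 0) (𝓝 L)

/-- The boundary conjugate function `v_h(ξ)`, used only where the limit exists. -/
def vBdry (h : Circle → ℝ) (ξ : Circle) : ℝ := limUnder (𝓝[>] (0 : ℝ)) (vTrunc h ξ)

/-- `O_h^ρ` on the closed unit disk. In the open disk `O_h = exp (u_h + i v_h)`, so
`O_h^ρ = exp (ρ (u_h + i v_h))`; on the circle (where the point `z` is `Circle.exp (arg z)`),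
`O_h = h exp (i v_h)` off the zero set of `h` and `O_h = 0` on it. -/
def outerPow (h : Circle → ℝ) (ρ : ℝ) (z : ℂ) : ℂ :=
  if ‖z‖ < 1 then
    Complex.exp ((ρ : ℂ) * ((uDisk h z : ℂ) + (vDisk h z : ℂ) * Complex.I))
  else if h (Circle.exp z.arg) = 0 then 0
  else ((h (Circle.exp z.arg) ^ ρ : ℝ) : ℂ) *
    Complex.exp ((ρ : ℂ) * (vBdry h (Circle.exp z.arg) : ℂ) * Complex.I)

/-- `ψ^*(h(ξ) / (2 ψ_𝕋(h)))`. -/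
def radius (ψ : ℝ → ℝ) (h : Circle → ℝ) (ξ : Circle) : ℝ :=
  starInv ψ (h ξ / (2 * lipConst ψ univ h))

/-- The arc `Ψ_ξ = {ζ ∈ 𝕋 : |ζ - ξ| ≤ ψ^*(h(ξ) / (2 ψ_𝕋(h)))}`. -/
def Psi (ψ : ℝ → ℝ) (h : Circle → ℝ) (ξ : Circle) : Set Circle :=
  {ζ | dist ζ ξ ≤ radius ψ h ξ}

/-- `a_h(ξ) = ∫_{𝕋 ∖ Ψ_ξ} |log (h(ζ)/h(ξ))| / |ζ - ξ|² |dζ|`, for `h(ξ) ≠ 0` (the integrand is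
then integrable when `log h` is). -/
def aFun (ψ : ℝ → ℝ) (h : Circle → ℝ) (ξ : Circle) : ℝ :=
  ∫ s in {s : ℝ | s ∈ Ioc 0 (2 * Real.pi) ∧ Circle.exp s ∉ Psi ψ h ξ},
    |Real.log (h (Circle.exp s) / h ξ)| / dist (Circle.exp s) ξ ^ 2

/-- The closed arc `[e^{iθ}, e^{iφ}] = {e^{is} : θ ≤ s ≤ φ}`. -/
def arc (θ φ : ℝ) : Set Circle := (fun s : ℝ => Circle.exp s) '' Icc θ φ

/-- `h(ξ,ζ) = inf_{[ξ,ζ]} h`, for `ξ = e^{iθ}`, `ζ = e^{iφ}`. -/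
def infArc (h : Circle → ℝ) (θ φ : ℝ) : ℝ := sInf (h '' arc θ φ)

/-- `λ_h(ξ,ζ) = inf_{σ ∈ [ξ,ζ]} ψ^*(h(σ) / (2 ψ_𝕋(h)))`. -/
def lam (ψ : ℝ → ℝ) (h : Circle → ℝ) (θ φ : ℝ) : ℝ := sInf (radius ψ h '' arc θ φ)

/-- `A_h(ξ,ζ)`, for `ξ = e^{iθ}`, `ζ = e^{iφ}`. If `v_h` is finite at `ξ` and `ζ` and
`λ_h(ξ,ζ) > 0`, the limit exists. -/
def AFun (ψ : ℝ → ℝ) (h : Circle → ℝ) (θ φ : ℝ) : ℝ :=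
  |Real.sin (limUnder (𝓝[>] (0 : ℝ)) (fun ε =>
    1 / (2 * Real.pi) * ∫ t in ε..lam ψ h θ φ,
      (Real.log (h (Circle.exp (θ + t)) / h (Circle.exp (θ - t)))
        - Real.log (h (Circle.exp (φ + t)) / h (Circle.exp (φ - t)))) / Real.tan (t / 2)))|

end OuterLip

end

/-! On the circle `O_h^ρ` has modulus `h^ρ` and phase `ρ v_h`. The modulus is harmless: `ρ ≥ 1`
makes `h^ρ` again `ψ`-Lipschitz (`IsWeight.rpow`), and `ψ ≤ ω`. Everything is therefore decided by
phase differences weighted by `h^ρ`.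

Truncating the singular integral for `v_h` at scale `l = λ(ξ,ζ)` splits `v_h(ξ) - v_h(ζ)` into two
parts. The local part, multiplied by `ρ`, is up to sign the argument of the sine in `A` (`AFun_eq`).
The nonlocal part is almost Lipschitz, with constant `a_h(ξ) + 4/l` (`abs_vTrunc_sub_le`). After
weighting, the term `4/l` is absorbed because `ψ(l)` is comparable to the infimum of `h^ρ` on the
arc, and the term `a_h` is absorbed by the first supremum (`RadialBound.nonlocal_le`). So, given the
first bound, the second one is equivalent to control of the infimum of `h^ρ` times `|sin(ρ v_h(ξ) -
ρ v_h(ζ))|`.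

Necessity. The arc bound then follows by comparing boundary values (`arcBound_of_lip`). For the
radial bound, put `δ = 1/a_h(ξ)` and suppose `h(ξ)^ρ` is far larger than `ω(δ)`. Then `log|O_h|`
hardly drops between `ξ` and `z = (1-δ)ξ`, while the positive part of `log h - log h(ξ)` has a small
Poisson integral at `z`. Hence so does its absolute value, although that integral dominates a fixed
multiple of `δ a_h(ξ) = 1` (`radialBound_of_lip`).

Sufficiency. The sine sees phases only modulo `π`, so the bounds control differences of `(O_h^ρ)^2`
(`ArcBound.norm_sq_sub_sq_le`). They also concern only arcs that do not cross the point `1`. A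
Poisson integral has the mean of two one-sided limits as radial limit, which rules out a jump of the
square there (`tendsto_outerPow_sq_cut`). The square is thus continuous on the closed disk. Radial
limits select the right branch of the root, so `O_h^ρ` is continuous too
(`continuousOn_closedBall_of_sq`). Continuity along short arcs then excludes sign changes, and the
estimate for squares becomes one for `O_h^ρ` on the circle. The maximum principle and the Schwarz
lemma carry it to the closed disk (`finiteLip_closedBall`). -/

namespace OuterLip

/-! ### Moduli of continuity and their generalized inverses. -/

section Modulus

variable {ω ψ : ℝ → ℝ}

lemma IsModulus.self_le (hω : IsModulus ω) {t : ℝ} (h0 : 0 ≤ t) (h1 : t ≤ 1) : t ≤ ω t := by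
  rcases h0.eq_or_lt with rfl | h0
  · simp [hω.map_zero]
  have := hω.antitoneOn_div (a := t) (b := 1) ⟨h0, by linarith⟩ ⟨by norm_num, by norm_num⟩ h1
  simp only [hω.map_one, div_one] at this
  rwa [le_div_iff₀ h0, one_mul] at this

lemma IsModulus.one_le (hω : IsModulus ω) {t : ℝ} (h0 : 1 ≤ t) (h1 : t ≤ 2) : 1 ≤ ω t := by
  have := hω.monotoneOn (a := 1) (b := t) ⟨by norm_num, by norm_num⟩ ⟨by linarith, h1⟩ h0
  rwa [hω.map_one] at this

lemma IsModulus.mono (hω : IsModulus ω) {s t : ℝ} (h0 : 0 ≤ s) (h1 : s ≤ t) (h2 : t ≤ 2) :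
    ω s ≤ ω t :=
  hω.monotoneOn ⟨h0, h1.trans h2⟩ ⟨h0.trans h1, h2⟩ h1

lemma IsModulus.nonneg (hω : IsModulus ω) {t : ℝ} (h0 : 0 ≤ t) (h1 : t ≤ 2) : 0 ≤ ω t := by
  simpa [hω.map_zero] using hω.mono le_rfl h0 h1

lemma IsModulus.pos (hω : IsModulus ω) {t : ℝ} (h0 : 0 < t) (h1 : t ≤ 2) : 0 < ω t := by
  rcases le_total t 1 with h | h
  · exact h0.trans_le (hω.self_le h0.le h)
  · linarith [hω.one_le h h1]

lemma IsModulus.mul_le (hω : IsModulus ω) {s t : ℝ} (h0 : 0 ≤ s) (h1 : s ≤ t) (h2 : t ≤ 2) :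
    ω t * s ≤ ω s * t := by
  rcases h0.eq_or_lt with rfl | h0
  · simp [hω.map_zero]
  have := hω.antitoneOn_div (a := s) (b := t) ⟨h0, by linarith⟩ ⟨by linarith, h2⟩ h1
  simp only at this
  rwa [div_le_div_iff₀ (by linarith) h0] at this

/-- Monotonicity of `ω(t)/t` makes `ω` grow at most linearly under dilation. All comparisons of `ω`
at proportional arguments rest on this. -/
lemma IsModulus.le_mul (hω : IsModulus ω) {s t k : ℝ} (h0 : 0 ≤ s) (hs : s ≤ 2) (ht0 : 0 ≤ t)
    (h2 : t ≤ 2) (hk : 1 ≤ k) (htk : t ≤ k * s) : ω t ≤ k * ω s := by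
  have hn := hω.nonneg h0 hs
  rcases le_total t s with h | h
  · have := hω.mono ht0 h hs
    nlinarith
  rcases h0.eq_or_lt with rfl | h0
  · have : t = 0 := by linarith
    simp [this, hω.map_zero]
  have := hω.mul_le h0.le h h2
  have h3 : ω t * s ≤ (k * ω s) * s := by nlinarith
  exact le_of_mul_le_mul_right h3 h0

lemma IsModulus.le_two (hω : IsModulus ω) {t : ℝ} (h0 : 0 ≤ t) (h1 : t ≤ 2) : ω t ≤ 2 := by
  simpa [hω.map_one] using
    hω.le_mul (s := 1) (k := 2) (by norm_num) (by norm_num) h0 h1 (by norm_num) (by linarith)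

/-- The level set is closed by continuity and nonempty by the intermediate value theorem, so the
infimum is attained. -/
lemma IsModulus.starInv_spec (hω : IsModulus ω) {t : ℝ} (h0 : 0 ≤ t) (h1 : t ≤ 1) :
    starInv ω t ∈ Icc (0 : ℝ) 1 ∧ ω (starInv ω t) = t := by
  have hc : ContinuousOn ω (Icc 0 1) := hω.continuousOn.mono (Icc_subset_Icc_right (by norm_num))
  have hcl : IsClosed {u | u ∈ Icc (0 : ℝ) 1 ∧ ω u = t} :=
    hc.preimage_isClosed_of_isClosed isClosed_Icc (isClosed_singleton (x := t))
  have hne : {u | u ∈ Icc (0 : ℝ) 1 ∧ ω u = t}.Nonempty := by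
    have := intermediate_value_Icc (zero_le_one (α := ℝ)) hc
    rw [hω.map_zero, hω.map_one] at this
    obtain ⟨u, hu, hut⟩ := this ⟨h0, h1⟩
    exact ⟨u, hu, hut⟩
  have hb : BddBelow {u | u ∈ Icc (0 : ℝ) 1 ∧ ω u = t} := ⟨0, fun u hu => hu.1.1⟩
  exact hcl.csInf_mem hne hb

lemma IsModulus.starInv_le (hω : IsModulus ω) {t x : ℝ} (h0 : 0 ≤ t) (hx0 : 0 ≤ x) (hx1 : x ≤ 1)
    (h : t ≤ ω x) : starInv ω t ≤ x := by
  have hc : ContinuousOn ω (Icc 0 x) := hω.continuousOn.mono (Icc_subset_Icc_right (by linarith))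
  have := intermediate_value_Icc hx0 hc
  rw [hω.map_zero] at this
  obtain ⟨u, hu, hut⟩ := this ⟨h0, h⟩
  have hb : BddBelow {u | u ∈ Icc (0 : ℝ) 1 ∧ ω u = t} := ⟨0, fun u hu => hu.1.1⟩
  exact (csInf_le hb ⟨⟨hu.1, hu.2.trans hx1⟩, hut⟩).trans hu.2

lemma IsModulus.starInv_mono (hω : IsModulus ω) {s t : ℝ} (h0 : 0 ≤ s) (hst : s ≤ t)
    (h1 : t ≤ 1) : starInv ω s ≤ starInv ω t := by
  obtain ⟨h2, h3⟩ := hω.starInv_spec (h0.trans hst) h1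
  exact hω.starInv_le h0 h2.1 h2.2 (by rwa [h3])

end Modulus

/-! ### Lipschitz constants relative to a modulus. -/

section Lip

variable {X E : Type*} [MetricSpace X] [NormedAddCommGroup E] {ω : ℝ → ℝ} {Γ : Set X} {f : X → E}

lemma FiniteLip.norm_sub_le (hf : FiniteLip ω Γ f) (hω : IsModulus ω)
    (hΓ : ∀ z ∈ Γ, ∀ w ∈ Γ, dist z w ≤ 2) {z w : X} (hz : z ∈ Γ) (hw : w ∈ Γ) :
    ‖f z - f w‖ ≤ lipConst ω Γ f * ω (dist z w) := by
  by_cases hzw : z = w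
  · simp [hzw, hω.map_zero]
  have h : 0 < ω (dist z w) := hω.pos (dist_pos.2 hzw) (hΓ z hz w hw)
  rw [← div_le_iff₀ h]
  exact le_csSup hf ⟨z, hz, w, hw, hzw, rfl⟩

lemma finiteLip_of_norm_sub_le (hω : IsModulus ω) (hΓ : ∀ z ∈ Γ, ∀ w ∈ Γ, dist z w ≤ 2) {C : ℝ}
    (h : ∀ z ∈ Γ, ∀ w ∈ Γ, z ≠ w → ‖f z - f w‖ ≤ C * ω (dist z w)) : FiniteLip ω Γ f := by
  refine ⟨C, ?_⟩
  rintro r ⟨z, hz, w, hw, hzw, rfl⟩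
  have h0 : 0 < ω (dist z w) := hω.pos (dist_pos.2 hzw) (hΓ z hz w hw)
  rw [div_le_iff₀ h0]
  exact h z hz w hw hzw

end Lip

/-! ### Chords and arcs of the circle. -/

section Geometry

lemma dist_circle (z w : Circle) : dist z w = dist (z : ℂ) (w : ℂ) := rfl

lemma dist_circle_le_two (z w : Circle) : dist z w ≤ 2 := by
  rw [dist_circle, dist_eq_norm]
  refine (norm_sub_le _ _).trans ?_
  simp only [Circle.norm_coe]; norm_num

lemma dist_exp (a b : ℝ) :
    dist (Circle.exp a) (Circle.exp b) = 2 * |Real.sin ((a - b) / 2)| := by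
  rw [dist_circle, dist_eq_norm, Circle.coe_exp, Circle.coe_exp]
  have h : Complex.exp (a * Complex.I) - Complex.exp (b * Complex.I)
      = Complex.exp (b * Complex.I) * (Complex.exp (Complex.I * ((a - b : ℝ) : ℂ)) - 1) := by
    rw [mul_sub, ← Complex.exp_add, mul_one]
    congr 2
    push_cast; ring
  rw [h, norm_mul, Complex.norm_exp_ofReal_mul_I, one_mul, Complex.norm_exp_I_mul_ofReal_sub_one]
  simp

lemma dist_exp_le (a b : ℝ) : dist (Circle.exp a) (Circle.exp b) ≤ |a - b| := by
  rw [dist_exp]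
  have := Real.abs_sin_le_abs (x := (a - b) / 2)
  rw [abs_div, abs_two] at this
  linarith

lemma mul_abs_le_dist_exp {a b : ℝ} (h : |a - b| ≤ Real.pi) :
    2 / Real.pi * |a - b| ≤ dist (Circle.exp a) (Circle.exp b) := by
  rw [dist_exp]
  have := Real.mul_abs_le_abs_sin (x := (a - b) / 2) (by rw [abs_div, abs_two]; linarith)
  rw [abs_div, abs_two] at this
  calc 2 / Real.pi * |a - b| = 2 * (2 / Real.pi * (|a - b| / 2)) := by ring
    _ ≤ _ := by linarith

lemma abs_le_two_mul_dist_exp {a b : ℝ} (h : |a - b| ≤ Real.pi) :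
    |a - b| ≤ 2 * dist (Circle.exp a) (Circle.exp b) := by
  have h1 := mul_abs_le_dist_exp h
  have h2 : (1 : ℝ) / 2 ≤ 2 / Real.pi := by
    rw [div_le_div_iff₀ (by norm_num) Real.pi_pos]; linarith [Real.pi_le_four]
  nlinarith [abs_nonneg (a - b)]

/-- Chord length is monotone in the arc length up to a half circle. -/
lemma dist_exp_mono {a b c d : ℝ} (h : |a - b| ≤ |c - d|) (h2 : |c - d| ≤ Real.pi) :
    dist (Circle.exp a) (Circle.exp b) ≤ dist (Circle.exp c) (Circle.exp d) := by
  have key : ∀ x : ℝ, |x| ≤ Real.pi → |Real.sin (x / 2)| = Real.sin (|x| / 2) := by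
    intro x hx
    rw [Real.abs_sin_eq_sin_abs_of_abs_le_pi (by rw [abs_div, abs_two]; linarith [abs_nonneg x]),
      abs_div, abs_two]
  rw [dist_exp, dist_exp, key _ (h.trans h2), key _ h2]
  have := Real.sin_le_sin_of_le_of_le_pi_div_two (x := |a - b| / 2) (y := |c - d| / 2)
    (by linarith [abs_nonneg (a - b), Real.pi_pos]) (by linarith) (by linarith)
  linarith

lemma exists_exp_eq (ξ : Circle) : ∃ θ : ℝ, 0 ≤ θ ∧ θ < 2 * Real.pi ∧ Circle.exp θ = ξ := by
  have hp := Real.pi_pos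
  rcases le_or_gt 0 (Complex.arg ξ) with h | h
  · exact ⟨Complex.arg ξ, h, by linarith [Complex.arg_le_pi ξ], Circle.exp_arg ξ⟩
  · exact ⟨Complex.arg ξ + 2 * Real.pi, by linarith [Complex.neg_pi_lt_arg (ξ : ℂ)], by linarith,
      by rw [Circle.exp_add_two_pi, Circle.exp_arg]⟩

end Geometry

/-! ### Weights, their radii, and powers of weights. -/

section Weight

/-- A continuous nonnegative `ψ`-Lipschitz function on the circle that vanishes somewhere but not
everywhere. -/
structure IsWeight (ψ : ℝ → ℝ) (g : Circle → ℝ) : Prop where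
  mod : IsModulus ψ
  cont : Continuous g
  nonneg : ∀ ξ, 0 ≤ g ξ
  zero : ∃ ξ, g ξ = 0
  nonzero : ∃ ξ, g ξ ≠ 0
  lip : FiniteLip ψ univ g

variable {ψ : ℝ → ℝ} {g : Circle → ℝ}

lemma IsWeight.abs_sub_le (hg : IsWeight ψ g) (ξ ζ : Circle) :
    |g ξ - g ζ| ≤ lipConst ψ univ g * ψ (dist ξ ζ) :=
  hg.lip.norm_sub_le hg.mod (fun z _ w _ => dist_circle_le_two z w) (mem_univ ξ) (mem_univ ζ)

lemma IsWeight.lipConst_pos (hg : IsWeight ψ g) : 0 < lipConst ψ univ g := by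
  obtain ⟨ξ, hξ⟩ := hg.zero
  obtain ⟨ζ, hζ⟩ := hg.nonzero
  have h := hg.abs_sub_le ζ ξ
  rw [hξ, sub_zero] at h
  have h1 : 0 < |g ζ| := abs_pos.2 hζ
  have h2 := hg.mod.nonneg (dist_nonneg (x := ζ) (y := ξ)) (dist_circle_le_two ζ ξ)
  by_contra hc
  nlinarith

lemma IsWeight.le_lipConst_mul (hg : IsWeight ψ g) (ξ : Circle) :
    g ξ ≤ 2 * lipConst ψ univ g := by
  obtain ⟨ζ, hζ⟩ := hg.zero
  have h := hg.abs_sub_le ξ ζ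
  rw [hζ, sub_zero] at h
  have h2 := hg.mod.le_two (dist_nonneg (x := ξ) (y := ζ)) (dist_circle_le_two ξ ζ)
  have := hg.lipConst_pos
  nlinarith [le_abs_self (g ξ)]

lemma IsWeight.div_mem (hg : IsWeight ψ g) (ξ : Circle) :
    0 ≤ g ξ / (2 * lipConst ψ univ g) ∧ g ξ / (2 * lipConst ψ univ g) ≤ 1 := by
  have := hg.lipConst_pos
  exact ⟨div_nonneg (hg.nonneg ξ) (by linarith),
    (div_le_one (by linarith)).2 (hg.le_lipConst_mul ξ)⟩

lemma IsWeight.radius_mem (hg : IsWeight ψ g) (ξ : Circle) : radius ψ g ξ ∈ Icc (0 : ℝ) 1 :=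
  (hg.mod.starInv_spec (hg.div_mem ξ).1 (hg.div_mem ξ).2).1

lemma IsWeight.map_radius (hg : IsWeight ψ g) (ξ : Circle) :
    2 * lipConst ψ univ g * ψ (radius ψ g ξ) = g ξ := by
  have := hg.lipConst_pos
  rw [radius, (hg.mod.starInv_spec (hg.div_mem ξ).1 (hg.div_mem ξ).2).2]
  field_simp

lemma IsWeight.radius_pos (hg : IsWeight ψ g) {ξ : Circle} (hξ : g ξ ≠ 0) :
    0 < radius ψ g ξ := by
  refine (hg.radius_mem ξ).1.lt_of_ne fun h => hξ ?_
  rw [← hg.map_radius ξ, ← h, hg.mod.map_zero, mul_zero]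

lemma IsWeight.radius_mono (hg : IsWeight ψ g) {ξ ζ : Circle} (h : g ξ ≤ g ζ) :
    radius ψ g ξ ≤ radius ψ g ζ := by
  have := hg.lipConst_pos
  exact hg.mod.starInv_mono (hg.div_mem ξ).1 (by gcongr) (hg.div_mem ζ).2

/-- If `g ξ` is large compared with `ψ x`, then the radius at `ξ` is larger than `x`. -/
lemma IsWeight.lt_radius (hg : IsWeight ψ g) {ξ : Circle} {x : ℝ} (hx : x ≤ 2)
    (h : 2 * lipConst ψ univ g * ψ x < g ξ) : x < radius ψ g ξ := by
  by_contra! hc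
  have h1 := hg.mod.mono (hg.radius_mem ξ).1 hc hx
  have := hg.lipConst_pos
  rw [← hg.map_radius ξ] at h
  nlinarith

/-- The factor `2` in the definition of the radius is made for this: on `Ψ_ξ` the weight stays
within half of its central value, so its logarithm is nearly constant. -/
lemma IsWeight.abs_sub_le_of_dist_le_radius (hg : IsWeight ψ g) {ξ ζ : Circle}
    (h : dist ζ ξ ≤ radius ψ g ξ) : |g ζ - g ξ| ≤ g ξ / 2 := by
  have h1 := hg.mod.mono dist_nonneg h ((hg.radius_mem ξ).2.trans (by norm_num))
  have h2 := hg.abs_sub_le ζ ξ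
  have h3 := hg.lipConst_pos
  have h4 := hg.map_radius ξ
  nlinarith

lemma isCompact_arc (θ φ : ℝ) : IsCompact (arc θ φ) :=
  isCompact_Icc.image (by fun_prop)

lemma exp_mem_arc {θ φ s : ℝ} (h1 : θ ≤ s) (h2 : s ≤ φ) : Circle.exp s ∈ arc θ φ :=
  ⟨s, ⟨h1, h2⟩, rfl⟩

lemma exists_infArc (hg : Continuous g) {θ φ : ℝ} (h : θ ≤ φ) :
    ∃ s ∈ Icc θ φ, g (Circle.exp s) = infArc g θ φ ∧ ∀ σ ∈ arc θ φ, g (Circle.exp s) ≤ g σ := by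
  obtain ⟨σ, ⟨s, hs, rfl⟩, hmin⟩ := (isCompact_arc θ φ).exists_isMinOn
    ⟨_, exp_mem_arc le_rfl h⟩ hg.continuousOn
  refine ⟨s, hs, ?_, fun σ hσ => hmin hσ⟩
  have hl : IsLeast (g '' arc θ φ) (g (Circle.exp s)) :=
    ⟨⟨Circle.exp s, ⟨s, hs, rfl⟩, rfl⟩, by rintro _ ⟨σ, hσ, rfl⟩; exact hmin hσ⟩
  exact hl.csInf_eq.symm

/-- As `ψ^*` is monotone, the smallest radius on an arc occurs where the weight is smallest. This
links `λ` to the infimum of the weight. -/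
lemma IsWeight.lam_eq (hg : IsWeight ψ g) {θ φ s : ℝ} (hs : s ∈ Icc θ φ)
    (hmin : ∀ σ ∈ arc θ φ, g (Circle.exp s) ≤ g σ) : lam ψ g θ φ = radius ψ g (Circle.exp s) := by
  unfold lam
  exact IsLeast.csInf_eq ⟨⟨Circle.exp s, ⟨s, hs, rfl⟩, rfl⟩,
    by rintro _ ⟨σ, hσ, rfl⟩; exact hg.radius_mono (hmin σ hσ)⟩

lemma rpow_sub_le {M ρ x y : ℝ} (hρ : 1 ≤ ρ) (hx : 0 ≤ x) (hy : 0 ≤ y) (hxM : x ≤ M)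
    (hyM : y ≤ M) : |x ^ ρ - y ^ ρ| ≤ ρ * M ^ (ρ - 1) * |x - y| := by
  have hM : 0 ≤ M := hx.trans hxM
  have := (convex_Icc (0 : ℝ) M).norm_image_sub_le_of_norm_hasDerivWithin_le
    (f := fun x => x ^ ρ) (f' := fun x => ρ * x ^ (ρ - 1)) (C := ρ * M ^ (ρ - 1)) (x := y) (y := x)
    (fun t ht => (Real.hasDerivAt_rpow_const (Or.inr hρ)).hasDerivWithinAt) ?_ ⟨hy, hyM⟩ ⟨hx, hxM⟩
  · simpa using this
  · intro t ht
    rw [Real.norm_of_nonneg (mul_nonneg (by linarith) (Real.rpow_nonneg ht.1 _))]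
    have := Real.rpow_le_rpow ht.1 ht.2 (sub_nonneg.2 hρ)
    nlinarith

/-- A weight is bounded, and `x ↦ x^ρ` is Lipschitz on bounded intervals when `ρ ≥ 1`. -/
lemma IsWeight.rpow (hg : IsWeight ψ g) {ρ : ℝ} (hρ : 1 ≤ ρ) :
    IsWeight ψ (fun σ => g σ ^ ρ) where
  mod := hg.mod
  cont := hg.cont.rpow_const fun _ => Or.inr (by linarith)
  nonneg ξ := Real.rpow_nonneg (hg.nonneg ξ) _
  zero := by
    obtain ⟨ξ, hξ⟩ := hg.zero
    exact ⟨ξ, by simp only [hξ]; exact Real.zero_rpow (by linarith)⟩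
  nonzero := by
    obtain ⟨ξ, hξ⟩ := hg.nonzero
    exact ⟨ξ, (Real.rpow_pos_of_pos ((hg.nonneg ξ).lt_of_ne hξ.symm) _).ne'⟩
  lip := by
    have hl := hg.lipConst_pos
    refine finiteLip_of_norm_sub_le hg.mod (fun z _ w _ => dist_circle_le_two z w)
      (C := ρ * (2 * lipConst ψ univ g) ^ (ρ - 1) * lipConst ψ univ g) fun z _ w _ _ => ?_
    refine (rpow_sub_le hρ (hg.nonneg z) (hg.nonneg w) (hg.le_lipConst_mul z)
      (hg.le_lipConst_mul w)).trans ?_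
    rw [mul_assoc (ρ * _)]
    exact mul_le_mul_of_nonneg_left (hg.abs_sub_le z w) (by positivity)

end Weight

/-! ### Poisson integrals and their boundary behaviour. -/

section Poisson

/-- The Poisson kernel of the unit disk at the boundary point `e^{is}`. -/
noncomputable def pKernel (z : ℂ) (s : ℝ) : ℝ :=
  (((Circle.exp s : ℂ) + z) / ((Circle.exp s : ℂ) - z)).re

lemma pKernel_eq (z : ℂ) (s : ℝ) :
    pKernel z s = (1 - ‖z‖ ^ 2) / ‖(Circle.exp s : ℂ) - z‖ ^ 2 := by
  have := congrFun (poissonKernel_eq_re_herglotzRieszKernel (c := 0) (w := z)) (Circle.exp s : ℂ)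
  simpa [poissonKernel_def, herglotzRieszKernel_def, pKernel] using this.symm

lemma exp_sub_ne_zero {z : ℂ} (hz : ‖z‖ < 1) (s : ℝ) : (Circle.exp s : ℂ) - z ≠ 0 := by
  intro h
  rw [sub_eq_zero] at h
  rw [← h, Circle.norm_coe] at hz
  exact lt_irrefl _ hz

lemma pKernel_nonneg {z : ℂ} (hz : ‖z‖ < 1) (s : ℝ) : 0 ≤ pKernel z s := by
  rw [pKernel_eq]
  have : ‖z‖ ^ 2 ≤ 1 := by nlinarith [norm_nonneg z]
  exact div_nonneg (by linarith) (by positivity)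

lemma continuous_pKernel {z : ℂ} (hz : ‖z‖ < 1) : Continuous (pKernel z) := by
  unfold pKernel
  exact Complex.continuous_re.comp
    (Continuous.div (by fun_prop) (by fun_prop) (exp_sub_ne_zero hz))

variable {E : Type*} [NormedAddCommGroup E] [NormedSpace ℝ E]

/-- The Poisson integral of a function of the angle. -/
noncomputable def pIntegral (q : ℝ → E) (z : ℂ) : E :=
  (2 * Real.pi)⁻¹ • ∫ s in 0..2 * Real.pi, pKernel z s • q s

lemma pKernel_smul_integrable {q : ℝ → E} {z : ℂ} (hz : ‖z‖ < 1) {a b : ℝ}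
    (hq : IntervalIntegrable q volume a b) :
    IntervalIntegrable (fun s => pKernel z s • q s) volume a b :=
  hq.continuousOn_smul (continuous_pKernel hz).continuousOn

lemma circleMap_zero_one (s : ℝ) : circleMap 0 1 s = (Circle.exp s : ℂ) := by
  simp [circleMap, Circle.coe_exp]

lemma pIntegral_eq_of_diffContOnCl {F : ℂ → ℂ} (hF : DiffContOnCl ℂ F (Metric.ball 0 1)) {z : ℂ}
    (hz : ‖z‖ < 1) : pIntegral (fun s => F (Circle.exp s)) z = F z := by
  have := hF.circleAverage_re_herglotzRieszKernel_smul (w := z) (by simpa using hz)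
  rw [Real.circleAverage_def] at this
  rw [← this, pIntegral]
  simp only [Pi.smul_apply', Function.comp_apply, herglotzRieszKernel_def, circleMap_zero_one,
    sub_zero, pKernel]

lemma integral_pKernel {z : ℂ} (hz : ‖z‖ < 1) :
    ∫ s in 0..2 * Real.pi, pKernel z s = 2 * Real.pi := by
  have h := pIntegral_eq_of_diffContOnCl (F := fun _ => 1) diffContOnCl_const hz
  have hp := Real.pi_pos
  simp only [pIntegral, Complex.real_smul, mul_one] at h
  rw [intervalIntegral.integral_ofReal, ← Complex.ofReal_mul] at h
  have h2 : (2 * Real.pi)⁻¹ * ∫ s in 0..2 * Real.pi, pKernel z s = 1 := by exact_mod_cast h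
  field_simp at h2
  linarith

lemma pIntegral_const [CompleteSpace E] (c : E) {z : ℂ} (hz : ‖z‖ < 1) :
    pIntegral (fun _ => c) z = c := by
  rw [pIntegral, intervalIntegral.integral_smul_const, integral_pKernel hz, smul_smul,
    inv_mul_cancel₀ (by positivity), one_smul]

lemma pIntegral_add {p q : ℝ → E} {z : ℂ} (hz : ‖z‖ < 1)
    (hp : IntervalIntegrable p volume 0 (2 * Real.pi))
    (hq : IntervalIntegrable q volume 0 (2 * Real.pi)) :
    pIntegral (fun s => p s + q s) z = pIntegral p z + pIntegral q z := by
  simp only [pIntegral, smul_add]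
  rw [intervalIntegral.integral_add (pKernel_smul_integrable hz hp)
    (pKernel_smul_integrable hz hq), smul_add]

lemma pIntegral_sub {p q : ℝ → E} {z : ℂ} (hz : ‖z‖ < 1)
    (hp : IntervalIntegrable p volume 0 (2 * Real.pi))
    (hq : IntervalIntegrable q volume 0 (2 * Real.pi)) :
    pIntegral (fun s => p s - q s) z = pIntegral p z - pIntegral q z := by
  simp only [pIntegral, smul_sub]
  rw [intervalIntegral.integral_sub (pKernel_smul_integrable hz hp)
    (pKernel_smul_integrable hz hq), smul_sub]

lemma pIntegral_sub_const [CompleteSpace E] {q : ℝ → E} {z : ℂ} (hz : ‖z‖ < 1)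
    (hq : IntervalIntegrable q volume 0 (2 * Real.pi)) (c : E) :
    pIntegral (fun s => q s - c) z = pIntegral q z - c := by
  rw [pIntegral_sub hz hq intervalIntegrable_const, pIntegral_const c hz]

lemma norm_pIntegral_le (q : ℝ → E) {z : ℂ} (hz : ‖z‖ < 1) :
    ‖pIntegral q z‖ ≤ pIntegral (fun s => ‖q s‖) z := by
  have hp := Real.pi_pos
  rw [pIntegral, norm_smul, Real.norm_of_nonneg (by positivity), pIntegral, smul_eq_mul]
  gcongr
  refine (intervalIntegral.norm_integral_le_integral_norm (by positivity)).trans (le_of_eq ?_)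
  simp only [norm_smul, smul_eq_mul, Real.norm_of_nonneg (pKernel_nonneg hz _)]

lemma pIntegral_mono {p q : ℝ → ℝ} {z : ℂ} (hz : ‖z‖ < 1)
    (hp : IntervalIntegrable p volume 0 (2 * Real.pi))
    (hq : IntervalIntegrable q volume 0 (2 * Real.pi))
    (h : ∀ᵐ s ∂volume.restrict (Ioc 0 (2 * Real.pi)), p s ≤ q s) :
    pIntegral p z ≤ pIntegral q z := by
  have hpi := Real.pi_pos
  simp only [pIntegral, smul_eq_mul]
  gcongr
  rw [intervalIntegral.integral_of_le (by positivity),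
    intervalIntegral.integral_of_le (by positivity)]
  refine integral_mono_ae ?_ ?_ ?_
  · exact (intervalIntegrable_iff_integrableOn_Ioc_of_le (by positivity)).1
      (pKernel_smul_integrable hz hp)
  · exact (intervalIntegrable_iff_integrableOn_Ioc_of_le (by positivity)).1
      (pKernel_smul_integrable hz hq)
  · filter_upwards [h] with s hs
    exact mul_le_mul_of_nonneg_left hs (pKernel_nonneg hz s)

lemma ae_Ioo_of_Ioc : ∀ᵐ s ∂volume.restrict (Ioc (0 : ℝ) (2 * Real.pi)),
    s ∈ Ioo 0 (2 * Real.pi) := by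
  rw [← restrict_Ioo_eq_restrict_Ioc]
  exact ae_restrict_mem measurableSet_Ioo

/-- `p` is small near `ξ`, apart from the endpoints of `[0, 2π]`. -/
def SmallNear (p : ℝ → ℝ) (ξ : Circle) : Prop :=
  ∀ ε > 0, ∃ δ > 0, ∀ s ∈ Ioo 0 (2 * Real.pi), dist (Circle.exp s) ξ < δ → p s ≤ ε

/-- The kernel is an approximate identity: near `ξ` its total mass `1` costs at most `ε/2`, and away
from `ξ` it is `O(1 - |z|²)`. Endpoints of the parameter interval are null, so a jump of the
parametrization at the cut may be ignored. -/
lemma tendsto_pIntegral_zero {p : ℝ → ℝ} (hp0 : ∀ s, 0 ≤ p s)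
    (hp : IntervalIntegrable p volume 0 (2 * Real.pi)) {ξ : Circle} (hs : SmallNear p ξ) :
    Tendsto (pIntegral p) (𝓝[Metric.ball 0 1] (ξ : ℂ)) (𝓝 0) := by
  have hpi := Real.pi_pos
  rw [Metric.tendsto_nhds]
  intro ε hε
  obtain ⟨δ, hδ, hδ'⟩ := hs (ε / 2) (by linarith)
  set I := (2 * Real.pi)⁻¹ * ∫ s in 0..2 * Real.pi, p s with hI
  have hlim : Tendsto (fun z : ℂ => (1 - ‖z‖ ^ 2) * (4 / δ ^ 2) * I) (𝓝[Metric.ball 0 1] (ξ : ℂ))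
      (𝓝 0) := by
    have : Continuous fun z : ℂ => (1 - ‖z‖ ^ 2) * (4 / δ ^ 2) * I := by fun_prop
    have h2 := this.tendsto (ξ : ℂ)
    simp only [Circle.norm_coe, one_pow, sub_self, zero_mul] at h2
    exact h2.mono_left nhdsWithin_le_nhds
  have hlim2 := hlim.eventually (gt_mem_nhds (show (0 : ℝ) < ε / 2 by linarith))
  filter_upwards [hlim2, self_mem_nhdsWithin,
    nhdsWithin_le_nhds (Metric.ball_mem_nhds (ξ : ℂ) (half_pos hδ))] with z h1 hz hzδ
  have hz : ‖z‖ < 1 := by simpa using hz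
  have hz2 : 0 ≤ 1 - ‖z‖ ^ 2 := by nlinarith [norm_nonneg z]
  have hle : pIntegral p z ≤ ε / 2 + (1 - ‖z‖ ^ 2) * (4 / δ ^ 2) * I := by
    rw [← pIntegral_const (ε / 2) hz, hI]
    simp only [pIntegral, smul_eq_mul]
    rw [mul_left_comm, ← mul_add]
    refine mul_le_mul_of_nonneg_left ?_ (by positivity)
    rw [← intervalIntegral.integral_const_mul, ← intervalIntegral.integral_add (f := fun s =>
      pKernel z s * (ε / 2)) (((continuous_pKernel hz).mul continuous_const).intervalIntegrable _ _)
      (hp.const_mul _)]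
    rw [intervalIntegral.integral_of_le (by positivity),
      intervalIntegral.integral_of_le (by positivity)]
    refine integral_mono_ae
      ((intervalIntegrable_iff_integrableOn_Ioc_of_le (by positivity)).1
      (pKernel_smul_integrable hz hp))
      ((intervalIntegrable_iff_integrableOn_Ioc_of_le (by positivity)).1
      ((((continuous_pKernel hz).mul continuous_const).intervalIntegrable _ _).add
        (hp.const_mul _))) ?_
    filter_upwards [ae_Ioo_of_Ioc] with s hs
    have hK := pKernel_nonneg hz s
    have hps := hp0 s
    rcases lt_or_ge (dist (Circle.exp s) ξ) δ with hd | hd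
    · have := hδ' s hs hd
      have h3 : 0 ≤ (1 - ‖z‖ ^ 2) * (4 / δ ^ 2) * p s := by positivity
      show pKernel z s * p s ≤ pKernel z s * (ε / 2) + (1 - ‖z‖ ^ 2) * (4 / δ ^ 2) * p s
      nlinarith
    · have h4 : δ / 2 ≤ ‖(Circle.exp s : ℂ) - z‖ := by
        rw [dist_circle] at hd
        have := dist_triangle (Circle.exp s : ℂ) z ξ
        rw [Metric.mem_ball] at hzδ
        rw [← dist_eq_norm]
        linarith
      have h5 : pKernel z s ≤ (1 - ‖z‖ ^ 2) * (4 / δ ^ 2) := by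
        have h6 : 0 < ‖(Circle.exp s : ℂ) - z‖ := (half_pos hδ).trans_le h4
        rw [pKernel_eq, div_eq_mul_inv]
        gcongr
        rw [inv_le_comm₀ (by positivity) (by positivity), inv_div]
        calc δ ^ 2 / 4 = (δ / 2) ^ 2 := by ring
          _ ≤ _ := by gcongr
      show pKernel z s * p s ≤ pKernel z s * (ε / 2) + (1 - ‖z‖ ^ 2) * (4 / δ ^ 2) * p s
      nlinarith
  have h0 : 0 ≤ pIntegral p z := by
    have := norm_pIntegral_le p hz
    simp only [Real.norm_of_nonneg (hp0 _)] at this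
    exact (norm_nonneg _).trans this
  rw [Real.dist_eq, sub_zero, abs_of_nonneg h0]
  linarith

lemma tendsto_pIntegral [CompleteSpace E] {q : ℝ → E} {c : E}
    (hq : IntervalIntegrable q volume 0 (2 * Real.pi)) {ξ : Circle}
    (hs : SmallNear (fun s => ‖q s - c‖) ξ) :
    Tendsto (pIntegral q) (𝓝[Metric.ball 0 1] (ξ : ℂ)) (𝓝 c) := by
  rw [tendsto_iff_norm_sub_tendsto_zero]
  refine squeeze_zero' (Eventually.of_forall fun _ => norm_nonneg _) ?_
    (tendsto_pIntegral_zero (fun s => norm_nonneg _) (hq.sub intervalIntegrable_const).norm hs)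
  filter_upwards [self_mem_nhdsWithin] with z hz
  have hz : ‖z‖ < 1 := by simpa using hz
  rw [← pIntegral_sub_const hz hq c]
  exact norm_pIntegral_le _ hz

lemma tendsto_radial (ξ : Circle) :
    Tendsto (fun r : ℝ => (r : ℂ) * ξ) (𝓝[<] 1) (𝓝[Metric.ball 0 1] (ξ : ℂ)) := by
  refine tendsto_nhdsWithin_iff.2 ⟨?_, ?_⟩
  · have : Continuous fun r : ℝ => (r : ℂ) * ξ := by fun_prop
    simpa using (this.tendsto 1).mono_left nhdsWithin_le_nhds
  · filter_upwards [Ioo_mem_nhdsLT (show (0 : ℝ) < 1 by norm_num)] with r hr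
    rw [mem_ball_zero_iff, norm_mul, Circle.norm_coe, Complex.norm_real,
      Real.norm_of_nonneg hr.1.le, mul_one]
    exact hr.2

/-- A radius sequence increasing to `1`. -/
lemma exists_radii : ∃ r : ℕ → ℝ, (∀ n, r n ∈ Ioo (0 : ℝ) 1) ∧ Tendsto r atTop (𝓝[<] 1) := by
  have : (𝓝[<] (1 : ℝ)).NeBot := inferInstance
  obtain ⟨r, -, h1, h2⟩ := exists_seq_strictMono_tendsto' (show (0 : ℝ) < 1 by norm_num)
  exact ⟨r, h1, tendsto_nhdsWithin_iff.2 ⟨h2, Eventually.of_forall fun n => (h1 n).2⟩⟩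

/-- A bounded analytic function in the disk is the Poisson integral of its radial limits. -/
lemma eq_pIntegral_of_radial {F : ℂ → ℂ} (hF : DifferentiableOn ℂ F (Metric.ball 0 1)) {M : ℝ}
    (hM : ∀ z, ‖z‖ < 1 → ‖F z‖ ≤ M) {b : ℝ → ℂ}
    (hb : ∀ᵐ s ∂volume.restrict (Ioc 0 (2 * Real.pi)),
      Tendsto (fun r : ℝ => F (r * Circle.exp s)) (𝓝[<] 1) (𝓝 (b s))) :
    IntervalIntegrable b volume 0 (2 * Real.pi) ∧
      ∀ z, ‖z‖ < 1 → F z = pIntegral b z := by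
  have hpi := Real.pi_pos
  obtain ⟨r, hr, hr1⟩ := exists_radii
  have hmem : ∀ n (w : ℂ), ‖w‖ ≤ 1 → (r n : ℂ) * w ∈ Metric.ball (0 : ℂ) 1 := by
    intro n w hw
    have := hr n
    rw [mem_ball_zero_iff, norm_mul, Complex.norm_real, Real.norm_of_nonneg this.1.le]
    nlinarith [this.1, this.2]
  have hFr : ∀ n, DiffContOnCl ℂ (fun w => F (r n * w)) (Metric.ball 0 1) := by
    intro n
    refine DifferentiableOn.diffContOnCl ?_
    rw [closure_ball (0 : ℂ) one_ne_zero]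
    exact hF.comp (by fun_prop) fun w hw => hmem n w (by simpa using hw)
  -- The dilates `F(r_n w)` are analytic across the circle, so the Poisson formula holds for them.
  -- It passes to the limit by dominated convergence, with majorant `M` times the kernel.
  have hcont : ∀ n, Continuous fun s : ℝ => F (r n * Circle.exp s) := by
    intro n
    refine continuous_iff_continuousAt.2 fun s => ?_
    have h1 : ContinuousAt F (r n * Circle.exp s) :=
      (hF.differentiableAt (Metric.isOpen_ball.mem_nhds (hmem n _ (by simp)))).continuousAt
    exact h1.comp (f := fun s : ℝ => (r n : ℂ) * Circle.exp s)
      (Continuous.continuousAt (by fun_prop))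
  have hb' : ∀ᵐ s ∂volume.restrict (Ioc 0 (2 * Real.pi)),
      Tendsto (fun n => F (r n * Circle.exp s)) atTop (𝓝 (b s)) := by
    filter_upwards [hb] with s hs
    exact hs.comp hr1
  have hbm : AEStronglyMeasurable b (volume.restrict (Ioc 0 (2 * Real.pi))) :=
    aestronglyMeasurable_of_tendsto_ae atTop (fun n => (hcont n).aestronglyMeasurable) hb'
  have hbM : ∀ᵐ s ∂volume.restrict (Ioc 0 (2 * Real.pi)), ‖b s‖ ≤ M := by
    filter_upwards [hb'] with s hs
    exact le_of_tendsto hs.norm (Eventually.of_forall fun n =>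
      hM _ (by simpa using hmem n (Circle.exp s) (by simp)))
  have hbi : IntervalIntegrable b volume 0 (2 * Real.pi) := by
    rw [intervalIntegrable_iff_integrableOn_Ioc_of_le (by positivity)]
    exact Integrable.of_bound hbm M hbM
  refine ⟨hbi, fun z hz => ?_⟩
  have h1 : Tendsto (fun n => F (r n * z)) atTop (𝓝 (F z)) := by
    have h1 : ContinuousAt F z :=
      (hF.differentiableAt (Metric.isOpen_ball.mem_nhds (by simpa using hz))).continuousAt
    have h2 : Tendsto (fun n => (r n : ℂ) * z) atTop (𝓝 z) := by
      have h3 : Tendsto r atTop (𝓝 1) := hr1.mono_right nhdsWithin_le_nhds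
      have h4 := (Complex.continuous_ofReal.tendsto 1).comp h3
      simpa using h4.mul_const z
    exact h1.tendsto.comp h2
  have h2 : Tendsto (fun n => pIntegral (fun s => F (r n * Circle.exp s)) z) atTop
      (𝓝 (pIntegral b z)) := by
    simp only [pIntegral]
    refine Tendsto.const_smul ?_ _
    refine intervalIntegral.tendsto_integral_filter_of_dominated_convergence
      (fun s => pKernel z s * M) ?_ ?_ ?_ ?_
    · exact Eventually.of_forall fun n =>
        ((continuous_pKernel hz).smul (hcont n)).aestronglyMeasurable
    · refine Eventually.of_forall fun n => Eventually.of_forall fun s _ => ?_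
      rw [norm_smul, Real.norm_of_nonneg (pKernel_nonneg hz s)]
      exact mul_le_mul_of_nonneg_left (hM _ (by simpa using hmem n (Circle.exp s) (by simp)))
        (pKernel_nonneg hz s)
    · exact ((continuous_pKernel hz).mul continuous_const).intervalIntegrable _ _
    · rw [uIoc_of_le (by positivity)]
      filter_upwards [(ae_restrict_iff' measurableSet_Ioc).1 hb'] with s hs hs'
      exact (hs hs').const_smul _
  have h3 : ∀ n, pIntegral (fun s => F (r n * Circle.exp s)) z = F (r n * z) := fun n =>
    pIntegral_eq_of_diffContOnCl (F := fun w => F (r n * w)) (hFr n) hz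
  simp only [h3] at h2
  exact tendsto_nhds_unique h1 h2

end Poisson

/-! ### The logarithm of the weight and the outer function in the disk. -/

section LogH

variable {h : Circle → ℝ}

/-- `log h` as a function of the angle. -/
noncomputable def logAngle (h : Circle → ℝ) (s : ℝ) : ℝ := Real.log (h (Circle.exp s))

lemma logAngle_periodic (h : Circle → ℝ) : Function.Periodic (logAngle h) (2 * Real.pi) := by
  intro s
  simp only [logAngle, Circle.exp_add_two_pi]

lemma LogIntegrable.intervalIntegrable (hh : LogIntegrable h) (a b : ℝ) :
    IntervalIntegrable (logAngle h) volume a b := by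
  have hp : (0 : ℝ) < 2 * Real.pi := Real.two_pi_pos
  refine (logAngle_periodic h).intervalIntegrable₀ hp.ne' ?_ a b
  rw [intervalIntegrable_iff_integrableOn_Ioc_of_le hp.le]
  exact hh.2

/-- The null set in one period is carried to the whole line by countably many translations. -/
lemma LogIntegrable.ae_ne_zero (hh : LogIntegrable h) : ∀ᵐ s : ℝ, h (Circle.exp s) ≠ 0 := by
  have hp : (0 : ℝ) < 2 * Real.pi := Real.two_pi_pos
  have h0 := (ae_restrict_iff' measurableSet_Ioc).1 hh.1
  have h1 : ∀ n : ℤ, ∀ᵐ s : ℝ, s + n * (2 * Real.pi) ∈ Ioc 0 (2 * Real.pi) →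
      h (Circle.exp (s + n * (2 * Real.pi))) ≠ 0 := fun n =>
    (measurePreserving_add_right volume ((n : ℝ) * (2 * Real.pi))).quasiMeasurePreserving.ae h0
  rw [← ae_all_iff] at h1
  filter_upwards [h1] with s hs
  obtain ⟨n, hn, -⟩ := existsUnique_add_zsmul_mem_Ioc hp s 0
  rw [zero_add, zsmul_eq_mul] at hn
  have h2 := hs n hn
  rwa [Circle.periodic_exp.int_mul n s] at h2

lemma uDisk_eq (z : ℂ) : uDisk h z = pIntegral (logAngle h) z := by
  rw [uDisk, pIntegral, intervalIntegral.integral_of_le Real.two_pi_pos.le, one_div]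
  rfl

lemma smallNear_of_continuousAt {E : Type*} [NormedAddCommGroup E] {q : Circle → E} {ξ : Circle}
    (hq : ContinuousAt q ξ) : SmallNear (fun s => ‖q (Circle.exp s) - q ξ‖) ξ := by
  intro ε hε
  obtain ⟨δ, hδ, h⟩ := Metric.continuousAt_iff.1 hq ε hε
  exact ⟨δ, hδ, fun s _ hs => (dist_eq_norm (q (Circle.exp s)) (q ξ)).symm.le.trans (h hs).le⟩

lemma tendsto_uDisk (hc : Continuous h) (hh : LogIntegrable h) {ξ : Circle} (hξ : h ξ ≠ 0) :
    Tendsto (uDisk h) (𝓝[Metric.ball 0 1] (ξ : ℂ)) (𝓝 (Real.log (h ξ))) := by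
  have hq : ContinuousAt (fun ζ => Real.log (h ζ)) ξ := hc.continuousAt.log hξ
  have := tendsto_pIntegral (hh.intervalIntegrable 0 (2 * Real.pi)) (smallNear_of_continuousAt hq)
  exact this.congr fun z => (uDisk_eq z).symm

lemma uDisk_le {M : ℝ} (hh : LogIntegrable h) (h0 : ∀ ξ, 0 ≤ h ξ)
    (hM : ∀ ξ, h ξ ≤ M) {z : ℂ} (hz : ‖z‖ < 1) : uDisk h z ≤ Real.log M := by
  rw [uDisk_eq, ← pIntegral_const (Real.log M) hz]
  refine pIntegral_mono hz (hh.intervalIntegrable _ _) intervalIntegrable_const ?_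
  filter_upwards [hh.1] with s hs
  exact Real.log_le_log ((h0 _).lt_of_ne hs.symm) (hM _)

lemma norm_outerPow_disk {ρ : ℝ} {z : ℂ} (hz : ‖z‖ < 1) :
    ‖outerPow h ρ z‖ = Real.exp (ρ * uDisk h z) := by
  rw [outerPow, if_pos hz, Complex.norm_exp]
  simp

lemma outerPow_circle (ρ : ℝ) (ξ : Circle) : outerPow h ρ ξ = if h ξ = 0 then 0 else
    ((h ξ ^ ρ : ℝ) : ℂ) * Complex.exp ((ρ : ℂ) * (vBdry h ξ : ℂ) * Complex.I) := by
  rw [outerPow, if_neg (Circle.norm_coe ξ).not_lt, Circle.exp_arg]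

lemma norm_outerPow_circle {ρ : ℝ} (hρ : ρ ≠ 0) (h0 : ∀ ξ, 0 ≤ h ξ) (ξ : Circle) :
    ‖outerPow h ρ ξ‖ = h ξ ^ ρ := by
  rw [outerPow_circle]
  split_ifs with hξ
  · rw [hξ, Real.zero_rpow hρ, norm_zero]
  · rw [norm_mul, Complex.norm_real, Real.norm_of_nonneg (Real.rpow_nonneg (h0 ξ) _),
      ← Complex.ofReal_mul, Complex.norm_exp_ofReal_mul_I, mul_one]

lemma differentiableOn_outerPow (hh : LogIntegrable h) (ρ : ℝ) :
    DifferentiableOn ℂ (outerPow h ρ) (Metric.ball 0 1) := by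
  -- The exponent is the circle average of the Herglotz kernel against `log h`, which is analytic.
  -- Here the data are written as a function on the plane through the argument.
  set g : ℂ → ℂ := fun ζ => (Real.log (h (Circle.exp ζ.arg)) : ℂ) with hg
  have hgs : ∀ s : ℝ, g (circleMap 0 1 s) = (logAngle h s : ℂ) := by
    intro s
    rw [circleMap_zero_one, hg]
    simp only [Circle.exp_arg, logAngle]
  have hLi : IntervalIntegrable (fun s => (logAngle h s : ℂ)) volume 0 (2 * Real.pi) :=
    ⟨(hh.intervalIntegrable 0 (2 * Real.pi)).1.ofReal,
      (hh.intervalIntegrable 0 (2 * Real.pi)).2.ofReal⟩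
  have hgi : CircleIntegrable g 0 1 := by
    unfold CircleIntegrable
    simp only [hgs]
    exact hLi
  have hd := differentiableOn_circleAverage_herglotzRieszKernel_smul hgi
  refine ((hd.const_mul (ρ : ℂ)).cexp).congr fun z hz => ?_
  have hz : ‖z‖ < 1 := by simpa using hz
  rw [outerPow, if_pos hz]
  congr 2
  set K : ℝ → ℂ := fun s => ((Circle.exp s : ℂ) + z) / ((Circle.exp s : ℂ) - z) with hK
  have hKc : Continuous K := Continuous.div (by fun_prop) (by fun_prop) (exp_sub_ne_zero hz)
  have hi : IntervalIntegrable (fun s => K s * (logAngle h s : ℂ)) volume 0 (2 * Real.pi) :=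
    hLi.continuousOn_mul hKc.continuousOn
  have hI : (∫ s in 0..2 * Real.pi, herglotzRieszKernel 0 z (circleMap 0 1 s) •
      g (circleMap 0 1 s)) = ∫ s in 0..2 * Real.pi, K s * (logAngle h s : ℂ) := by
    refine intervalIntegral.integral_congr fun s _ => ?_
    simp only [hgs]
    simp only [herglotzRieszKernel_def, circleMap_zero_one, sub_zero, smul_eq_mul, hK]
  have hre : uDisk h z = (2 * Real.pi)⁻¹ *
      (∫ s in 0..2 * Real.pi, K s * (logAngle h s : ℂ)).re := by
    have := intervalIntegral.intervalIntegral_re hi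
    rw [uDisk, one_div, ← intervalIntegral.integral_of_le Real.two_pi_pos.le]
    congr 1
    refine Eq.trans (intervalIntegral.integral_congr fun s _ => ?_) this
    simp [hK, logAngle]
  have him : vDisk h z = (2 * Real.pi)⁻¹ *
      (∫ s in 0..2 * Real.pi, K s * (logAngle h s : ℂ)).im := by
    have := intervalIntegral.intervalIntegral_im hi
    rw [vDisk, one_div, ← intervalIntegral.integral_of_le Real.two_pi_pos.le]
    congr 1
    refine Eq.trans (intervalIntegral.integral_congr fun s _ => ?_) this
    simp [hK, logAngle]
  rw [Real.circleAverage_def, hI, hre, him]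
  apply Complex.ext <;> simp

end LogH

/-! ### The kernel `cot (t / 2)`. -/

section Cotangent

/-- `cot (t / 2)`. -/
noncomputable def cotHalf (t : ℝ) : ℝ := Real.cos (t / 2) / Real.sin (t / 2)

lemma div_tan_eq (x t : ℝ) : x / Real.tan (t / 2) = x * cotHalf t := by
  rw [Real.tan_eq_sin_div_cos, cotHalf, div_div_eq_mul_div, mul_div_assoc]

lemma cotHalf_add_two_pi (t : ℝ) : cotHalf (t + 2 * Real.pi) = cotHalf t := by
  rw [cotHalf, cotHalf, show (t + 2 * Real.pi) / 2 = t / 2 + Real.pi by ring, Real.cos_add_pi,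
    Real.sin_add_pi, neg_div_neg_eq]

lemma cotHalf_neg (t : ℝ) : cotHalf (-t) = -cotHalf t := by
  rw [cotHalf, cotHalf, neg_div, Real.cos_neg, Real.sin_neg, div_neg]

lemma cotHalf_two_pi_sub (t : ℝ) : cotHalf (2 * Real.pi - t) = -cotHalf t := by
  rw [← cotHalf_neg, ← cotHalf_add_two_pi (-t)]
  congr 1; ring

lemma sin_half_pos {t : ℝ} (h0 : 0 < t) (h1 : t < 2 * Real.pi) : 0 < Real.sin (t / 2) :=
  Real.sin_pos_of_pos_of_lt_pi (by linarith) (by linarith)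

lemma continuousOn_cotHalf : ContinuousOn cotHalf (Ioo 0 (2 * Real.pi)) := by
  unfold cotHalf
  exact ContinuousOn.div (by fun_prop) (by fun_prop) fun t ht => (sin_half_pos ht.1 ht.2).ne'

lemma le_sin_half {t δ : ℝ} (h0 : 0 ≤ δ) (h1 : δ ≤ t) (h2 : t ≤ 2 * Real.pi - δ) :
    δ / Real.pi ≤ Real.sin (t / 2) := by
  have hp := Real.pi_pos
  have key : ∀ u, δ ≤ u → u ≤ Real.pi → δ / Real.pi ≤ Real.sin (u / 2) := by
    intro u hu hu2
    have := Real.mul_le_sin (x := u / 2) (by linarith) (by linarith)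
    refine le_trans ?_ this
    rw [div_mul_div_comm, mul_comm Real.pi, mul_div_mul_left _ _ two_ne_zero]
    gcongr
  rcases le_total t Real.pi with h | h
  · exact key t h1 h
  · have := key (2 * Real.pi - t) (by linarith) (by linarith)
    rwa [show (2 * Real.pi - t) / 2 = Real.pi - t / 2 by ring, Real.sin_pi_sub] at this

lemma abs_cotHalf_le {t δ : ℝ} (h0 : 0 < δ) (h1 : δ ≤ t) (h2 : t ≤ 2 * Real.pi - δ) :
    |cotHalf t| ≤ Real.pi / δ := by
  have h3 := le_sin_half h0.le h1 h2
  have h4 : 0 < Real.sin (t / 2) := lt_of_lt_of_le (by have := Real.pi_pos; positivity) h3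
  rw [cotHalf, abs_div, abs_of_pos h4, div_le_div_iff₀ h4 h0]
  have h5 := Real.abs_cos_le_one (t / 2)
  rw [div_le_iff₀ Real.pi_pos] at h3
  nlinarith

lemma integral_symm_zero {q : ℝ → ℝ} (hq : ∀ t, q (2 * Real.pi - t) = -q t) (δ : ℝ) :
    ∫ t in δ..2 * Real.pi - δ, q t = 0 := by
  have h1 := intervalIntegral.integral_comp_sub_left (a := δ) (b := 2 * Real.pi - δ) q
    (2 * Real.pi)
  simp only [hq, intervalIntegral.integral_neg, sub_sub_cancel] at h1
  linarith

end Cotangent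

/-! ### Truncated conjugate integrals. -/

section Conjugate

variable {h : Circle → ℝ}

lemma uIcc_subset_Ioo_two_pi {a b : ℝ} (ha : 0 < a) (ha' : a < 2 * Real.pi) (hb : 0 < b)
    (hb' : b < 2 * Real.pi) : uIcc a b ⊆ Ioo 0 (2 * Real.pi) := by
  intro t ht
  rw [uIcc, mem_Icc] at ht
  exact ⟨(lt_min ha hb).trans_le ht.1, ht.2.trans_lt (max_lt ha' hb')⟩

lemma LogIntegrable.shift (hh : LogIntegrable h) (θ a b : ℝ) :
    IntervalIntegrable (fun t => logAngle h (θ + t)) volume a b := by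
  have := (hh.intervalIntegrable (a + θ) (b + θ)).comp_add_right θ
  simpa [add_comm] using this

lemma LogIntegrable.mul_cotHalf (hh : LogIntegrable h) (θ : ℝ) {a b : ℝ} (ha : 0 < a)
    (ha' : a < 2 * Real.pi) (hb : 0 < b) (hb' : b < 2 * Real.pi) :
    IntervalIntegrable (fun t => logAngle h (θ + t) * cotHalf t) volume a b :=
  (hh.shift θ a b).mul_continuousOn
    (continuousOn_cotHalf.mono (uIcc_subset_Ioo_two_pi ha ha' hb hb'))

/-- The negative half is translated by `2π`, leaving one interval symmetric about `π`. The kernel is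
odd about `π`, which is why constants may later be subtracted from `log h`. -/
lemma vTrunc_eq (hh : LogIntegrable h) (θ : ℝ) {ε : ℝ} (h0 : 0 < ε) (h1 : ε ≤ Real.pi) :
    vTrunc h (Circle.exp θ) ε =
      -((2 * Real.pi)⁻¹ * ∫ t in ε..2 * Real.pi - ε, logAngle h (θ + t) * cotHalf t) := by
  have hp := Real.pi_pos
  have hset : {t : ℝ | ε ≤ |t| ∧ |t| ≤ Real.pi} = Icc (-Real.pi) (-ε) ∪ Icc ε Real.pi := by
    ext t
    simp only [mem_ofPred_eq, mem_union, mem_Icc]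
    constructor
    · rintro ⟨ha, hb⟩
      rcases abs_cases t with ⟨h2, -⟩ | ⟨h2, -⟩
      · right; constructor <;> linarith
      · left; constructor <;> linarith
    · rintro (⟨ha, hb⟩ | ⟨ha, hb⟩)
      · rw [abs_of_neg (by linarith)]; constructor <;> linarith
      · rw [abs_of_pos (by linarith)]; constructor <;> linarith
  have hF : (fun t => Real.log (h (Circle.exp θ * Circle.exp t)) / Real.tan (t / 2))
      = fun t => logAngle h (θ + t) * cotHalf t := by
    ext t
    rw [div_tan_eq, logAngle, Circle.exp_add]
  have hper : Function.Periodic (fun t => logAngle h (θ + t) * cotHalf t) (2 * Real.pi) := by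
    intro t
    simp only [cotHalf_add_two_pi, ← add_assoc, logAngle_periodic h (θ + t)]
  have i1 : IntervalIntegrable (fun t => logAngle h (θ + t) * cotHalf t) volume ε Real.pi :=
    hh.mul_cotHalf θ h0 (by linarith) hp (by linarith)
  have i2 : IntervalIntegrable (fun t => logAngle h (θ + t) * cotHalf t) volume Real.pi
      (2 * Real.pi - ε) := hh.mul_cotHalf θ hp (by linarith) (by linarith) (by linarith)
  have hshift : ∀ a b, (∫ t in a..b, logAngle h (θ + t) * cotHalf t)
      = ∫ t in a + 2 * Real.pi..b + 2 * Real.pi, logAngle h (θ + t) * cotHalf t := by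
    intro a b
    rw [← intervalIntegral.integral_comp_add_right (fun t => logAngle h (θ + t) * cotHalf t)]
    exact intervalIntegral.integral_congr fun t _ => (hper t).symm
  have i3 : IntervalIntegrable (fun t => logAngle h (θ + t) * cotHalf t) volume (-Real.pi) (-ε) := by
    have := i2.comp_add_right (2 * Real.pi)
    rw [show Real.pi - 2 * Real.pi = -Real.pi by ring,
      show 2 * Real.pi - ε - 2 * Real.pi = -ε by ring] at this
    exact this.congr fun t _ => hper t
  rw [vTrunc, hset, hF, one_div, setIntegral_union ?_ measurableSet_Icc
    ((intervalIntegrable_iff_integrableOn_Icc_of_le (by linarith)).1 i3)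
    ((intervalIntegrable_iff_integrableOn_Icc_of_le h1).1 i1), integral_Icc_eq_integral_Ioc,
    integral_Icc_eq_integral_Ioc, ← intervalIntegral.integral_of_le (by linarith),
    ← intervalIntegral.integral_of_le h1, hshift, show -Real.pi + 2 * Real.pi = Real.pi by ring,
    show -ε + 2 * Real.pi = 2 * Real.pi - ε by ring, add_comm,
    intervalIntegral.integral_add_adjacent_intervals i1 i2]
  rw [Set.disjoint_left]
  rintro t ⟨-, h2⟩ ⟨h3, -⟩
  linarith

/-- Subtracting a constant does not change the truncated integral. -/
lemma vTrunc_eq_sub (hh : LogIntegrable h) (θ c : ℝ) {ε : ℝ} (h0 : 0 < ε) (h1 : ε ≤ Real.pi) :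
    vTrunc h (Circle.exp θ) ε =
      -((2 * Real.pi)⁻¹ * ∫ t in ε..2 * Real.pi - ε, (logAngle h (θ + t) - c) * cotHalf t) := by
  have hp := Real.pi_pos
  rw [vTrunc_eq hh θ h0 h1]
  simp only [sub_mul]
  rw [intervalIntegral.integral_sub (hh.mul_cotHalf θ h0 (by linarith) (by linarith) (by linarith))
    (g := fun t => c * cotHalf t) ((continuousOn_const.mul (continuousOn_cotHalf.mono
      (uIcc_subset_Ioo_two_pi h0 (by linarith) (by linarith) (by linarith)))).intervalIntegrable),
    intervalIntegral.integral_const_mul, integral_symm_zero cotHalf_two_pi_sub, mul_zero, sub_zero]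

lemma kernel_den_pos {r : ℝ} (h0 : 0 ≤ r) (h1 : r < 1) (t : ℝ) :
    0 < 1 - 2 * r * Real.cos t + r ^ 2 := by
  nlinarith [Real.cos_le_one t]

/-- Rotating by `e^{iθ}` leaves only the angle difference `t`; the real part is the Poisson kernel
and the imaginary part is minus the conjugate kernel. -/
lemma herglotz_polar {r : ℝ} (h0 : 0 ≤ r) (h1 : r < 1) (θ t : ℝ) :
    (((Circle.exp (θ + t) : ℂ) + r * Circle.exp θ) / ((Circle.exp (θ + t) : ℂ) - r * Circle.exp θ))
      = ((1 - r ^ 2) / (1 - 2 * r * Real.cos t + r ^ 2) : ℝ)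
        + (-(2 * r * Real.sin t / (1 - 2 * r * Real.cos t + r ^ 2)) : ℝ) * Complex.I := by
  have hd := (kernel_den_pos h0 h1 t).ne'
  have hne := exp_sub_ne_zero (z := r * Circle.exp θ)
    (by simpa [abs_of_nonneg h0] using h1) (θ + t)
  have hd' : ((1 : ℂ) - 2 * r * Complex.cos t + r ^ 2) ≠ 0 := by exact_mod_cast hd
  rw [div_eq_iff hne, Circle.exp_add, Circle.coe_mul, Circle.coe_exp t, Complex.exp_mul_I]
  push_cast
  have e1 : ((1 - (r : ℂ) ^ 2) / (1 - 2 * r * Complex.cos t + r ^ 2)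
      + -(2 * r * Complex.sin t / (1 - 2 * r * Complex.cos t + r ^ 2)) * Complex.I)
      = (1 - (r : ℂ) ^ 2 - 2 * r * Complex.sin t * Complex.I)
        / (1 - 2 * r * Complex.cos t + r ^ 2) := by ring
  rw [e1, div_mul_eq_mul_div, eq_div_iff hd']
  have hs := Complex.sin_sq_add_cos_sq (t : ℂ)
  linear_combination Complex.exp (θ * Complex.I) *
    (-2 * (r : ℂ) * hs + 2 * r * Complex.sin t ^ 2 * Complex.I_sq)

end Conjugate

/-! ### Radial limits of the conjugate function and of the outer function. -/

section ConjugateLimit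

variable {h : Circle → ℝ}

/-- The conjugate Poisson kernel. -/
noncomputable def conjKernel (r t : ℝ) : ℝ :=
  2 * r * Real.sin t / (1 - 2 * r * Real.cos t + r ^ 2)

lemma continuous_conjKernel {r : ℝ} (h0 : 0 ≤ r) (h1 : r < 1) : Continuous (conjKernel r) :=
  Continuous.div (by fun_prop) (by fun_prop) fun t => (kernel_den_pos h0 h1 t).ne'

lemma conjKernel_two_pi_sub (r t : ℝ) : conjKernel r (2 * Real.pi - t) = -conjKernel r t := by
  simp only [conjKernel, Real.sin_two_pi_sub, Real.cos_two_pi_sub]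
  ring

lemma pKernel_polar {r : ℝ} (h0 : 0 ≤ r) (h1 : r < 1) (θ t : ℝ) :
    pKernel (r * Circle.exp θ) (θ + t) = (1 - r ^ 2) / (1 - 2 * r * Real.cos t + r ^ 2) := by
  rw [pKernel, herglotz_polar h0 h1]
  simp only [Complex.add_re, Complex.ofReal_re, Complex.mul_re, Complex.I_re, Complex.ofReal_im,
    Complex.I_im, mul_zero, zero_mul, sub_self, add_zero]

lemma integral_two_pi_shift {F : ℝ → ℝ} (hF : Function.Periodic F (2 * Real.pi)) (θ : ℝ) :
    ∫ s in 0..2 * Real.pi, F s = ∫ t in 0..2 * Real.pi, F (θ + t) := by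
  rw [intervalIntegral.integral_comp_add_left, add_zero]
  simpa using hF.intervalIntegral_add_eq 0 θ

lemma norm_radial_lt {r : ℝ} (h0 : 0 ≤ r) (h1 : r < 1) (ξ : Circle) : ‖(r : ℂ) * ξ‖ < 1 := by
  rw [norm_mul, Circle.norm_coe, Complex.norm_real, Real.norm_of_nonneg h0, mul_one]
  exact h1

lemma pIntegral_polar {p : ℝ → ℝ} (hp : Function.Periodic p (2 * Real.pi)) {r : ℝ} (h0 : 0 ≤ r)
    (h1 : r < 1) (θ : ℝ) : pIntegral p (r * Circle.exp θ) = (2 * Real.pi)⁻¹ *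
      ∫ t in 0..2 * Real.pi, (1 - r ^ 2) / (1 - 2 * r * Real.cos t + r ^ 2) * p (θ + t) := by
  have hper : Function.Periodic (fun s => pKernel (r * Circle.exp θ) s * p s) (2 * Real.pi) := by
    intro s
    simp only [pKernel, hp s, Circle.exp_add_two_pi]
  simp only [pIntegral, smul_eq_mul]
  rw [integral_two_pi_shift hper θ]
  simp only [pKernel_polar h0 h1]

lemma vDisk_polar (hh : LogIntegrable h) {r : ℝ} (h0 : 0 ≤ r) (h1 : r < 1) (θ c : ℝ) :
    vDisk h (r * Circle.exp θ) = -((2 * Real.pi)⁻¹ *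
      ∫ t in 0..2 * Real.pi, (logAngle h (θ + t) - c) * conjKernel r t) := by
  have hi := (hh.shift θ 0 (2 * Real.pi)).mul_continuousOn
    (continuous_conjKernel h0 h1).continuousOn
  have hz : ∫ t in 0..2 * Real.pi, conjKernel r t = 0 := by
    have := integral_symm_zero (conjKernel_two_pi_sub r) 0
    rwa [sub_zero] at this
  simp only [sub_mul]
  rw [intervalIntegral.integral_sub hi (g := fun t => c * conjKernel r t)
    ((continuous_const.mul (continuous_conjKernel h0 h1)).intervalIntegrable _ _),
    intervalIntegral.integral_const_mul, hz, mul_zero, sub_zero, vDisk, one_div,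
    ← intervalIntegral.integral_of_le Real.two_pi_pos.le, ← mul_neg,
    ← intervalIntegral.integral_neg]
  congr 1
  rw [integral_two_pi_shift _ θ]
  · refine intervalIntegral.integral_congr fun t _ => ?_
    simp only [herglotz_polar h0 h1]
    simp only [Complex.add_im, Complex.ofReal_im, Complex.mul_im, Complex.ofReal_re,
      Complex.I_im, Complex.I_re, mul_one, mul_zero, zero_add, add_zero, logAngle, conjKernel]
    ring
  · intro s
    simp only [Circle.exp_add_two_pi]

/-- With `1 - 2r cos t + r² = (1-r)² + 4r sin²(t/2)`, the difference loses everything but the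
`(1-r)²` term. -/
lemma conjKernel_sub_cotHalf {r : ℝ} (h0 : 0 ≤ r) (h1 : r < 1) {t : ℝ}
    (ht : t ∈ Ioo 0 (2 * Real.pi)) : conjKernel r t - cotHalf t =
      -(cotHalf t * (1 - r) ^ 2 / (1 - 2 * r * Real.cos t + r ^ 2)) := by
  have hd := (kernel_den_pos h0 h1 t).ne'
  have hs := (sin_half_pos ht.1 ht.2).ne'
  have e1 : Real.sin t = 2 * Real.sin (t / 2) * Real.cos (t / 2) := by
    rw [← Real.sin_two_mul]; congr 1; ring
  have e2 : Real.cos t = 1 - 2 * Real.sin (t / 2) ^ 2 := by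
    have := Real.cos_two_mul (t / 2)
    rw [show 2 * (t / 2) = t by ring] at this
    rw [this, Real.cos_sq']; ring
  rw [conjKernel, cotHalf]
  rw [e2] at hd ⊢
  rw [e1]
  field_simp
  ring

lemma abs_conjKernel_le {r : ℝ} (h0 : 0 ≤ r) (h1 : r < 1) {t : ℝ}
    (ht : |Real.sin t| ≤ 1 - r) :
    |conjKernel r t| ≤ 4 * ((1 - r ^ 2) / (1 - 2 * r * Real.cos t + r ^ 2)) := by
  have hd := kernel_den_pos h0 h1 t
  rw [conjKernel, abs_div, abs_of_pos hd, ← mul_div_assoc, abs_mul, abs_of_nonneg (by linarith)]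
  refine div_le_div_of_nonneg_right ?_ hd.le
  nlinarith [abs_nonneg (Real.sin t)]

lemma abs_conjKernel_sub_cotHalf_le {r : ℝ} (h0 : 0 ≤ r) (h1 : r < 1) {t : ℝ}
    (ht : 1 - r ≤ t) (ht2 : t ≤ 2 * Real.pi - (1 - r)) : |conjKernel r t - cotHalf t| ≤
      4 * ((1 - r ^ 2) / (1 - 2 * r * Real.cos t + r ^ 2)) := by
  have hd := kernel_den_pos h0 h1 t
  rw [conjKernel_sub_cotHalf h0 h1 ⟨by linarith, by linarith⟩, abs_neg, abs_div, abs_of_pos hd,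
    ← mul_div_assoc, abs_mul, abs_of_nonneg (sq_nonneg (1 - r))]
  refine div_le_div_of_nonneg_right ?_ hd.le
  have h2 := abs_cotHalf_le (by linarith) ht ht2
  have h3 : 0 < 1 - r := by linarith
  rw [le_div_iff₀ h3] at h2
  have h4 := Real.pi_le_four
  nlinarith [abs_nonneg (cotHalf t)]

lemma abs_integral_le_of_abs_le {f g : ℝ → ℝ} {a b : ℝ} (hab : a ≤ b)
    (h : ∀ t ∈ Ioc a b, |f t| ≤ g t) (hg : IntervalIntegrable g volume a b) :
    |∫ t in a..b, f t| ≤ ∫ t in a..b, g t := by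
  rw [← Real.norm_eq_abs]
  exact intervalIntegral.norm_integral_le_of_norm_le hab (Eventually.of_forall h) hg

/-- At distance at least `1 - r` from the singularity, four Poisson kernels dominate the difference
of the conjugate kernel and the cotangent. Closer in, they dominate the conjugate kernel itself. At
a continuity point of `log h`, with `c` its value there, the right side tends to `0` as `r → 1`. -/
lemma abs_vDisk_sub_vTrunc_le (hh : LogIntegrable h) {r : ℝ} (h0 : 0 ≤ r) (h1 : r < 1) (θ c : ℝ) :
    |vDisk h (r * Circle.exp θ) - vTrunc h (Circle.exp θ) (1 - r)| ≤
      4 * pIntegral (fun s => |logAngle h s - c|) (r * Circle.exp θ) := by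
  have hpi := Real.pi_gt_three
  set M : ℝ → ℝ := fun t => logAngle h (θ + t) - c with hM
  set P : ℝ → ℝ := fun t => (1 - r ^ 2) / (1 - 2 * r * Real.cos t + r ^ 2) with hP
  have hPc : Continuous P :=
    Continuous.div (by fun_prop) (by fun_prop) fun t => (kernel_den_pos h0 h1 t).ne'
  have hMi : ∀ a b, IntervalIntegrable M volume a b := fun a b =>
    (hh.shift θ a b).sub intervalIntegrable_const
  have hMP : ∀ a b, IntervalIntegrable (fun t => 4 * (P t * |M t|)) volume a b := fun a b =>
    ((hMi a b).abs.continuousOn_mul hPc.continuousOn).const_mul 4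
  have hQ : ∀ a b, IntervalIntegrable (fun t => M t * conjKernel r t) volume a b := fun a b =>
    (hMi a b).mul_continuousOn (continuous_conjKernel h0 h1).continuousOn
  have hC : IntervalIntegrable (fun t => M t * cotHalf t) volume (1 - r)
      (2 * Real.pi - (1 - r)) := (hMi _ _).mul_continuousOn (continuousOn_cotHalf.mono
      (uIcc_subset_Ioo_two_pi (by linarith) (by linarith) (by linarith) (by linarith)))
  rw [vDisk_polar hh h0 h1 θ c, vTrunc_eq_sub hh θ c (by linarith) (by linarith),
    pIntegral_polar _ h0 h1 θ]
  swap
  · intro s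
    simp only [logAngle_periodic h s]
  have e1 : (∫ t in 0..2 * Real.pi, M t * conjKernel r t)
      - (∫ t in (1 - r)..(2 * Real.pi - (1 - r)), M t * cotHalf t)
      = (∫ t in 0..(1 - r), M t * conjKernel r t)
        + (∫ t in (1 - r)..(2 * Real.pi - (1 - r)), M t * (conjKernel r t - cotHalf t))
        + ∫ t in (2 * Real.pi - (1 - r))..2 * Real.pi, M t * conjKernel r t := by
    simp only [mul_sub]
    rw [intervalIntegral.integral_sub (hQ _ _) hC, ← intervalIntegral.integral_add_adjacent_intervals
      (hQ 0 (1 - r)) (hQ (1 - r) (2 * Real.pi)), ← intervalIntegral.integral_add_adjacent_intervals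
      (hQ (1 - r) (2 * Real.pi - (1 - r))) (hQ _ _)]
    ring
  have e2 : (∫ t in 0..2 * Real.pi, 4 * (P t * |M t|)) = (∫ t in 0..(1 - r), 4 * (P t * |M t|))
        + (∫ t in (1 - r)..(2 * Real.pi - (1 - r)), 4 * (P t * |M t|))
        + ∫ t in (2 * Real.pi - (1 - r))..2 * Real.pi, 4 * (P t * |M t|) := by
    rw [intervalIntegral.integral_add_adjacent_intervals (hMP _ _) (hMP _ _),
      intervalIntegral.integral_add_adjacent_intervals (hMP _ _) (hMP _ _)]
  have b1 : |∫ t in 0..(1 - r), M t * conjKernel r t| ≤ ∫ t in 0..(1 - r), 4 * (P t * |M t|) := by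
    refine abs_integral_le_of_abs_le (by linarith) (fun t ht => ?_) (hMP _ _)
    have := abs_conjKernel_le h0 h1 (t := t) (by
      refine (Real.abs_sin_le_abs).trans ?_
      rw [abs_of_pos ht.1]; exact ht.2)
    rw [abs_mul]
    nlinarith [abs_nonneg (M t)]
  have b2 : |∫ t in (1 - r)..(2 * Real.pi - (1 - r)), M t * (conjKernel r t - cotHalf t)| ≤
      ∫ t in (1 - r)..(2 * Real.pi - (1 - r)), 4 * (P t * |M t|) := by
    refine abs_integral_le_of_abs_le (by linarith) (fun t ht => ?_) (hMP _ _)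
    have := abs_conjKernel_sub_cotHalf_le h0 h1 ht.1.le ht.2
    rw [abs_mul]
    nlinarith [abs_nonneg (M t)]
  have b3 : |∫ t in (2 * Real.pi - (1 - r))..2 * Real.pi, M t * conjKernel r t| ≤
      ∫ t in (2 * Real.pi - (1 - r))..2 * Real.pi, 4 * (P t * |M t|) := by
    refine abs_integral_le_of_abs_le (by linarith) (fun t ht => ?_) (hMP _ _)
    have := abs_conjKernel_le h0 h1 (t := t) (by
      have h3 := Real.abs_sin_le_abs (x := 2 * Real.pi - t)
      rw [Real.sin_two_pi_sub, abs_neg] at h3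
      refine h3.trans ?_
      rw [abs_of_nonneg (by linarith [ht.2])]; linarith [ht.1])
    rw [abs_mul]
    nlinarith [abs_nonneg (M t)]
  rw [neg_sub_neg, ← mul_sub, abs_mul, abs_of_pos (by positivity), abs_sub_comm, e1, mul_left_comm,
    ← intervalIntegral.integral_const_mul, e2]
  refine mul_le_mul_of_nonneg_left ?_ (by positivity)
  exact (abs_add_three _ _ _).trans (by linarith)

lemma tendsto_vBdry {ξ : Circle} (hv : VFinite h ξ) :
    Tendsto (vTrunc h ξ) (𝓝[>] 0) (𝓝 (vBdry h ξ)) :=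
  tendsto_nhds_limUnder hv

lemma tendsto_vDisk_radial (hc : Continuous h) (hh : LogIntegrable h) {ξ : Circle} (hξ : h ξ ≠ 0)
    (hv : VFinite h ξ) :
    Tendsto (fun r : ℝ => vDisk h (r * ξ)) (𝓝[<] 1) (𝓝 (vBdry h ξ)) := by
  obtain ⟨θ, -, -, rfl⟩ := exists_exp_eq ξ
  have hq : ContinuousAt (fun ζ => Real.log (h ζ)) (Circle.exp θ) := hc.continuousAt.log hξ
  have h1 := (tendsto_pIntegral_zero (fun s => norm_nonneg _)
    ((hh.intervalIntegrable 0 (2 * Real.pi)).sub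
      (intervalIntegrable_const (c := Real.log (h (Circle.exp θ))))).norm
    (smallNear_of_continuousAt hq)).comp (tendsto_radial (Circle.exp θ))
  have h2 : Tendsto (fun r : ℝ => 1 - r) (𝓝[<] 1) (𝓝[>] 0) := by
    refine tendsto_nhdsWithin_iff.2 ⟨?_, ?_⟩
    · have : Continuous fun r : ℝ => 1 - r := by fun_prop
      simpa using (this.tendsto 1).mono_left nhdsWithin_le_nhds
    · filter_upwards [self_mem_nhdsWithin] with r hr
      exact sub_pos.2 (mem_Iio.1 hr)
  have h3 := (tendsto_vBdry hv).comp h2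
  have h4 : Tendsto (fun r : ℝ => vDisk h (r * Circle.exp θ) - vTrunc h (Circle.exp θ) (1 - r))
      (𝓝[<] 1) (𝓝 0) := by
    refine squeeze_zero_norm' ?_ (by simpa using h1.const_mul 4)
    filter_upwards [Ioo_mem_nhdsLT (show (0 : ℝ) < 1 by norm_num)] with r hr
    exact abs_vDisk_sub_vTrunc_le hh hr.1.le hr.2 θ _
  have := h4.add h3
  rw [zero_add] at this
  refine this.congr fun r => ?_
  simp

/-- The outer function has its prescribed boundary value as radial limit off the zero set. -/
lemma tendsto_outerPow_radial (hc : Continuous h) (h0 : ∀ ξ, 0 ≤ h ξ) (hh : LogIntegrable h)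
    (ρ : ℝ) {ξ : Circle} (hξ : h ξ ≠ 0) (hv : VFinite h ξ) :
    Tendsto (fun r : ℝ => outerPow h ρ (r * ξ)) (𝓝[<] 1) (𝓝 (outerPow h ρ ξ)) := by
  have hpos : 0 < h ξ := (h0 ξ).lt_of_ne hξ.symm
  have hu := (tendsto_uDisk hc hh hξ).comp (tendsto_radial ξ)
  have hv := tendsto_vDisk_radial hc hh hξ hv
  have hlim : outerPow h ρ ξ = Complex.exp ((ρ : ℂ) *
      (((Real.log (h ξ) : ℝ) : ℂ) + (vBdry h ξ : ℂ) * Complex.I)) := by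
    rw [outerPow_circle, if_neg hξ, Real.rpow_def_of_pos hpos, Complex.ofReal_exp,
      ← Complex.exp_add]
    congr 1
    push_cast
    ring
  rw [hlim]
  have hmain : Tendsto (fun r : ℝ => Complex.exp ((ρ : ℂ) *
      ((uDisk h (r * ξ) : ℂ) + (vDisk h (r * ξ) : ℂ) * Complex.I))) (𝓝[<] 1)
      (𝓝 (Complex.exp ((ρ : ℂ) *
      (((Real.log (h ξ) : ℝ) : ℂ) + (vBdry h ξ : ℂ) * Complex.I)))) := by
    refine (Complex.continuous_exp.tendsto _).comp ?_
    refine Tendsto.const_mul _ ?_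
    exact ((Complex.continuous_ofReal.tendsto _).comp hu).add
      (((Complex.continuous_ofReal.tendsto _).comp hv).mul_const _)
  refine hmain.congr' ?_
  filter_upwards [Ioo_mem_nhdsLT (show (0 : ℝ) < 1 by norm_num)] with r hr
  rw [outerPow, if_pos (norm_radial_lt hr.1.le hr.2 ξ)]

end ConjugateLimit

/-! ### The local part of the conjugate function and the quantity `A`. -/

section Local

variable {h : Circle → ℝ}

/-- Between scales `ε` and `l` two pieces remain, one at each end of the period. Reflection `t ↦ 2π
- t` folds the second onto the first and produces the symmetric difference that appears in `A`. -/
lemma vTrunc_sub_vTrunc (hh : LogIntegrable h) (θ : ℝ) {ε l : ℝ} (h0 : 0 < ε) (h1 : ε ≤ l)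
    (h2 : l ≤ Real.pi) : vTrunc h (Circle.exp θ) l - vTrunc h (Circle.exp θ) ε =
      (2 * Real.pi)⁻¹ * ∫ t in ε..l, (logAngle h (θ + t) - logAngle h (θ - t)) * cotHalf t := by
  have hp := Real.pi_pos
  have i1 := hh.mul_cotHalf θ (a := ε) (b := l) h0 (by linarith) (by linarith) (by linarith)
  have i2 := hh.mul_cotHalf θ (a := l) (b := 2 * Real.pi - l) (by linarith) (by linarith)
    (by linarith) (by linarith)
  have i3 := hh.mul_cotHalf θ (a := 2 * Real.pi - l) (b := 2 * Real.pi - ε) (by linarith)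
    (by linarith) (by linarith) (by linarith)
  have e1 : ∀ t, logAngle h (θ + (2 * Real.pi - t)) * cotHalf (2 * Real.pi - t) =
      -(logAngle h (θ - t) * cotHalf t) := by
    intro t
    rw [cotHalf_two_pi_sub, show θ + (2 * Real.pi - t) = θ - t + 2 * Real.pi by ring,
      logAngle_periodic h (θ - t), mul_neg]
  have i4 : IntervalIntegrable (fun t => logAngle h (θ - t) * cotHalf t) volume ε l := by
    have := (i3.comp_sub_left (2 * Real.pi)).symm
    simp only [sub_sub_cancel, e1] at this
    exact this.neg.congr fun t _ => by simp
  have e2 : ∫ t in (2 * Real.pi - l)..(2 * Real.pi - ε), logAngle h (θ + t) * cotHalf t =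
      -∫ t in ε..l, logAngle h (θ - t) * cotHalf t := by
    rw [← intervalIntegral.integral_comp_sub_left (fun t => logAngle h (θ + t) * cotHalf t),
      ← intervalIntegral.integral_neg]
    simp only [e1]
  rw [vTrunc_eq hh θ (by linarith) h2, vTrunc_eq hh θ h0 (by linarith)]
  simp only [sub_mul]
  rw [intervalIntegral.integral_sub i1 i4, ← intervalIntegral.integral_add_adjacent_intervals i1
    (i2.trans i3), ← intervalIntegral.integral_add_adjacent_intervals i2 i3, e2]
  ring

/-- The quantity `A` for `h ^ ρ` in terms of the conjugate function. -/
lemma AFun_eq {ψ : ℝ → ℝ} (h0 : ∀ ξ, 0 ≤ h ξ) (hh : LogIntegrable h) (ρ : ℝ) {θ φ : ℝ}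
    (hθ : VFinite h (Circle.exp θ)) (hφ : VFinite h (Circle.exp φ)) {l : ℝ}
    (hl : lam ψ (fun σ => h σ ^ ρ) θ φ = l) (hl0 : 0 < l) (hl1 : l ≤ Real.pi) :
    AFun ψ (fun σ => h σ ^ ρ) θ φ =
      |Real.sin (ρ * ((vTrunc h (Circle.exp θ) l - vBdry h (Circle.exp θ))
        - (vTrunc h (Circle.exp φ) l - vBdry h (Circle.exp φ))))| := by
  have hp := Real.pi_pos
  rw [AFun, hl]
  congr 2
  refine Tendsto.limUnder_eq ?_
  have hlim := ((tendsto_const_nhds (x := vTrunc h (Circle.exp θ) l)).sub (tendsto_vBdry hθ)).sub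
    ((tendsto_const_nhds (x := vTrunc h (Circle.exp φ) l)).sub (tendsto_vBdry hφ))
  refine (hlim.const_mul ρ).congr' ?_
  have hae := hh.ae_ne_zero
  have hadd : ∀ a : ℝ, ∀ᵐ t : ℝ, h (Circle.exp (a + t)) ≠ 0 := fun a =>
    (measurePreserving_add_left volume a).quasiMeasurePreserving.ae hae
  have hsub : ∀ a : ℝ, ∀ᵐ t : ℝ, h (Circle.exp (a - t)) ≠ 0 := fun a =>
    (quasiMeasurePreserving_sub_left volume a).ae hae
  have hi : ∀ a ε, 0 < ε → ε < l → IntervalIntegrable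
      (fun t => (logAngle h (a + t) - logAngle h (a - t)) * cotHalf t) volume ε l := by
    intro a ε hε hεl
    have i2 : IntervalIntegrable (fun t => logAngle h (a - t)) volume ε l := by
      simpa using (hh.intervalIntegrable (a - ε) (a - l)).comp_sub_left a
    exact ((hh.shift a ε l).sub i2).mul_continuousOn (continuousOn_cotHalf.mono
      (uIcc_subset_Ioo_two_pi hε (by linarith) hl0 (by linarith)))
  filter_upwards [Ioo_mem_nhdsGT hl0] with ε hε
  rw [vTrunc_sub_vTrunc hh θ hε.1 hε.2.le hl1, vTrunc_sub_vTrunc hh φ hε.1 hε.2.le hl1, ← mul_sub,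
    ← intervalIntegral.integral_sub (hi θ ε hε.1 hε.2) (hi φ ε hε.1 hε.2), mul_left_comm, one_div,
    ← intervalIntegral.integral_const_mul]
  congr 1
  refine intervalIntegral.integral_congr_ae ?_
  -- The logarithm of a quotient splits only away from zeros of `h`, so a null set has to be
  -- discarded for each of the four translates.
  filter_upwards [hadd θ, hsub θ, hadd φ, hsub φ] with t h1 h2 h3 h4 _
  have hpos : ∀ s, h (Circle.exp s) ≠ 0 → 0 < h (Circle.exp s) := fun s hs =>
    (h0 _).lt_of_ne hs.symm
  have hlog : ∀ a b, h (Circle.exp a) ≠ 0 → h (Circle.exp b) ≠ 0 →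
      Real.log (h (Circle.exp a) ^ ρ / h (Circle.exp b) ^ ρ) =
        ρ * (logAngle h a - logAngle h b) := by
    intro a b ha hb
    rw [Real.log_div (Real.rpow_pos_of_pos (hpos _ ha) _).ne'
      (Real.rpow_pos_of_pos (hpos _ hb) _).ne', Real.log_rpow (hpos _ ha),
      Real.log_rpow (hpos _ hb)]
    simp only [logAngle]
    ring
  rw [div_tan_eq, hlog _ _ h1 h2, hlog _ _ h3 h4]
  ring

end Local

/-! ### The nonlocal part of the conjugate function and the quantity `a_h`. -/

section Nonlocal

variable {h : Circle → ℝ} {ψ : ℝ → ℝ}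

open Classical in
/-- The integrand of `aFun`, extended by zero. -/
noncomputable def aIntegrand (ψ : ℝ → ℝ) (h : Circle → ℝ) (ξ : Circle) (s : ℝ) : ℝ :=
  if Circle.exp s ∈ Psi ψ h ξ then 0
  else |Real.log (h (Circle.exp s) / h ξ)| / dist (Circle.exp s) ξ ^ 2

lemma aIntegrand_nonneg (ξ : Circle) (s : ℝ) : 0 ≤ aIntegrand ψ h ξ s := by
  unfold aIntegrand
  split_ifs <;> positivity

lemma aIntegrand_periodic (ξ : Circle) : Function.Periodic (aIntegrand ψ h ξ) (2 * Real.pi) := by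
  intro s
  unfold aIntegrand
  rw [Circle.exp_add_two_pi]

lemma measurableSet_exp_mem_Psi (ξ : Circle) :
    MeasurableSet {s : ℝ | Circle.exp s ∈ Psi ψ h ξ} := by
  have : IsClosed {s : ℝ | Circle.exp s ∈ Psi ψ h ξ} := by
    refine isClosed_le (f := fun s : ℝ => dist (Circle.exp s) ξ) ?_ continuous_const
    exact Continuous.dist (by fun_prop) continuous_const
  exact this.measurableSet

lemma measurable_aIntegrand (hc : Continuous h) (ξ : Circle) : Measurable (aIntegrand ψ h ξ) := by
  refine Measurable.ite (measurableSet_exp_mem_Psi ξ) measurable_const ?_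
  have h1 : Measurable fun s : ℝ => h (Circle.exp s) := (hc.comp Circle.exp.continuous).measurable
  have h2 : Measurable fun s : ℝ => dist (Circle.exp s) ξ :=
    (Continuous.dist Circle.exp.continuous continuous_const).measurable
  exact ((h1.div_const _).log.abs).div (h2.pow_const 2)

lemma aFun_eq (ξ : Circle) : aFun ψ h ξ = ∫ s in 0..2 * Real.pi, aIntegrand ψ h ξ s := by
  classical
  have hset : {s : ℝ | s ∈ Ioc 0 (2 * Real.pi) ∧ Circle.exp s ∉ Psi ψ h ξ} =
      Ioc 0 (2 * Real.pi) ∩ {s : ℝ | Circle.exp s ∈ Psi ψ h ξ}ᶜ := rfl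
  rw [aFun, hset, intervalIntegral.integral_of_le Real.two_pi_pos.le,
    ← setIntegral_indicator (measurableSet_exp_mem_Psi ξ).compl]
  refine integral_congr_ae (Eventually.of_forall fun s => ?_)
  by_cases hs : Circle.exp s ∈ Psi ψ h ξ <;> simp [aIntegrand, hs, indicator]

lemma aFun_nonneg (ξ : Circle) : 0 ≤ aFun ψ h ξ := by
  rw [aFun_eq]
  exact intervalIntegral.integral_nonneg Real.two_pi_pos.le fun s _ => aIntegrand_nonneg ξ s

/-- Outside `Ψ_ξ` the distance exceeds the radius, so the integrand is at most a constant times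
`|log h - log h(ξ)|`. -/
lemma aIntegrand_intervalIntegrable (hc : Continuous h) (hh : LogIntegrable h) {ξ : Circle}
    (hξ : h ξ ≠ 0) (hR : 0 < radius ψ h ξ) (a b : ℝ) :
    IntervalIntegrable (aIntegrand ψ h ξ) volume a b := by
  refine ((((hh.intervalIntegrable a b).sub (intervalIntegrable_const
    (c := Real.log (h ξ)))).norm).const_mul (1 / radius ψ h ξ ^ 2)).mono_fun
    (measurable_aIntegrand hc ξ).aestronglyMeasurable ?_
  refine ae_restrict_of_ae ?_
  filter_upwards [hh.ae_ne_zero] with s hs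
  rw [Real.norm_of_nonneg (aIntegrand_nonneg ξ s), norm_mul, norm_norm, Real.norm_eq_abs,
    Real.norm_eq_abs, abs_of_pos (by positivity : 0 < 1 / radius ψ h ξ ^ 2)]
  unfold aIntegrand
  split_ifs with hm
  · positivity
  · have hm : radius ψ h ξ < dist (Circle.exp s) ξ := by
      simpa [Psi] using hm
    rw [Real.log_div hs hξ, one_div_mul_eq_div]
    simp only [logAngle]
    gcongr

lemma hasDerivAt_cotHalf {t : ℝ} (ht : t ∈ Ioo 0 (2 * Real.pi)) :
    HasDerivAt cotHalf (-(1 / 2) / Real.sin (t / 2) ^ 2) t := by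
  have hs := (sin_half_pos ht.1 ht.2).ne'
  have h1 : HasDerivAt (fun t : ℝ => t / 2) (1 / 2) t := (hasDerivAt_id t).div_const 2
  refine (h1.cos.div h1.sin hs).congr_deriv ?_
  have := Real.sin_sq_add_cos_sq (t / 2)
  field_simp
  linarith

lemma continuousOn_inv_sin_sq :
    ContinuousOn (fun t : ℝ => 1 / Real.sin (t / 2) ^ 2) (Ioo 0 (2 * Real.pi)) :=
  ContinuousOn.div (by fun_prop) (by fun_prop) fun t ht =>
    (pow_pos (sin_half_pos ht.1 ht.2) 2).ne'

lemma integral_inv_sin_sq {l : ℝ} (hl : 0 < l) (hl1 : l ≤ Real.pi) :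
    ∫ t in l..2 * Real.pi - l, 1 / Real.sin (t / 2) ^ 2 = 4 * cotHalf l := by
  have hp := Real.pi_pos
  have hsub : uIcc l (2 * Real.pi - l) ⊆ Ioo 0 (2 * Real.pi) :=
    uIcc_subset_Ioo_two_pi hl (by linarith) (by linarith) (by linarith)
  have := intervalIntegral.integral_eq_sub_of_hasDerivAt (f := fun t => -2 * cotHalf t)
    (f' := fun t => 1 / Real.sin (t / 2) ^ 2) (a := l) (b := 2 * Real.pi - l)
    (fun t ht => ((hasDerivAt_cotHalf (hsub ht)).const_mul (-2)).congr_deriv (by ring))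
    (continuousOn_inv_sin_sq.mono hsub).intervalIntegrable
  rw [this, cotHalf_two_pi_sub]
  ring

/-- The difference equals `-sin(d/2)` over the product of the two sines. The condition `4d ≤ l`
keeps the shifted sine at least half of the other. -/
lemma abs_cotHalf_sub_le {t d l : ℝ} (hd : 0 ≤ d) (hdl : 4 * d ≤ l) (hl : 0 < l)
    (ht : l ≤ t) (ht2 : t ≤ 2 * Real.pi - l) :
    |cotHalf t - cotHalf (t - d)| ≤ d * (1 / Real.sin (t / 2) ^ 2) := by
  have hp := Real.pi_pos
  have h1 := le_sin_half hl.le ht ht2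
  have h2 : l / 4 ≤ l / Real.pi := by
    gcongr; exact Real.pi_le_four
  have h3 : 0 < Real.sin (t / 2) := by linarith
  have h4 : Real.sin (t / 2) / 2 ≤ Real.sin ((t - d) / 2) := by
    have := Real.abs_sin_sub_sin_le (t / 2) ((t - d) / 2)
    rw [show t / 2 - (t - d) / 2 = d / 2 by ring, abs_of_nonneg (by linarith : 0 ≤ d / 2)] at this
    have := (abs_le.1 this).2
    linarith
  have h5 : 0 < Real.sin ((t - d) / 2) := by linarith
  have e : cotHalf t - cotHalf (t - d) =
      -(Real.sin (d / 2) / (Real.sin (t / 2) * Real.sin ((t - d) / 2))) := by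
    have : Real.sin (d / 2) = Real.sin (t / 2) * Real.cos ((t - d) / 2)
        - Real.cos (t / 2) * Real.sin ((t - d) / 2) := by
      rw [← Real.sin_sub]; congr 1; ring
    rw [this, cotHalf, cotHalf]
    field_simp
    ring
  rw [e, abs_neg, abs_div, abs_of_pos (mul_pos h3 h5), mul_one_div,
    div_le_div_iff₀ (mul_pos h3 h5) (by positivity)]
  have h6 : |Real.sin (d / 2)| ≤ d / 2 := by
    have := Real.abs_sin_le_abs (x := d / 2)
    rwa [abs_of_nonneg (by linarith : 0 ≤ d / 2)] at this
  calc |Real.sin (d / 2)| * Real.sin (t / 2) ^ 2 ≤ d / 2 * Real.sin (t / 2) ^ 2 := by gcongr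
    _ = d * (Real.sin (t / 2) * (Real.sin (t / 2) / 2)) := by ring
    _ ≤ _ := by gcongr

/-- The part of the conjugate function away from the singularity is almost Lipschitz. -/
lemma abs_vTrunc_sub_le (hc : Continuous h) (hh : LogIntegrable h) {θ φ l : ℝ}
    (hθ : h (Circle.exp θ) ≠ 0) (hR : 0 < radius ψ h (Circle.exp θ)) (hl : 0 < l) (hl1 : l ≤ 1)
    (hd : θ ≤ φ) (hdl : 4 * (φ - θ) ≤ l)
    (hM : ∀ s, |s - θ| ≤ l + (φ - θ) → |logAngle h s - logAngle h θ| ≤ 1)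
    (hΨ : ∀ s, dist (Circle.exp s) (Circle.exp θ) ≤ radius ψ h (Circle.exp θ) →
      |logAngle h s - logAngle h θ| ≤ 1) :
    |vTrunc h (Circle.exp θ) l - vTrunc h (Circle.exp φ) l| ≤
      (φ - θ) * (aFun ψ h (Circle.exp θ) + 4 / l) := by
  have hp := Real.pi_gt_three
  have hp4 := Real.pi_le_four
  set d := φ - θ with hdd
  have hd0 : 0 ≤ d := by linarith
  set M : ℝ → ℝ := fun t => logAngle h (θ + t) - logAngle h θ with hMdef
  have hMi : ∀ a b, IntervalIntegrable M volume a b := fun a b =>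
    (hh.shift θ a b).sub intervalIntegrable_const
  have hMc : ∀ a b, 0 < a → a < 2 * Real.pi → 0 < b → b < 2 * Real.pi →
      IntervalIntegrable (fun t => M t * cotHalf t) volume a b := fun a b h1 h2 h3 h4 =>
    (hMi a b).mul_continuousOn (continuousOn_cotHalf.mono (uIcc_subset_Ioo_two_pi h1 h2 h3 h4))
  have hMd : ∀ a b, d < a → a < 2 * Real.pi + d → d < b → b < 2 * Real.pi + d →
      IntervalIntegrable (fun t => M t * cotHalf (t - d)) volume a b := by
    intro a b h1 h2 h3 h4
    refine (hMi a b).mul_continuousOn (continuousOn_cotHalf.comp (by fun_prop) fun t ht => ?_)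
    rw [mem_uIcc] at ht
    constructor <;> rcases ht with ht | ht <;> linarith [ht.1, ht.2]
  -- Both integrals are centred at `θ` with the same constant `log h(e^{iθ})` subtracted, so the
  -- shift from `θ` to `φ` moves only the kernel and the limits.
  have e2 : ∫ t in l..2 * Real.pi - l, (logAngle h (φ + t) - logAngle h θ) * cotHalf t =
      ∫ t in l + d..2 * Real.pi - l + d, M t * cotHalf (t - d) := by
    rw [← intervalIntegral.integral_comp_add_right (fun t => M t * cotHalf (t - d))]
    refine intervalIntegral.integral_congr fun t _ => ?_
    simp only [hMdef, add_sub_cancel_right]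
    rw [show θ + (t + d) = φ + t by rw [hdd]; ring]
  rw [vTrunc_eq_sub hh θ (logAngle h θ) hl (by linarith),
    vTrunc_eq_sub hh φ (logAngle h θ) hl (by linarith), e2, neg_sub_neg, ← mul_sub, abs_mul,
    abs_of_pos (by positivity), abs_sub_comm]
  -- On the common range the kernels are subtracted. Two end pieces of length `d` remain, where `|M|
  -- ≤ 1` and the cotangent is at most `π/l`.
  have e3 : (∫ t in l..2 * Real.pi - l, M t * cotHalf t)
      - (∫ t in l + d..2 * Real.pi - l + d, M t * cotHalf (t - d)) =
      (∫ t in l..l + d, M t * cotHalf t)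
      + (∫ t in l + d..2 * Real.pi - l, M t * (cotHalf t - cotHalf (t - d)))
      - ∫ t in 2 * Real.pi - l..2 * Real.pi - l + d, M t * cotHalf (t - d) := by
    simp only [mul_sub]
    rw [intervalIntegral.integral_sub (hMc _ _ (by linarith) (by linarith) (by linarith)
      (by linarith)) (hMd _ _ (by linarith) (by linarith) (by linarith) (by linarith)),
      ← intervalIntegral.integral_add_adjacent_intervals (a := l) (b := l + d)
      (hMc _ _ (by linarith) (by linarith) (by linarith) (by linarith))
      (hMc _ _ (by linarith) (by linarith) (by linarith) (by linarith)),
      ← intervalIntegral.integral_add_adjacent_intervals (a := l + d) (b := 2 * Real.pi - l)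
      (hMd _ _ (by linarith) (by linarith) (by linarith) (by linarith))
      (hMd _ _ (by linarith) (by linarith) (by linarith) (by linarith))]
    ring
  have b1 : |∫ t in l..l + d, M t * cotHalf t| ≤ d * (Real.pi / l) := by
    refine (abs_integral_le_of_abs_le (g := fun _ => Real.pi / l) (by linarith) (fun t ht => ?_)
      intervalIntegrable_const).trans (by simp [mul_div_assoc])
    have h1 := hM (θ + t) (by rw [add_sub_cancel_left, abs_of_pos (by linarith [ht.1])]; exact ht.2)
    have h2 := abs_cotHalf_le hl ht.1.le (by linarith [ht.2])
    rw [abs_mul, ← one_mul (Real.pi / l)]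
    exact mul_le_mul h1 h2 (abs_nonneg _) zero_le_one
  have b3 : |∫ t in 2 * Real.pi - l..2 * Real.pi - l + d, M t * cotHalf (t - d)| ≤
      d * (Real.pi / l) := by
    refine (abs_integral_le_of_abs_le (g := fun _ => Real.pi / l) (by linarith) (fun t ht => ?_)
      intervalIntegrable_const).trans (by simp [mul_div_assoc])
    have h1 := hM (θ + t - 2 * Real.pi) (by
      rw [show θ + t - 2 * Real.pi - θ = t - 2 * Real.pi by ring, abs_le]
      constructor <;> linarith [ht.1, ht.2])
    rw [(logAngle_periodic h).sub_eq] at h1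
    have h2 := abs_cotHalf_le (t := t - d) hl (by linarith [ht.1]) (by linarith [ht.2])
    rw [abs_mul, ← one_mul (Real.pi / l)]
    exact mul_le_mul h1 h2 (abs_nonneg _) zero_le_one
  set W : ℝ → ℝ := fun t => aIntegrand ψ h (Circle.exp θ) (θ + t) with hW
  have hWi : ∀ a b, IntervalIntegrable W volume a b := by
    intro a b
    have := (aIntegrand_intervalIntegrable hc hh hθ hR (a + θ) (b + θ)).comp_add_right θ
    simpa [add_comm, hW] using this
  have hWa : ∫ t in 0..2 * Real.pi, W t = aFun ψ h (Circle.exp θ) := by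
    rw [aFun_eq, integral_two_pi_shift (aIntegrand_periodic _) θ]
  have hSi : ∀ a b, 0 < a → a < 2 * Real.pi → 0 < b → b < 2 * Real.pi →
      IntervalIntegrable (fun t => 1 / Real.sin (t / 2) ^ 2) volume a b := fun a b h1 h2 h3 h4 =>
    (continuousOn_inv_sin_sq.mono (uIcc_subset_Ioo_two_pi h1 h2 h3 h4)).intervalIntegrable
  have hWle : ∫ t in l + d..2 * Real.pi - l, W t ≤ aFun ψ h (Circle.exp θ) := by
    rw [← hWa]
    exact intervalIntegral.integral_mono_interval (by linarith) (by linarith) (by linarith)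
      (Eventually.of_forall fun t => aIntegrand_nonneg _ _) (hWi _ _)
  have hSle : ∫ t in l + d..2 * Real.pi - l, 1 / Real.sin (t / 2) ^ 2 ≤ 4 * (Real.pi / l) := by
    have h1 := abs_cotHalf_le hl le_rfl (by linarith)
    have h2 := integral_inv_sin_sq hl (by linarith)
    have h3 : ∫ t in l + d..2 * Real.pi - l, 1 / Real.sin (t / 2) ^ 2 ≤
        ∫ t in l..2 * Real.pi - l, 1 / Real.sin (t / 2) ^ 2 :=
      intervalIntegral.integral_mono_interval (by linarith) (by linarith) le_rfl
        (Eventually.of_forall fun t => by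
          show (0 : ℝ) ≤ 1 / Real.sin (t / 2) ^ 2
          positivity)
        (hSi _ _ (by linarith) (by linarith) (by linarith) (by linarith))
    linarith [le_abs_self (cotHalf l)]
  have hpt : ∀ᵐ t : ℝ, t ∈ Ioc (l + d) (2 * Real.pi - l) →
      ‖M t * (cotHalf t - cotHalf (t - d))‖ ≤
        4 * d * W t + d * (1 / Real.sin (t / 2) ^ 2) := by
    have hadd : ∀ᵐ t : ℝ, h (Circle.exp (θ + t)) ≠ 0 :=
      (measurePreserving_add_left volume θ).quasiMeasurePreserving.ae hh.ae_ne_zero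
    filter_upwards [hadd] with t ht0 ht
    have h1 := abs_cotHalf_sub_le hd0 hdl hl (by linarith [ht.1]) ht.2
    have h2 : 0 < Real.sin (t / 2) := sin_half_pos (by linarith [ht.1]) (by linarith [ht.2])
    have hWn := aIntegrand_nonneg (ψ := ψ) (h := h) (Circle.exp θ) (θ + t)
    rw [norm_mul, Real.norm_eq_abs, Real.norm_eq_abs]
    refine (mul_le_mul_of_nonneg_left h1 (abs_nonneg _)).trans ?_
    -- Inside `Ψ` the bound `|M| ≤ 1` leaves an integrable kernel of total size `O(1/l)`. Outside,
    -- the squared chord is `4 sin²(t/2)`, so the term is exactly the integrand of `a_h` times `4d`.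
    by_cases hm : Circle.exp (θ + t) ∈ Psi ψ h (Circle.exp θ)
    · have h3 : |M t| ≤ 1 := hΨ _ hm
      have h4 : 0 ≤ d * (1 / Real.sin (t / 2) ^ 2) := by positivity
      have h5 : 0 ≤ 4 * d * W t := by positivity
      nlinarith
    · have h3 : 4 * W t = |M t| * (1 / Real.sin (t / 2) ^ 2) := by
        simp only [hW, aIntegrand, if_neg hm, hMdef, dist_exp, add_sub_cancel_left,
          Real.log_div ht0 hθ, logAngle]
        rw [mul_pow, sq_abs]
        field_simp
        ring
      have h4 : 0 ≤ d * (1 / Real.sin (t / 2) ^ 2) := by positivity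
      nlinarith
  have b2 : |∫ t in l + d..2 * Real.pi - l, M t * (cotHalf t - cotHalf (t - d))| ≤
      4 * d * aFun ψ h (Circle.exp θ) + d * (4 * (Real.pi / l)) := by
    have := intervalIntegral.norm_integral_le_of_norm_le (by linarith) hpt
      (((hWi _ _).const_mul (4 * d)).add ((hSi (l + d) (2 * Real.pi - l) (by linarith)
        (by linarith) (by linarith) (by linarith)).const_mul d))
    rw [Real.norm_eq_abs, intervalIntegral.integral_add ((hWi _ _).const_mul (4 * d))
      ((hSi (l + d) (2 * Real.pi - l) (by linarith) (by linarith) (by linarith)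
      (by linarith)).const_mul d), intervalIntegral.integral_const_mul,
      intervalIntegral.integral_const_mul] at this
    refine this.trans ?_
    gcongr
  rw [e3]
  have h3 : |(∫ t in l..l + d, M t * cotHalf t)
      + (∫ t in l + d..2 * Real.pi - l, M t * (cotHalf t - cotHalf (t - d)))
      - ∫ t in 2 * Real.pi - l..2 * Real.pi - l + d, M t * cotHalf (t - d)| ≤
      4 * d * aFun ψ h (Circle.exp θ) + 6 * d * (Real.pi / l) := by
    refine (abs_sub _ _).trans ?_
    linarith [abs_add_le (∫ t in l..l + d, M t * cotHalf t)
      (∫ t in l + d..2 * Real.pi - l, M t * (cotHalf t - cotHalf (t - d)))]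
  rw [inv_mul_le_iff₀ (by positivity)]
  refine h3.trans ?_
  have ha := aFun_nonneg (ψ := ψ) (h := h) (Circle.exp θ)
  have h4 : 0 ≤ d * aFun ψ h (Circle.exp θ) := by positivity
  have h5 : 0 ≤ d * (Real.pi / l) := by positivity
  have h6 : 2 * Real.pi * (d * (aFun ψ h (Circle.exp θ) + 4 / l)) =
      2 * Real.pi * (d * aFun ψ h (Circle.exp θ)) + 8 * (d * (Real.pi / l)) := by
    field_simp
    ring
  rw [h6]
  nlinarith

end Nonlocal

/-! ### Combining local and nonlocal parts; necessity of the arc bound. -/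

section Combine

variable {h : Circle → ℝ} {ψ ω : ℝ → ℝ} {ρ : ℝ}

/-- The threshold `5/8` works because `3/8` just exceeds `1/e`. It will arise as `(5/4) · (1/2)`. -/
lemma abs_log_sub_le_one {x y : ℝ} (hy : 0 < y) (hxy : |x - y| ≤ 5 / 8 * y) :
    |Real.log x - Real.log y| ≤ 1 := by
  have h1 := abs_le.1 hxy
  have hx : 0 < x := by linarith [h1.1]
  rw [← Real.log_div hx.ne' hy.ne', abs_le]
  have hd : 0 < x / y := by positivity
  constructor
  · rw [Real.le_log_iff_exp_le hd, le_div_iff₀ hy]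
    have := Real.exp_neg_one_lt_d9
    nlinarith [h1.1]
  · refine (Real.log_le_sub_one_of_pos hd).trans ?_
    rw [sub_le_iff_le_add, div_le_iff₀ hy]
    linarith [h1.2]

lemma IsWeight.abs_sub_le' (hg : IsWeight ψ h) (hψω : ∀ t ∈ Icc (0 : ℝ) 2, ψ t ≤ ω t)
    (ξ ζ : Circle) : |h ξ - h ζ| ≤ lipConst ψ univ h * ω (dist ξ ζ) :=
  (hg.abs_sub_le ξ ζ).trans (mul_le_mul_of_nonneg_left
    (hψω _ ⟨dist_nonneg, dist_circle_le_two ξ ζ⟩) hg.lipConst_pos.le)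

lemma dist_left_le {θ φ s : ℝ} (h1 : θ ≤ s) (h2 : s ≤ φ) (h3 : φ - θ ≤ Real.pi) :
    dist (Circle.exp θ) (Circle.exp s) ≤ dist (Circle.exp θ) (Circle.exp φ) := by
  refine dist_exp_mono ?_ ?_
  · rw [abs_of_nonpos (by linarith), abs_of_nonpos (by linarith)]; linarith
  · rw [abs_of_nonpos (by linarith)]; linarith

lemma dist_right_le {θ φ s : ℝ} (h1 : θ ≤ s) (h2 : s ≤ φ) (h3 : φ - θ ≤ Real.pi) :
    dist (Circle.exp φ) (Circle.exp s) ≤ dist (Circle.exp θ) (Circle.exp φ) := by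
  refine dist_exp_mono ?_ ?_
  · rw [abs_of_nonneg (by linarith), abs_of_nonpos (by linarith)]; linarith
  · rw [abs_of_nonpos (by linarith)]; linarith

lemma infArc_nonneg (h0 : ∀ ξ, 0 ≤ h ξ) (θ φ : ℝ) : 0 ≤ infArc h θ φ :=
  Real.sInf_nonneg (by rintro _ ⟨σ, -, rfl⟩; exact h0 σ)

lemma infArc_le (h0 : ∀ ξ, 0 ≤ h ξ) {θ φ : ℝ} {σ : Circle} (hσ : σ ∈ arc θ φ) :
    infArc h θ φ ≤ h σ :=
  csInf_le ⟨0, by rintro _ ⟨σ, -, rfl⟩; exact h0 σ⟩ ⟨σ, hσ, rfl⟩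

/-- On a long arc the infimum is controlled by the chord, because the weight vanishes somewhere. -/
lemma IsWeight.infArc_rpow_le_of_pi_lt (hw : IsWeight ψ h)
    (hψω : ∀ t ∈ Icc (0 : ℝ) 2, ψ t ≤ ω t) (hω : IsModulus ω) (hρ : 1 ≤ ρ) {θ φ : ℝ}
    (hθ : 0 ≤ θ) (hφ : φ < 2 * Real.pi) (hd : Real.pi < φ - θ) :
    infArc h θ φ ^ ρ ≤ lipConst ψ univ (fun σ => h σ ^ ρ) *
      ω (dist (Circle.exp θ) (Circle.exp φ)) := by
  have hp := Real.pi_pos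
  have hg := hw.rpow hρ
  obtain ⟨ξ, hξ⟩ := hw.zero
  obtain ⟨s, hs0, hs1, rfl⟩ := exists_exp_eq ξ
  have hω0 := hω.nonneg dist_nonneg (dist_circle_le_two (Circle.exp θ) (Circle.exp φ))
  have hm0 := infArc_nonneg hw.nonneg θ φ
  have key : ∀ u, Circle.exp u = Circle.exp s → dist (Circle.exp θ) (Circle.exp u) ≤
      dist (Circle.exp θ) (Circle.exp φ) → infArc h θ φ ^ ρ ≤
        lipConst ψ univ (fun σ => h σ ^ ρ) * ω (dist (Circle.exp θ) (Circle.exp φ)) := by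
    intro u hu hdu
    have h1 := infArc_le hw.nonneg (exp_mem_arc (le_refl θ) (by linarith : θ ≤ φ))
    have h2 := hg.abs_sub_le' hψω (Circle.exp θ) (Circle.exp u)
    rw [hu, hξ, Real.zero_rpow (by linarith), sub_zero, ← hu] at h2
    have h3 := hω.mono dist_nonneg hdu (dist_circle_le_two _ _)
    calc infArc h θ φ ^ ρ ≤ h (Circle.exp θ) ^ ρ := by gcongr
      _ ≤ _ := (le_abs_self _).trans h2
      _ ≤ _ := mul_le_mul_of_nonneg_left h3 hg.lipConst_pos.le
  have hflip : dist (Circle.exp θ) (Circle.exp φ) =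
      dist (Circle.exp (φ - 2 * Real.pi)) (Circle.exp θ) := by
    rw [Circle.exp_sub_two_pi, dist_comm]
  -- A zero of `h` outside the long arc lies on the complementary arc, which is shorter than `π`;
  -- there its chord to `e^{iθ}` is at most that from `e^{iθ}` to `e^{iφ}`.
  rcases lt_or_ge s θ with h1 | h1
  · refine key s rfl ?_
    rw [hflip]
    exact dist_right_le (by linarith) h1.le (by linarith)
  rcases le_or_gt s φ with h2 | h2
  · have h3 := infArc_le hw.nonneg (exp_mem_arc h1 h2)
    rw [hξ] at h3
    rw [le_antisymm h3 hm0, Real.zero_rpow (by linarith)]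
    exact mul_nonneg hg.lipConst_pos.le hω0
  · refine key (s - 2 * Real.pi) (Circle.exp_sub_two_pi s) ?_
    rw [hflip]
    exact dist_right_le (by linarith) (by linarith) (by linarith)

/-- On a short arc the values of the weight are controlled by the infimum and the chord. -/
lemma IsWeight.rpow_le_infArc_add (hw : IsWeight ψ h)
    (hψω : ∀ t ∈ Icc (0 : ℝ) 2, ψ t ≤ ω t) (hω : IsModulus ω) (hρ : 1 ≤ ρ) {θ φ : ℝ}
    (hθφ : θ ≤ φ) (hd : φ - θ ≤ Real.pi) :
    h (Circle.exp θ) ^ ρ ≤ infArc h θ φ ^ ρ + lipConst ψ univ (fun σ => h σ ^ ρ) *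
        ω (dist (Circle.exp θ) (Circle.exp φ)) ∧
    h (Circle.exp φ) ^ ρ ≤ infArc h θ φ ^ ρ + lipConst ψ univ (fun σ => h σ ^ ρ) *
        ω (dist (Circle.exp θ) (Circle.exp φ)) := by
  have hg := hw.rpow hρ
  obtain ⟨s, hs, hsm, -⟩ := exists_infArc hw.cont hθφ
  rw [← hsm]
  have key : ∀ u, dist (Circle.exp u) (Circle.exp s) ≤ dist (Circle.exp θ) (Circle.exp φ) →
      h (Circle.exp u) ^ ρ ≤ h (Circle.exp s) ^ ρ + lipConst ψ univ (fun σ => h σ ^ ρ) *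
        ω (dist (Circle.exp θ) (Circle.exp φ)) := by
    intro u hu
    have h1 := (abs_le.1 (hg.abs_sub_le' hψω (Circle.exp u) (Circle.exp s))).2
    have h3 := mul_le_mul_of_nonneg_left (hω.mono dist_nonneg hu (dist_circle_le_two _ _))
      hg.lipConst_pos.le
    linarith
  exact ⟨key θ (dist_left_le hs.1 hs.2 hd), key φ (dist_right_le hs.1 hs.2 hd)⟩

/-- The first supremum of the criterion is finite. -/
def RadialBound (ψ ω : ℝ → ℝ) (h : Circle → ℝ) (ρ : ℝ) : Prop :=
  ∃ C : ℝ, ∀ ξ : Circle, h ξ ≠ 0 → h ξ ^ ρ / ω (min 1 (aFun ψ h ξ)⁻¹) ≤ C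

/-- Compare `D` with `μ = min(1, 1/a)`. Below `μ`, the decrease of `ω(t)/t` turns `ω(μ) D a` into
`ω(D) μ a ≤ ω(D)`; above `μ`, monotonicity of `ω` suffices. -/
lemma RadialBound.mul_min_le (hb : RadialBound ψ ω h ρ) (hω : IsModulus ω) :
    ∃ C, 0 ≤ C ∧ ∀ ξ, h ξ ≠ 0 → ∀ D, 0 ≤ D → D ≤ 2 → 0 ≤ h ξ ^ ρ →
      h ξ ^ ρ * min 1 (D * aFun ψ h ξ) ≤ C * ω D := by
  obtain ⟨C, hC⟩ := hb
  refine ⟨max C 0, le_max_right _ _, fun ξ hξ D hD0 hD2 hh0 => ?_⟩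
  have hC' := (hC ξ hξ).trans (le_max_left C 0)
  set K := max C 0
  have hK : 0 ≤ K := le_max_right _ _
  set a := aFun ψ h ξ
  have ha : 0 ≤ a := aFun_nonneg ξ
  have hωD := hω.nonneg hD0 hD2
  -- When `a = 0` the hypothesis carries no information, since `0⁻¹ = 0` makes its quotient `0`; but
  -- the left side vanishes as well.
  rcases ha.eq_or_lt with ha | ha
  · rw [← ha, mul_zero, min_eq_right zero_le_one, mul_zero]
    positivity
  set μ := min 1 a⁻¹ with hμ
  have hμ0 : 0 < μ := lt_min one_pos (inv_pos.2 ha)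
  have hμ1 : μ ≤ 1 := min_le_left _ _
  have hμa : μ * a ≤ 1 := by
    calc μ * a ≤ a⁻¹ * a := by gcongr; exact min_le_right _ _
      _ = 1 := inv_mul_cancel₀ ha.ne'
  have hωμ := hω.pos hμ0 (by linarith)
  rw [div_le_iff₀ hωμ] at hC'
  rcases le_total D μ with h1 | h1
  · have h2 := hω.mul_le hD0 h1 (by linarith)
    calc h ξ ^ ρ * min 1 (D * a) ≤ h ξ ^ ρ * (D * a) := by gcongr; exact min_le_right _ _
      _ ≤ K * ω μ * (D * a) := by gcongr
      _ = K * (ω μ * D) * a := by ring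
      _ ≤ K * (ω D * μ) * a := by gcongr
      _ = K * ω D * (μ * a) := by ring
      _ ≤ K * ω D * 1 := by gcongr
      _ = K * ω D := mul_one _
  · calc h ξ ^ ρ * min 1 (D * a) ≤ h ξ ^ ρ * 1 := by gcongr; exact min_le_left _ _
      _ ≤ K * ω μ := by rw [mul_one]; exact hC'
      _ ≤ K * ω D := by gcongr; exact hω.mono hμ0.le h1 hD2

/-- The nonlocal part of the conjugate function contributes nothing beyond `ω`. -/
lemma RadialBound.nonlocal_le (hb : RadialBound ψ ω h ρ) (hw : IsWeight ψ h)
    (hω : IsModulus ω) (hψω : ∀ t ∈ Icc (0 : ℝ) 2, ψ t ≤ ω t) (hρ : 1 ≤ ρ)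
    (hh : LogIntegrable h) : ∃ C, 0 ≤ C ∧ ∀ θ φ : ℝ, θ < φ → φ - θ ≤ Real.pi →
      infArc h θ φ ≠ 0 → ∃ l, lam ψ (fun σ => h σ ^ ρ) θ φ = l ∧ 0 < l ∧ l ≤ 1 ∧
      infArc h θ φ ^ ρ * min 1 (ρ * |vTrunc h (Circle.exp θ) l - vTrunc h (Circle.exp φ) l|) ≤
        C * ω (dist (Circle.exp θ) (Circle.exp φ)) := by
  have hg := hw.rpow hρ
  obtain ⟨C, hC0, hC⟩ := hb.mul_min_le hω
  set K := lipConst ψ univ (fun σ => h σ ^ ρ) with hK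
  have hK0 : 0 < K := hg.lipConst_pos
  refine ⟨2 * ρ * C + 16 * ρ * K, by positivity, fun θ φ hθφ hd hm => ?_⟩
  obtain ⟨s, hs, hsm, hmin⟩ := exists_infArc hw.cont hθφ.le
  have hgmin : ∀ σ ∈ arc θ φ, h (Circle.exp s) ^ ρ ≤ h σ ^ ρ := fun σ hσ =>
    Real.rpow_le_rpow (hw.nonneg _) (hmin σ hσ) (by linarith)
  have hlam := hg.lam_eq hs hgmin
  rw [← hsm] at hm
  have hgm : h (Circle.exp s) ^ ρ ≠ 0 :=
    (Real.rpow_pos_of_pos ((hw.nonneg _).lt_of_ne hm.symm) _).ne'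
  set l := radius ψ (fun σ => h σ ^ ρ) (Circle.exp s) with hl
  have hl0 : 0 < l := hg.radius_pos hgm
  have hl1 : l ≤ 1 := (hg.radius_mem _).2
  have hψl : 2 * K * ψ l = h (Circle.exp s) ^ ρ := hg.map_radius (Circle.exp s)
  refine ⟨l, hlam, hl0, hl1, ?_⟩
  rw [← hsm]
  set D := dist (Circle.exp θ) (Circle.exp φ) with hD
  have hD0 : 0 ≤ D := dist_nonneg
  have hD2 : D ≤ 2 := dist_circle_le_two _ _
  have hωD := hω.nonneg hD0 hD2
  have hψD := hψω D ⟨hD0, hD2⟩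
  set d := φ - θ with hdd
  have hd0 : 0 ≤ d := by linarith
  have hdD : d ≤ 2 * D := by
    have := abs_le_two_mul_dist_exp (a := θ) (b := φ) (by rw [abs_of_neg (by linarith)]; linarith)
    rwa [abs_of_neg (by linarith), neg_sub] at this
  have hDd : D ≤ d := by
    have := dist_exp_le θ φ
    rwa [abs_of_neg (by linarith), neg_sub] at this
  have hm0 : 0 ≤ h (Circle.exp s) ^ ρ := hg.nonneg (Circle.exp s)
  set N := |vTrunc h (Circle.exp θ) l - vTrunc h (Circle.exp φ) l| with hN
  have hρ0 : 0 ≤ ρ := by linarith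
  -- If the truncation scale is comparable to the arc or smaller, the infimum itself, equal to
  -- `2Kψ(l)`, is already `O(ω(D))`. Otherwise the nonlocal estimate applies.
  rcases lt_or_ge l (4 * d) with hld | hld
  · have h1 : ψ l ≤ 8 * ψ D :=
      hw.mod.le_mul hD0 hD2 hl0.le (by linarith) (by norm_num) (by linarith)
    calc h (Circle.exp s) ^ ρ * min 1 (ρ * N) ≤ h (Circle.exp s) ^ ρ * 1 := by
          gcongr; exact min_le_left _ _
      _ = 2 * K * ψ l := by rw [mul_one, hψl]
      _ ≤ 2 * K * (8 * ω D) := by gcongr; linarith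
      _ = 16 * 1 * K * ω D := by ring
      _ ≤ 16 * ρ * K * ω D := by gcongr
      _ ≤ (2 * ρ * C + 16 * ρ * K) * ω D := by gcongr; linarith [mul_nonneg hρ0 hC0]
  · have hθmem : Circle.exp θ ∈ arc θ φ := exp_mem_arc le_rfl hθφ.le
    have hθpos : 0 < h (Circle.exp θ) :=
      ((hw.nonneg _).lt_of_ne hm.symm).trans_le (hmin _ hθmem)
    have hθ0 : h (Circle.exp θ) ≠ 0 := hθpos.ne'
    have hgθ := hgmin _ hθmem
    have hΨ : ∀ t, dist (Circle.exp t) (Circle.exp θ) ≤ radius ψ h (Circle.exp θ) →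
        |logAngle h t - logAngle h θ| ≤ 1 := fun t ht => by
      have := hw.abs_sub_le_of_dist_le_radius ht
      exact abs_log_sub_le_one hθpos (by linarith)
    -- Here `l + d ≤ 5l/4`, so `h^ρ` varies by at most `5/8` of its value at `e^{iθ}`. This bounds
    -- the oscillation of `ρ log h` by `1`, hence also that of `log h`.
    have hM : ∀ t, |t - θ| ≤ l + d → |logAngle h t - logAngle h θ| ≤ 1 := by
      intro t ht
      have h1 := hg.abs_sub_le (Circle.exp t) (Circle.exp θ)
      have h2 : ψ (dist (Circle.exp t) (Circle.exp θ)) ≤ ψ (l + d) :=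
        hw.mod.mono dist_nonneg ((dist_exp_le _ _).trans ht) (by linarith)
      have h3 : ψ (l + d) ≤ 5 / 4 * ψ l :=
        hw.mod.le_mul hl0.le (by linarith) (by linarith) (by linarith) (by norm_num) (by linarith)
      have h4 : |h (Circle.exp t) ^ ρ - h (Circle.exp θ) ^ ρ| ≤ 5 / 8 * h (Circle.exp θ) ^ ρ := by
        calc _ ≤ K * ψ (dist (Circle.exp t) (Circle.exp θ)) := h1
          _ ≤ K * (5 / 4 * ψ l) := by gcongr; linarith
          _ = 5 / 8 * (2 * K * ψ l) := by ring
          _ ≤ _ := by rw [hψl]; gcongr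
      have h5 := abs_log_sub_le_one (Real.rpow_pos_of_pos hθpos ρ) h4
      have htpos : 0 < h (Circle.exp t) := by
        refine (hw.nonneg _).lt_of_ne fun h6 => ?_
        rw [← h6, Real.zero_rpow (by linarith), zero_sub, abs_neg,
          abs_of_pos (Real.rpow_pos_of_pos hθpos ρ)] at h4
        linarith [Real.rpow_pos_of_pos hθpos ρ]
      rw [Real.log_rpow hθpos, Real.log_rpow htpos, ← mul_sub, abs_mul, abs_of_nonneg hρ0] at h5
      have h6 := abs_nonneg (Real.log (h (Circle.exp t)) - Real.log (h (Circle.exp θ)))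
      show |Real.log (h (Circle.exp t)) - Real.log (h (Circle.exp θ))| ≤ 1
      nlinarith
    have hmain := abs_vTrunc_sub_le hw.cont hh hθ0 (hw.radius_pos hθ0) hl0 hl1 hθφ.le hld hM hΨ
    rw [← hN, ← hdd] at hmain
    set a := aFun ψ h (Circle.exp θ) with ha
    have ha0 : 0 ≤ a := aFun_nonneg _
    have h1 : min 1 (ρ * N) ≤ 2 * ρ * min 1 (D * a) + 4 * ρ * (d / l) := by
      have h2 : ρ * N ≤ 2 * ρ * (D * a) + 4 * ρ * (d / l) := by
        calc ρ * N ≤ ρ * (d * (a + 4 / l)) := by gcongr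
          _ = ρ * (d * a) + 4 * ρ * (d / l) := by ring
          _ ≤ ρ * (2 * D * a) + 4 * ρ * (d / l) := by gcongr
          _ = _ := by ring
      have h3 : 0 ≤ 4 * ρ * (d / l) := by positivity
      rcases le_total 1 (D * a) with h4 | h4
      · rw [min_eq_left h4]
        exact (min_le_left _ _).trans (by linarith)
      · rw [min_eq_right h4]
        exact (min_le_right _ _).trans h2
    have h2 := hC _ hθ0 D hD0 hD2 (hg.nonneg (Circle.exp θ))
    have hmin0 : 0 ≤ min 1 (D * a) := le_min zero_le_one (by positivity)
    -- The term `4/l` is absorbed by `ψ(l)/l ≤ ψ(D)/D`, valid as `D ≤ l`.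
    have h3 : ψ l * (d / l) ≤ 2 * ω D := by
      have h4 := hw.mod.mul_le hD0 (show D ≤ l by linarith) (by linarith)
      have h5 : ψ l * D / l ≤ ψ D := by rwa [div_le_iff₀ hl0]
      have h6 := hw.mod.nonneg hl0.le (by linarith)
      calc ψ l * (d / l) ≤ ψ l * (2 * D / l) := by gcongr
        _ = 2 * (ψ l * D / l) := by ring
        _ ≤ 2 * ω D := by linarith
    have h7 : h (Circle.exp s) ^ ρ * (d / l) ≤ 2 * K * (2 * ω D) := by
      rw [← hψl, mul_assoc (2 * K)]
      exact mul_le_mul_of_nonneg_left h3 (by positivity)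
    calc h (Circle.exp s) ^ ρ * min 1 (ρ * N)
        ≤ h (Circle.exp s) ^ ρ * (2 * ρ * min 1 (D * a) + 4 * ρ * (d / l)) := by gcongr
      _ = 2 * ρ * (h (Circle.exp s) ^ ρ * min 1 (D * a))
          + 4 * ρ * (h (Circle.exp s) ^ ρ * (d / l)) := by ring
      _ ≤ 2 * ρ * (h (Circle.exp θ) ^ ρ * min 1 (D * a)) + 4 * ρ * (2 * K * (2 * ω D)) := by
          gcongr
      _ ≤ 2 * ρ * (C * ω D) + 4 * ρ * (2 * K * (2 * ω D)) := by gcongr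
      _ = _ := by ring

lemma outerPow_circle_eq {ξ : Circle} (hξ : h ξ ≠ 0) :
    outerPow h ρ ξ = ((h ξ ^ ρ : ℝ) : ℂ) * (Circle.exp (ρ * vBdry h ξ) : ℂ) := by
  rw [outerPow_circle, if_neg hξ, Circle.coe_exp]
  push_cast
  rfl

lemma abs_sin_sub_le (α β : ℝ) :
    |Real.sin (α - β)| ≤ ‖(Circle.exp α : ℂ) - Circle.exp β‖ := by
  have h1 := dist_exp α β
  rw [dist_circle, dist_eq_norm] at h1
  rw [h1, show α - β = 2 * ((α - β) / 2) by ring, Real.sin_two_mul, abs_mul, abs_mul, abs_two,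
    show 2 * ((α - β) / 2) / 2 = (α - β) / 2 by ring]
  have := Real.abs_cos_le_one ((α - β) / 2)
  nlinarith [abs_nonneg (Real.sin ((α - β) / 2))]

/-- This exchanges the phase in `A` for `ρ(v_h(ξ) - v_h(ζ))`, in either direction, at the cost of
the nonlocal error `x`. -/
lemma abs_sin_sub_le_add_min (x y : ℝ) :
    |Real.sin (x - y)| ≤ |Real.sin y| + min 1 |x| := by
  rw [Real.sin_sub]
  have h1 : |Real.sin x| ≤ min 1 |x| := le_min (Real.abs_sin_le_one x) Real.abs_sin_le_abs
  refine (abs_sub _ _).trans ?_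
  rw [abs_mul, abs_mul]
  have h2 := Real.abs_cos_le_one x
  have h3 := Real.abs_cos_le_one y
  nlinarith [abs_nonneg (Real.sin x), abs_nonneg (Real.sin y)]

/-- The second supremum of the criterion is finite. -/
def ArcBound (ψ ω : ℝ → ℝ) (h : Circle → ℝ) (ρ : ℝ) : Prop :=
  ∃ C : ℝ, ∀ θ φ : ℝ, 0 ≤ θ → θ < φ → φ < 2 * Real.pi →
    infArc h θ φ ^ ρ * AFun ψ (fun σ => h σ ^ ρ) θ φ
      / ω (dist (Circle.exp θ) (Circle.exp φ)) ≤ C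

lemma dist_exp_pos {θ φ : ℝ} (h1 : θ < φ) (h2 : φ - θ < 2 * Real.pi) :
    0 < dist (Circle.exp θ) (Circle.exp φ) := by
  rw [dist_comm, dist_exp]
  have := sin_half_pos (t := φ - θ) (by linarith) h2
  positivity

lemma AFun_le_one (g : Circle → ℝ) (θ φ : ℝ) : AFun ψ g θ φ ≤ 1 := Real.abs_sin_le_one _

/-- Multiplying the difference of the unimodular factors by `h(ξ)^ρ` gives the difference of the
boundary values plus a modulus difference, both `O(ω)`. Arcs longer than `π` need only the trivial
bound `A ≤ 1`. -/
lemma arcBound_of_lip (hb : RadialBound ψ ω h ρ) (hw : IsWeight ψ h)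
    (hω : IsModulus ω) (hψω : ∀ t ∈ Icc (0 : ℝ) 2, ψ t ≤ ω t) (hρ : 1 ≤ ρ)
    (hh : LogIntegrable h) (hv : ∀ ξ, h ξ ≠ 0 → VFinite h ξ) {C : ℝ} (hC0 : 0 ≤ C)
    (hf : ∀ ξ ζ : Circle, ‖outerPow h ρ ξ - outerPow h ρ ζ‖ ≤ C * ω (dist ξ ζ)) :
    ArcBound ψ ω h ρ := by
  have hg := hw.rpow hρ
  obtain ⟨C₁, hC₁, hN⟩ := hb.nonlocal_le hw hω hψω hρ hh
  set K := lipConst ψ univ (fun σ => h σ ^ ρ) with hK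
  have hK0 : 0 < K := hg.lipConst_pos
  refine ⟨K + C + C₁, fun θ φ hθ hθφ hφ => ?_⟩
  have hDpos := dist_exp_pos hθφ (by linarith)
  have hD2 := dist_circle_le_two (Circle.exp θ) (Circle.exp φ)
  rw [div_le_iff₀ (hω.pos hDpos hD2)]
  set D := dist (Circle.exp θ) (Circle.exp φ) with hD
  have hωD := hω.nonneg hDpos.le hD2
  have hm0 := Real.rpow_nonneg (infArc_nonneg hw.nonneg θ φ) ρ
  by_cases hm : infArc h θ φ = 0
  · rw [hm, Real.zero_rpow (by linarith), zero_mul]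
    positivity
  rcases lt_or_ge Real.pi (φ - θ) with hd | hd
  · have h1 := hw.infArc_rpow_le_of_pi_lt hψω hω hρ hθ hφ hd
    calc _ ≤ infArc h θ φ ^ ρ * 1 := by gcongr; exact AFun_le_one _ _ _
      _ ≤ K * ω D := by rw [mul_one]; exact h1
      _ ≤ _ := by gcongr; linarith
  obtain ⟨l, hl, hl0, hl1, hNl⟩ := hN θ φ hθφ hd hm
  have hmpos := (infArc_nonneg hw.nonneg θ φ).lt_of_ne (Ne.symm hm)
  have hθm := infArc_le hw.nonneg (exp_mem_arc (le_refl θ) hθφ.le)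
  have hφm := infArc_le hw.nonneg (exp_mem_arc hθφ.le (le_refl φ))
  have hθ0 : h (Circle.exp θ) ≠ 0 := (hmpos.trans_le hθm).ne'
  have hφ0 : h (Circle.exp φ) ≠ 0 := (hmpos.trans_le hφm).ne'
  rw [AFun_eq hw.nonneg hh ρ (hv _ hθ0) (hv _ hφ0) hl hl0 (by linarith [Real.pi_gt_three])]
  set α := ρ * vBdry h (Circle.exp θ) with hα
  set β := ρ * vBdry h (Circle.exp φ) with hβ
  set x := ρ * (vTrunc h (Circle.exp θ) l - vTrunc h (Circle.exp φ) l) with hx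
  have e1 : ρ * ((vTrunc h (Circle.exp θ) l - vBdry h (Circle.exp θ))
        - (vTrunc h (Circle.exp φ) l - vBdry h (Circle.exp φ))) = x - (α - β) := by
    rw [hx, hα, hβ]; ring
  have e2 : ρ * |vTrunc h (Circle.exp θ) l - vTrunc h (Circle.exp φ) l| = |x| := by
    rw [hx, abs_mul, abs_of_nonneg (show 0 ≤ ρ by linarith)]
  rw [e2] at hNl
  rw [e1]
  have h1 : infArc h θ φ ^ ρ * |Real.sin (α - β)| ≤ (K + C) * ω D := by
    have h2 : ((h (Circle.exp θ) ^ ρ : ℝ) : ℂ) * ((Circle.exp α : ℂ) - Circle.exp β) =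
        (outerPow h ρ (Circle.exp θ) - outerPow h ρ (Circle.exp φ)) +
        ((h (Circle.exp φ) ^ ρ - h (Circle.exp θ) ^ ρ : ℝ) : ℂ) * Circle.exp β := by
      rw [outerPow_circle_eq hθ0, outerPow_circle_eq hφ0, ← hα, ← hβ, Complex.ofReal_sub]
      ring
    have h3 := norm_add_le (outerPow h ρ (Circle.exp θ) - outerPow h ρ (Circle.exp φ))
      (((h (Circle.exp φ) ^ ρ - h (Circle.exp θ) ^ ρ : ℝ) : ℂ) * Circle.exp β)
    rw [← h2, norm_mul, norm_mul, Circle.norm_coe, Complex.norm_real, Complex.norm_real,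
      Real.norm_of_nonneg (hg.nonneg _), mul_one, Real.norm_eq_abs, abs_sub_comm] at h3
    have h4 := hg.abs_sub_le' hψω (Circle.exp θ) (Circle.exp φ)
    have h5 := hf (Circle.exp θ) (Circle.exp φ)
    calc infArc h θ φ ^ ρ * |Real.sin (α - β)|
        ≤ h (Circle.exp θ) ^ ρ * ‖(Circle.exp α : ℂ) - Circle.exp β‖ := by
          gcongr
          · exact hg.nonneg _
          · exact abs_sin_sub_le α β
      _ ≤ _ := h3
      _ ≤ C * ω D + K * ω D := add_le_add h5 h4
      _ = _ := by ring
  calc infArc h θ φ ^ ρ * |Real.sin (x - (α - β))|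
      ≤ infArc h θ φ ^ ρ * (|Real.sin (α - β)| + min 1 |x|) := by
        gcongr; exact abs_sin_sub_le_add_min _ _
    _ = infArc h θ φ ^ ρ * |Real.sin (α - β)| + infArc h θ φ ^ ρ * min 1 |x| := by ring
    _ ≤ (K + C) * ω D + C₁ * ω D := add_le_add h1 hNl
    _ = _ := by ring

end Combine

/-! ### Necessity of the radial bound. -/

section RadialNecessity

lemma re_pos_or_eq_zero {w : ℂ} (hw : ‖w‖ ≤ 1) : 0 < (1 - w).re ∨ 1 - w = 0 := by
  rw [or_iff_not_imp_left, Complex.sub_re, Complex.one_re, not_lt]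
  intro h
  have h1 : w.re ^ 2 + w.im ^ 2 ≤ 1 := by
    have := Complex.normSq_apply w
    rw [Complex.normSq_eq_norm_sq] at this
    nlinarith [norm_nonneg w]
  have h2 : w.re = 1 := by nlinarith [sq_nonneg w.im]
  have h3 : w.im = 0 := by
    rw [h2] at h1
    nlinarith [sq_nonneg w.im]
  rw [sub_eq_zero]
  exact Complex.ext (by simp [h2]) (by simp [h3])

/-- On the closed disk `1 - w ξ⁻¹` is zero or has positive real part. The principal square root is
therefore analytic inside, and continuous even at the zero because the exponent has positive real
part. -/
lemma diffContOnCl_sqrt (ξ : Circle) :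
    DiffContOnCl ℂ (fun w : ℂ => (1 - w * (ξ⁻¹ : Circle)) ^ ((2⁻¹ : ℝ) : ℂ))
      (Metric.ball 0 1) := by
  have hn : ∀ w : ℂ, ‖w * (ξ⁻¹ : Circle)‖ = ‖w‖ := fun w => by
    rw [norm_mul, Circle.norm_coe, mul_one]
  refine ⟨fun w hw => ?_, fun w hw => ?_⟩
  · have hw : ‖w‖ < 1 := by simpa using hw
    rcases re_pos_or_eq_zero (w := w * (ξ⁻¹ : Circle)) (by rw [hn]; exact hw.le) with h | h
    · have hd : DifferentiableAt ℂ (fun w : ℂ => 1 - w * (ξ⁻¹ : Circle)) w := by fun_prop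
      exact (hd.cpow_const (Or.inl h)).differentiableWithinAt
    · rw [sub_eq_zero] at h
      have := hn w
      rw [← h, norm_one] at this
      linarith
  · rw [closure_ball (0 : ℂ) one_ne_zero] at hw
    have hw : ‖w‖ ≤ 1 := by simpa using hw
    refine ContinuousAt.continuousWithinAt ?_
    have hc : ContinuousAt (fun w : ℂ => 1 - w * (ξ⁻¹ : Circle)) w := by fun_prop
    rcases re_pos_or_eq_zero (w := w * (ξ⁻¹ : Circle)) (by rw [hn]; exact hw) with h | h
    · exact hc.cpow continuousAt_const (Or.inl h)
    · have h0 := Complex.continuousAt_cpow_zero_of_re_pos (z := ((2⁻¹ : ℝ) : ℂ))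
        (by rw [Complex.ofReal_re]; norm_num)
      have h1 : ContinuousAt (fun w : ℂ => ((1 - w * (ξ⁻¹ : Circle) : ℂ), ((2⁻¹ : ℝ) : ℂ))) w :=
        hc.prodMk continuousAt_const
      refine ContinuousAt.comp (g := fun x : ℂ × ℂ => x.1 ^ x.2)
        (f := fun w : ℂ => ((1 - w * (ξ⁻¹ : Circle) : ℂ), ((2⁻¹ : ℝ) : ℂ))) ?_ h1
      rw [h]
      exact h0

/-- The Poisson integral of the square root of the distance, on the radius. -/
lemma pIntegral_sqrt_dist_le (ξ : Circle) {δ : ℝ} (h0 : 0 < δ) (h1 : δ ≤ 1) :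
    pIntegral (fun s => √(dist (Circle.exp s) ξ)) (((1 - δ : ℝ) : ℂ) * ξ) ≤ √2 * √δ := by
  have hz : ‖((1 - δ : ℝ) : ℂ) * ξ‖ < 1 := norm_radial_lt (by linarith) (by linarith) ξ
  set S : ℂ → ℂ := fun w => (1 - w * (ξ⁻¹ : Circle)) ^ ((2⁻¹ : ℝ) : ℂ) with hS
  have hcont : Continuous fun s : ℝ => S (Circle.exp s) := by
    have := (diffContOnCl_sqrt ξ).continuousOn
    rw [closure_ball (0 : ℂ) one_ne_zero] at this
    exact this.comp_continuous (f := fun s : ℝ => (Circle.exp s : ℂ)) (by fun_prop)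
      fun s => by simp
  have hP : pIntegral (fun s => S (Circle.exp s)) (((1 - δ : ℝ) : ℂ) * ξ) =
      S (((1 - δ : ℝ) : ℂ) * ξ) := pIntegral_eq_of_diffContOnCl (diffContOnCl_sqrt ξ) hz
  have hSz : (S (((1 - δ : ℝ) : ℂ) * ξ)).re = √δ := by
    have e : (1 - ((1 - δ : ℝ) : ℂ) * ξ * (ξ⁻¹ : Circle)) = (δ : ℂ) := by
      rw [mul_assoc, ← Circle.coe_mul, mul_inv_cancel, Circle.coe_one]
      push_cast; ring
    simp only [hS, e]
    rw [Complex.cpow_ofReal_re, Complex.arg_ofReal_of_nonneg h0.le, zero_mul, Real.cos_zero,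
      mul_one, Complex.norm_real, Real.norm_of_nonneg h0.le, Real.sqrt_eq_rpow, one_div]
  have hre : pIntegral (fun s => (S (Circle.exp s)).re) (((1 - δ : ℝ) : ℂ) * ξ) = √δ := by
    rw [← hSz, ← hP]
    have hi := pKernel_smul_integrable hz (hcont.intervalIntegrable (μ := volume) 0 (2 * Real.pi))
    have := intervalIntegral.intervalIntegral_re hi
    simp only [pIntegral, Complex.smul_re]
    congr 1
    simpa using this
  -- The root has argument at most `π/4` in absolute value, so its real part is at least its modulus
  -- over `√2`. Its value at `(1-δ)ξ` is `√δ`.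
  have hle : ∀ s, √(dist (Circle.exp s) ξ) ≤ √2 * (S (Circle.exp s)).re := by
    intro s
    have hn : ‖(1 : ℂ) - Circle.exp s * (ξ⁻¹ : Circle)‖ = dist (Circle.exp s) ξ := by
      have e : (1 : ℂ) - Circle.exp s * (ξ⁻¹ : Circle) =
          ((ξ : ℂ) - Circle.exp s) * (ξ⁻¹ : Circle) := by
        rw [sub_mul, ← Circle.coe_mul ξ, mul_inv_cancel, Circle.coe_one]
      rw [e, norm_mul, Circle.norm_coe, mul_one, ← dist_eq_norm, dist_comm, dist_circle]
    have hre : 0 ≤ ((1 : ℂ) - Circle.exp s * (ξ⁻¹ : Circle)).re := by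
      rcases re_pos_or_eq_zero (w := Circle.exp s * (ξ⁻¹ : Circle))
        (by rw [← Circle.coe_mul, Circle.norm_coe]) with h | h
      · exact h.le
      · rw [h]; simp
    have harg := Complex.abs_arg_le_pi_div_two_iff.2 hre
    have hp := Real.pi_pos
    simp only [hS]
    rw [Complex.cpow_ofReal_re, hn, ← one_div, ← Real.sqrt_eq_rpow]
    set x := Complex.arg ((1 : ℂ) - Circle.exp s * (ξ⁻¹ : Circle))
    have hcos : √2 / 2 ≤ Real.cos (x * (1 / 2)) := by
      rw [← Real.cos_pi_div_four, ← Real.cos_abs (x * (1 / 2))]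
      refine Real.cos_le_cos_of_nonneg_of_le_pi (abs_nonneg _) (by linarith) ?_
      rw [abs_mul, abs_of_pos (by norm_num : (0 : ℝ) < 1 / 2)]
      linarith
    have h2 : √2 * √2 = 2 := Real.mul_self_sqrt (by norm_num)
    have h3 : 1 ≤ √2 * Real.cos (x * (1 / 2)) := by
      nlinarith [Real.sqrt_nonneg 2]
    calc √(dist (Circle.exp s) ξ) = √(dist (Circle.exp s) ξ) * 1 := (mul_one _).symm
      _ ≤ √(dist (Circle.exp s) ξ) * (√2 * Real.cos (x * (1 / 2))) := by gcongr
      _ = _ := by ring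
  have hm : pIntegral (fun s => √(dist (Circle.exp s) ξ)) (((1 - δ : ℝ) : ℂ) * ξ) ≤
      pIntegral (fun s => √2 * (S (Circle.exp s)).re) (((1 - δ : ℝ) : ℂ) * ξ) := by
    refine pIntegral_mono hz (Continuous.intervalIntegrable (Real.continuous_sqrt.comp
      (Continuous.dist Circle.exp.continuous continuous_const)) _ _)
      (Continuous.intervalIntegrable ((Complex.continuous_re.comp hcont).const_mul _) _ _)
      (Eventually.of_forall hle)
  refine hm.trans (le_of_eq ?_)
  rw [← hre]
  simp only [pIntegral, smul_eq_mul, mul_left_comm _ (√2), intervalIntegral.integral_const_mul]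

lemma log_one_add_le_two_sqrt {x : ℝ} (hx : 0 ≤ x) : Real.log (1 + x) ≤ 2 * √x := by
  have hs := Real.sqrt_nonneg x
  have h1 : 1 + x ≤ (1 + √x) ^ 2 := by nlinarith [Real.sq_sqrt hx]
  calc Real.log (1 + x) ≤ Real.log ((1 + √x) ^ 2) := Real.log_le_log (by linarith) h1
    _ = 2 * Real.log (1 + √x) := by rw [Real.log_pow]; norm_num
    _ ≤ 2 * √x := by
      have := Real.log_le_sub_one_of_pos (show 0 < 1 + √x by linarith)
      linarith

variable {h : Circle → ℝ} {ψ ω : ℝ → ℝ} {ρ : ℝ}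

/-- Outside `Ψ_ξ` the chord to `ξ` exceeds `δ`, so the distance to `z` is at most twice that chord.
As `1 - |z|² ≥ δ`, the Poisson kernel dominates `δ` over four times the squared chord. -/
lemma mul_aFun_le (hw : IsWeight ψ h) (hh : LogIntegrable h) {ξ : Circle} (hξ : h ξ ≠ 0) {δ : ℝ}
    (h0 : 0 < δ) (h1 : δ ≤ 1) (hδ : δ ≤ radius ψ h ξ) :
    δ * aFun ψ h ξ ≤ 8 * Real.pi *
      pIntegral (fun s => |logAngle h s - Real.log (h ξ)|) (((1 - δ : ℝ) : ℂ) * ξ) := by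
  have hp := Real.two_pi_pos
  set z : ℂ := ((1 - δ : ℝ) : ℂ) * ξ with hzdef
  have hz : ‖z‖ < 1 := norm_radial_lt (by linarith) (by linarith) ξ
  have hzn : ‖z‖ = 1 - δ := by
    rw [hzdef, norm_mul, Circle.norm_coe, mul_one, Complex.norm_real,
      Real.norm_of_nonneg (by linarith)]
  have hzξ : ‖(ξ : ℂ) - z‖ = δ := by
    rw [hzdef, show (ξ : ℂ) - ((1 - δ : ℝ) : ℂ) * ξ = (δ : ℂ) * ξ by push_cast; ring, norm_mul,
      Circle.norm_coe, mul_one, Complex.norm_real, Real.norm_of_nonneg h0.le]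
  have hi : IntervalIntegrable (fun s => |logAngle h s - Real.log (h ξ)|) volume 0
      (2 * Real.pi) := ((hh.intervalIntegrable _ _).sub intervalIntegrable_const).abs
  have e : 8 * Real.pi * pIntegral (fun s => |logAngle h s - Real.log (h ξ)|) z =
      ∫ s in 0..2 * Real.pi, 4 * (pKernel z s * |logAngle h s - Real.log (h ξ)|) := by
    rw [intervalIntegral.integral_const_mul, pIntegral]
    simp only [smul_eq_mul]
    rw [← mul_assoc]
    congr 1
    have := Real.pi_ne_zero
    field_simp
    norm_num
  rw [e, aFun_eq, ← intervalIntegral.integral_const_mul, intervalIntegral.integral_of_le hp.le,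
    intervalIntegral.integral_of_le hp.le]
  refine integral_mono_ae
    ((intervalIntegrable_iff_integrableOn_Ioc_of_le hp.le).1
      ((aIntegrand_intervalIntegrable hw.cont hh hξ (hw.radius_pos hξ) _ _).const_mul δ))
    ((intervalIntegrable_iff_integrableOn_Ioc_of_le hp.le).1
      ((pKernel_smul_integrable hz hi).const_mul 4)) ?_
  filter_upwards [hh.1] with s hs
  have hK := pKernel_nonneg hz s
  show δ * aIntegrand ψ h ξ s ≤ 4 * (pKernel z s * |logAngle h s - Real.log (h ξ)|)
  by_cases hm : Circle.exp s ∈ Psi ψ h ξ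
  · rw [aIntegrand, if_pos hm, mul_zero]
    positivity
  · have hd : δ < dist (Circle.exp s) ξ := by
      have : radius ψ h ξ < dist (Circle.exp s) ξ := by simpa [Psi] using hm
      linarith
    rw [aIntegrand, if_neg hm, Real.log_div hs hξ, pKernel_eq, hzn]
    have h2 : ‖(Circle.exp s : ℂ) - z‖ ≤ 2 * dist (Circle.exp s) ξ := by
      have := norm_sub_le_norm_sub_add_norm_sub (Circle.exp s : ℂ) ξ z
      rw [hzξ] at this
      have h3 : dist (Circle.exp s) ξ = ‖(Circle.exp s : ℂ) - ξ‖ := by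
        rw [dist_circle, dist_eq_norm]
      linarith
    have h3 : 0 < ‖(Circle.exp s : ℂ) - z‖ := norm_pos_iff.2 (exp_sub_ne_zero hz s)
    have h4 : 0 < dist (Circle.exp s) ξ := h0.trans hd
    have h5 : δ / dist (Circle.exp s) ξ ^ 2 ≤
        4 * ((1 - (1 - δ) ^ 2) / ‖(Circle.exp s : ℂ) - z‖ ^ 2) := by
      rw [← mul_div_assoc, div_le_div_iff₀ (by positivity) (by positivity)]
      have h6 : ‖(Circle.exp s : ℂ) - z‖ ^ 2 ≤ (2 * dist (Circle.exp s) ξ) ^ 2 := by gcongr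
      have h7 : δ ≤ 1 - (1 - δ) ^ 2 := by nlinarith
      calc δ * ‖(Circle.exp s : ℂ) - z‖ ^ 2 ≤ δ * (2 * dist (Circle.exp s) ξ) ^ 2 := by gcongr
        _ = 4 * δ * dist (Circle.exp s) ξ ^ 2 := by ring
        _ ≤ _ := by gcongr
    simp only [logAngle]
    calc δ * (|Real.log (h (Circle.exp s)) - Real.log (h ξ)| / dist (Circle.exp s) ξ ^ 2)
        = (δ / dist (Circle.exp s) ξ ^ 2) *
          |Real.log (h (Circle.exp s)) - Real.log (h ξ)| := by ring
      _ ≤ (4 * ((1 - (1 - δ) ^ 2) / ‖(Circle.exp s : ℂ) - z‖ ^ 2)) *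
          |Real.log (h (Circle.exp s)) - Real.log (h ξ)| := by gcongr
      _ = _ := by ring

/-- The modulus bounds `h^ρ` by `h(ξ)^ρ (1 + 10⁻⁶(1 + D/δ))`, with `D` the chord to `ξ`. Then
`log(1+x) ≤ 2√x` leaves a multiple of `1 + √(D/δ)`, and `√D` has Poisson integral at most `√(2δ)`.
-/
lemma pIntegral_posPart_le (hw : IsWeight ψ h)
    (hω : IsModulus ω) (hψω : ∀ t ∈ Icc (0 : ℝ) 2, ψ t ≤ ω t) (hρ : 1 ≤ ρ)
    (hh : LogIntegrable h) {ξ : Circle} (hξ : h ξ ≠ 0) {δ : ℝ} (hδ0 : 0 < δ) (hδ1 : δ ≤ 1)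
    (hq : lipConst ψ univ (fun σ => h σ ^ ρ) * ω δ ≤ 10⁻¹ ^ 6 * h ξ ^ ρ) :
    pIntegral (fun s => max (logAngle h s - Real.log (h ξ)) 0) (((1 - δ : ℝ) : ℂ) * ξ) ≤
      2 * 10⁻¹ ^ 3 * (1 + √2) := by
  have hg := hw.rpow hρ
  set K := lipConst ψ univ (fun σ => h σ ^ ρ) with hK
  have hK0 : 0 < K := hg.lipConst_pos
  have hhξ : 0 < h ξ := (hw.nonneg ξ).lt_of_ne hξ.symm
  have hy : 0 < h ξ ^ ρ := Real.rpow_pos_of_pos hhξ _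
  set z : ℂ := ((1 - δ : ℝ) : ℂ) * ξ with hzdef
  have hz : ‖z‖ < 1 := norm_radial_lt (by linarith) (by linarith) ξ
  have hli : IntervalIntegrable (fun s => logAngle h s - Real.log (h ξ)) volume 0 (2 * Real.pi) :=
    (hh.intervalIntegrable _ _).sub intervalIntegrable_const
  have hsd := pIntegral_sqrt_dist_le ξ hδ0 hδ1
  have hsc : Continuous fun s : ℝ => √(dist (Circle.exp s) ξ) := Real.continuous_sqrt.comp
    (Continuous.dist Circle.exp.continuous continuous_const)
  have hm : pIntegral (fun s => max (logAngle h s - Real.log (h ξ)) 0) z ≤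
      pIntegral (fun s => 2 * 10⁻¹ ^ 3 +
        (2 * 10⁻¹ ^ 3 * (√δ)⁻¹) * √(dist (Circle.exp s) ξ)) z := by
    refine pIntegral_mono hz ?_ ((continuous_const.add
      (continuous_const.mul hsc)).intervalIntegrable _ _) ?_
    · have : (fun s => max (logAngle h s - Real.log (h ξ)) 0) =
          fun s => 2⁻¹ * ((logAngle h s - Real.log (h ξ)) +
            |logAngle h s - Real.log (h ξ)|) := by
        ext s
        rcases le_total (logAngle h s - Real.log (h ξ)) 0 with h1 | h1
        · rw [max_eq_right h1, abs_of_nonpos h1]; ring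
        · rw [max_eq_left h1, abs_of_nonneg h1]; ring
      rw [this]
      exact (hli.add hli.abs).const_mul _
    · filter_upwards [hh.1] with s hs
      have hspos : 0 < h (Circle.exp s) := (hw.nonneg _).lt_of_ne hs.symm
      set D := dist (Circle.exp s) ξ with hD
      have hD0 : 0 ≤ D := dist_nonneg
      have hD2 : D ≤ 2 := dist_circle_le_two _ _
      have hr0 : 0 ≤ 2 * 10⁻¹ ^ 3 + (2 * 10⁻¹ ^ 3 * (√δ)⁻¹) * √D := by positivity
      refine max_le ?_ hr0
      rw [← sub_nonneg, sub_nonneg]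
      by_contra! hcon2
      have hx0 : 0 < logAngle h s - Real.log (h ξ) := hr0.trans_lt hcon2
      have hωD : ω D ≤ (1 + D / δ) * ω δ := by
        refine hω.le_mul hδ0.le (by linarith) hD0 hD2 ?_ ?_
        · linarith [show 0 ≤ D / δ by positivity]
        · rw [add_mul, div_mul_cancel₀ _ hδ0.ne']; linarith
      have h1 := (abs_le.1 (hg.abs_sub_le' hψω (Circle.exp s) ξ)).2
      have h2 : h (Circle.exp s) ^ ρ ≤ h ξ ^ ρ * (1 + 10⁻¹ ^ 6 * (1 + D / δ)) := by
        have h3 : K * ω D ≤ (1 + D / δ) * (10⁻¹ ^ 6 * h ξ ^ ρ) := by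
          calc K * ω D ≤ K * ((1 + D / δ) * ω δ) := by gcongr
            _ = (1 + D / δ) * (K * ω δ) := by ring
            _ ≤ _ := by gcongr
        linarith
      have h3 := Real.log_le_log (Real.rpow_pos_of_pos hspos ρ) h2
      rw [Real.log_rpow hspos, Real.log_mul hy.ne' (by positivity), Real.log_rpow hhξ] at h3
      have h4 := log_one_add_le_two_sqrt (x := 10⁻¹ ^ 6 * (1 + D / δ)) (by positivity)
      have h5 : √(10⁻¹ ^ 6 * (1 + D / δ)) ≤ 10⁻¹ ^ 3 * (1 + √D * (√δ)⁻¹) := by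
        rw [Real.sqrt_le_left (by positivity), mul_pow, ← pow_mul]
        gcongr
        have : (√D * (√δ)⁻¹) ^ 2 = D / δ := by
          rw [mul_pow, inv_pow, Real.sq_sqrt hD0, Real.sq_sqrt hδ0.le]; rfl
        nlinarith [show 0 ≤ √D * (√δ)⁻¹ by positivity]
      have h6 : ρ * (logAngle h s - Real.log (h ξ)) ≤ 2 * (10⁻¹ ^ 3 * (1 + √D * (√δ)⁻¹)) := by
        simp only [logAngle]
        linarith
      have h7 : logAngle h s - Real.log (h ξ) ≤ ρ * (logAngle h s - Real.log (h ξ)) :=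
        le_mul_of_one_le_left hx0.le hρ
      linarith
  rw [pIntegral_add hz intervalIntegrable_const
    (q := fun s => (2 * 10⁻¹ ^ 3 * (√δ)⁻¹) * √(dist (Circle.exp s) ξ))
    ((continuous_const.mul hsc).intervalIntegrable _ _),
    pIntegral_const _ hz] at hm
  have e : pIntegral (fun s => (2 * 10⁻¹ ^ 3 * (√δ)⁻¹) * √(dist (Circle.exp s) ξ)) z =
      (2 * 10⁻¹ ^ 3 * (√δ)⁻¹) * pIntegral (fun s => √(dist (Circle.exp s) ξ)) z := by
    simp only [pIntegral, smul_eq_mul]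
    simp only [mul_left_comm _ (2 * 10⁻¹ ^ 3 * (√δ)⁻¹), intervalIntegral.integral_const_mul]
  rw [e] at hm
  have hsδ : 0 < √δ := Real.sqrt_pos.2 hδ0
  calc _ ≤ _ := hm
    _ ≤ 2 * 10⁻¹ ^ 3 + (2 * 10⁻¹ ^ 3 * (√δ)⁻¹) * (√2 * √δ) := by gcongr
    _ = _ := by field_simp

/-- At `z = (1-δ)ξ` with `δ = 1/a`, a very large quotient would make the Poisson integral of `|log h
- log h(ξ)|` too small to dominate `δ a = 1`. -/
lemma radialBound_of_lip (hw : IsWeight ψ h)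
    (hω : IsModulus ω) (hψω : ∀ t ∈ Icc (0 : ℝ) 2, ψ t ≤ ω t) (hρ : 1 ≤ ρ)
    (hh : LogIntegrable h) {C : ℝ} (hC0 : 0 ≤ C)
    (hf : ∀ ξ : Circle, ∀ δ ∈ Ioc (0 : ℝ) 1,
      ‖outerPow h ρ (((1 - δ : ℝ) : ℂ) * ξ) - outerPow h ρ ξ‖ ≤ C * ω δ) :
    RadialBound ψ ω h ρ := by
  have hg := hw.rpow hρ
  set K := lipConst ψ univ (fun σ => h σ ^ ρ) with hK
  have hK0 : 0 < K := hg.lipConst_pos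
  set k := lipConst ψ univ h with hk
  have hk0 : 0 < k := hw.lipConst_pos
  set B := (2 * k) ^ (ρ - 1) with hB
  have hB0 : 0 < B := by positivity
  -- The first summand makes `(C + K) ω(δ)` negligible against `h(ξ)^ρ`; the second forces `δ` below
  -- the radius at `ξ`.
  set A := 10 ^ 6 * (C + K) + 2 * k * B with hA
  have hA0 : 0 < A := by positivity
  refine ⟨max A (4 * K), fun ξ hξ => ?_⟩
  set a := aFun ψ h ξ with ha
  have ha0 : 0 ≤ a := aFun_nonneg ξ
  have hhξ : 0 < h ξ := (hw.nonneg ξ).lt_of_ne hξ.symm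
  have hy : 0 < h ξ ^ ρ := Real.rpow_pos_of_pos hhξ _
  have hy2 : h ξ ^ ρ ≤ 2 * K := hg.le_lipConst_mul ξ
  -- For `a = 0` the quotient is `0`, because `0⁻¹ = 0`, `ω(0) = 0` and division by zero gives zero.
  rcases ha0.eq_or_lt with ha1 | ha1
  · rw [← ha1, inv_zero, min_eq_right zero_le_one, hω.map_zero, div_zero]
    exact hA0.le.trans (le_max_left _ _)
  rcases le_or_gt a 2 with ha2 | ha2
  · refine le_trans ?_ (le_max_right _ _)
    have h1 : (1 : ℝ) / 2 ≤ min 1 a⁻¹ := by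
      refine le_min (by norm_num) ?_
      rw [one_div]
      exact inv_anti₀ ha1 ha2
    have h2 : min 1 a⁻¹ ≤ ω (min 1 a⁻¹) := hω.self_le (by linarith) (min_le_left _ _)
    rw [div_le_iff₀ (by linarith)]
    nlinarith
  refine le_trans ?_ (le_max_left _ _)
  have hδ1 : a⁻¹ < 1 := by
    rw [inv_lt_one₀ ha1]; linarith
  rw [min_eq_right hδ1.le]
  set δ := a⁻¹ with hδ
  have hδ0 : 0 < δ := inv_pos.2 ha1
  have hδa : δ * a = 1 := inv_mul_cancel₀ ha1.ne'
  have hωδ := hω.pos hδ0 (by linarith)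
  rw [div_le_iff₀ hωδ]
  by_contra! hcon
  have hcon1 : (C + K) * ω δ ≤ 10⁻¹ ^ 6 * h ξ ^ ρ := by
    have : 10 ^ 6 * (C + K) * ω δ ≤ A * ω δ := by
      gcongr
      rw [hA]
      linarith [show 0 < 2 * k * B by positivity]
    linarith
  have hrad : δ < radius ψ h ξ := by
    refine hw.lt_radius (by linarith) ?_
    have h1 : h ξ ^ ρ ≤ h ξ * B := by
      calc h ξ ^ ρ = h ξ ^ (1 + (ρ - 1)) := by congr 1; ring
        _ = h ξ * h ξ ^ (ρ - 1) := by rw [Real.rpow_add hhξ, Real.rpow_one]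
        _ ≤ h ξ * B := by
          gcongr
          exact Real.rpow_le_rpow hhξ.le (hw.le_lipConst_mul ξ) (by linarith)
    have h2 : 2 * k * B * ψ δ ≤ A * ω δ := by
      have := hw.mod.nonneg hδ0.le (by linarith)
      have h3 : 2 * k * B ≤ A := by
        rw [hA]
        linarith [show 0 ≤ 10 ^ 6 * (C + K) by positivity]
      calc 2 * k * B * ψ δ ≤ A * ψ δ := by gcongr
        _ ≤ A * ω δ := by gcongr; exact hψω _ ⟨hδ0.le, by linarith⟩
    have h3 : (2 * k * ψ δ) * B < h ξ * B := by linarith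
    exact lt_of_mul_lt_mul_right h3 hB0.le
  have hmain := mul_aFun_le hw hh hξ hδ0 hδ1.le hrad.le
  rw [← ha, hδa] at hmain
  set z : ℂ := ((1 - δ : ℝ) : ℂ) * ξ with hzdef
  have hz : ‖z‖ < 1 := norm_radial_lt (by linarith) (by linarith) ξ
  have hLi := hh.intervalIntegrable 0 (2 * Real.pi)
  have hli : IntervalIntegrable (fun s => logAngle h s - Real.log (h ξ)) volume 0 (2 * Real.pi) :=
    hLi.sub intervalIntegrable_const
  -- The Lipschitz bound on the radius prevents `|O_h^ρ(z)|` from falling noticeably below `h(ξ)^ρ`.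
  -- In logarithms, the mean of `log h - log h(ξ)` is almost nonnegative.
  have hlow : -(2 * 10⁻¹ ^ 6) ≤ pIntegral (fun s => logAngle h s - Real.log (h ξ)) z := by
    rw [pIntegral_sub_const hz hLi, ← uDisk_eq]
    have h1 := hf ξ δ ⟨hδ0, hδ1.le⟩
    have h2 := (abs_norm_sub_norm_le _ _).trans h1
    rw [norm_outerPow_disk hz, norm_outerPow_circle (by linarith) hw.nonneg] at h2
    have h3 : (1 - 10⁻¹ ^ 6) * h ξ ^ ρ ≤ Real.exp (ρ * uDisk h z) := by
      have := (abs_le.1 h2).1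
      nlinarith
    have h4 := Real.log_le_log (by norm_num; exact hy) h3
    rw [Real.log_exp, Real.log_mul (by norm_num) hy.ne', Real.log_rpow hhξ] at h4
    have h5 : -(2 * 10⁻¹ ^ 6) ≤ Real.log (1 - 10⁻¹ ^ 6) := by
      have := Real.one_sub_inv_le_log_of_pos (show (0 : ℝ) < 1 - 10⁻¹ ^ 6 by norm_num)
      refine le_trans ?_ this
      norm_num
    nlinarith
  have hup := pIntegral_posPart_le (ω := ω) hw hω hψω hρ hh hξ hδ0 hδ1.le
    (le_trans (mul_le_mul_of_nonneg_right (by linarith) hωδ.le) hcon1)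
  rw [← hzdef] at hup
  -- This is `|x| = 2x⁺ - x`: a small positive part and an almost nonnegative mean leave no room for
  -- the negative part.
  have habs : pIntegral (fun s => |logAngle h s - Real.log (h ξ)|) z =
      2 * pIntegral (fun s => max (logAngle h s - Real.log (h ξ)) 0) z -
        pIntegral (fun s => logAngle h s - Real.log (h ξ)) z := by
    have e1 : (fun s => max (logAngle h s - Real.log (h ξ)) 0) =
        fun s => 2⁻¹ * (|logAngle h s - Real.log (h ξ)| + (logAngle h s - Real.log (h ξ))) := by
      ext s
      rcases le_total (logAngle h s - Real.log (h ξ)) 0 with h1 | h1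
      · rw [max_eq_right h1, abs_of_nonpos h1]; ring
      · rw [max_eq_left h1, abs_of_nonneg h1]; ring
    have e2 : ∀ p : ℝ → ℝ, pIntegral (fun s => 2⁻¹ * p s) z = 2⁻¹ * pIntegral p z := by
      intro p
      simp only [pIntegral, smul_eq_mul, mul_left_comm _ (2⁻¹ : ℝ),
        intervalIntegral.integral_const_mul]
    rw [e1, e2, pIntegral_add hz hli.abs hli]
    ring
  rw [habs] at hmain
  have hs2 : √2 ≤ 2 := by
    rw [Real.sqrt_le_left (by norm_num)]; norm_num
  have hpi := Real.pi_le_four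
  have hpi0 := Real.pi_pos
  -- The value `1/64` contradicts the lower bound `1`, because `8π/64 ≤ 1/2`.
  have hfin : 2 * pIntegral (fun s => max (logAngle h s - Real.log (h ξ)) 0) z -
        pIntegral (fun s => logAngle h s - Real.log (h ξ)) z ≤ 1 / 64 := by
    norm_num at hlow hup ⊢
    linarith
  nlinarith

end RadialNecessity

/-! ### From the circle to the closed disk. -/

section Extension

variable {ω : ℝ → ℝ} {f : ℂ → ℂ} {C : ℝ}

lemma dist_closedBall_le_two {z w : ℂ} (hz : z ∈ Metric.closedBall (0 : ℂ) 1)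
    (hw : w ∈ Metric.closedBall (0 : ℂ) 1) : dist z w ≤ 2 := by
  rw [mem_closedBall_zero_iff] at hz hw
  rw [dist_eq_norm]
  linarith [norm_sub_le z w]

lemma circle_mem_closedBall (ξ : Circle) : (ξ : ℂ) ∈ Metric.closedBall (0 : ℂ) 1 := by
  rw [mem_closedBall_zero_iff, Circle.norm_coe]

lemma eq_norm_mul_exp_arg (z : ℂ) : z = (‖z‖ : ℂ) * Circle.exp z.arg := by
  rw [Circle.coe_exp, Complex.norm_mul_exp_arg_mul_I]

lemma exists_circle_eq {z : ℂ} (hz : ‖z‖ = 1) : ∃ ξ : Circle, (ξ : ℂ) = z := by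
  refine ⟨Circle.exp z.arg, ?_⟩
  have := eq_norm_mul_exp_arg z
  rw [hz, Complex.ofReal_one, one_mul] at this
  exact this.symm

/-- One-point extension of a modulus of continuity from the circle to the closed disk. -/
lemma norm_sub_le_of_circle (hω : IsModulus ω) (hd : DifferentiableOn ℂ f (Metric.ball 0 1))
    (hc : ContinuousOn f (Metric.closedBall 0 1)) (hC : 0 ≤ C)
    (hT : ∀ ξ ζ : Circle, ‖f ξ - f ζ‖ ≤ C * ω (dist ξ ζ)) (ζ : Circle) {z : ℂ}
    (hz : z ∈ Metric.closedBall (0 : ℂ) 1) : ‖f z - f ζ‖ ≤ 6 * C * ω (dist z ζ) := by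
  rcases eq_or_ne z ζ with rfl | hne
  · simp [hω.map_zero]
  set δ := dist z ζ with hδ
  have hδ0 : 0 < δ := dist_pos.2 hne
  have hδ2 : δ ≤ 2 := dist_closedBall_le_two hz (circle_mem_closedBall ζ)
  have hωδ := hω.nonneg hδ0.le hδ2
  -- A pole outside the disk at distance `δ` from `ζ`. Dividing by `w - p` offsets the growth of `ω`
  -- away from `ζ`, so the quotient is `O(ω(δ)/δ)` on the circle and the maximum principle applies.
  set p : ℂ := ((1 + δ : ℝ) : ℂ) * ζ with hp
  have hpn : ‖p‖ = 1 + δ := by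
    rw [hp, norm_mul, Circle.norm_coe, mul_one, Complex.norm_real,
      Real.norm_of_nonneg (by linarith)]
  have hpζ : ‖(ζ : ℂ) - p‖ = δ := by
    rw [hp, show (ζ : ℂ) - ((1 + δ : ℝ) : ℂ) * ζ = -((δ : ℂ) * ζ) by push_cast; ring, norm_neg,
      norm_mul, Circle.norm_coe, mul_one, Complex.norm_real, Real.norm_of_nonneg hδ0.le]
  have hsub : ∀ w : ℂ, ‖w‖ ≤ 1 → δ ≤ ‖w - p‖ := by
    intro w hw
    have := norm_sub_norm_le p w
    rw [norm_sub_rev] at this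
    linarith
  have hne0 : ∀ w : ℂ, ‖w‖ ≤ 1 → w - p ≠ 0 := fun w hw =>
    norm_pos_iff.1 (hδ0.trans_le (hsub w hw))
  have hcl : closure (Metric.ball (0 : ℂ) 1) = Metric.closedBall 0 1 :=
    closure_ball (0 : ℂ) one_ne_zero
  have hF : DiffContOnCl ℂ (fun w => (f w - f ζ) / (w - p)) (Metric.ball 0 1) := by
    refine ⟨?_, ?_⟩
    · exact (hd.sub_const _).div (by fun_prop) fun w hw =>
        hne0 w (by simpa using (Metric.ball_subset_closedBall hw))
    · rw [hcl]
      exact (hc.sub continuousOn_const).div (by fun_prop) fun w hw => hne0 w (by simpa using hw)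
  have hfr : ∀ w ∈ frontier (Metric.ball (0 : ℂ) 1),
      ‖(f w - f ζ) / (w - p)‖ ≤ 3 * C * ω δ / δ := by
    intro w hw
    rw [frontier_ball (0 : ℂ) one_ne_zero, mem_sphere_zero_iff_norm] at hw
    obtain ⟨ξ, rfl⟩ := exists_circle_eq hw
    have h1 := hT ξ ζ
    set D := dist ξ ζ with hD
    have hD0 : 0 ≤ D := dist_nonneg
    have h2 : ω D ≤ (1 + D / δ) * ω δ := by
      refine hω.le_mul hδ0.le hδ2 hD0 (dist_circle_le_two _ _) ?_ ?_
      · linarith [show 0 ≤ D / δ by positivity]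
      · rw [add_mul, div_mul_cancel₀ _ hδ0.ne']; linarith
    set E := ‖(ξ : ℂ) - p‖ with hE
    have hE1 : δ ≤ E := hsub ξ hw.le
    have hE2 : D ≤ 2 * E := by
      have h3 := norm_sub_le_norm_sub_add_norm_sub (ξ : ℂ) p ζ
      rw [norm_sub_rev p, hpζ] at h3
      have h4 : D = ‖(ξ : ℂ) - ζ‖ := by rw [hD, dist_circle, dist_eq_norm]
      linarith
    rw [norm_div, ← hE, div_le_div_iff₀ (hδ0.trans_le hE1) hδ0]
    calc ‖f ξ - f ζ‖ * δ ≤ C * ((1 + D / δ) * ω δ) * δ := by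
          gcongr; exact h1.trans (by gcongr)
      _ = C * ω δ * (δ + D) := by field_simp
      _ ≤ C * ω δ * (3 * E) := by gcongr; linarith
      _ = _ := by ring
  have hmax := Complex.norm_le_of_forall_mem_frontier_norm_le Metric.isBounded_ball hF hfr
    (z := z) (by rwa [hcl])
  rw [norm_div] at hmax
  have hz' : ‖z‖ ≤ 1 := by simpa using hz
  have hzp : ‖z - p‖ ≤ 2 * δ := by
    have h3 := norm_sub_le_norm_sub_add_norm_sub z ζ p
    have h4 : δ = ‖z - ζ‖ := by rw [hδ, dist_eq_norm]
    rw [hpζ] at h3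
    linarith
  have hzp0 : 0 < ‖z - p‖ := hδ0.trans_le (hsub z hz')
  rw [div_le_iff₀ hzp0] at hmax
  calc ‖f z - f ζ‖ ≤ 3 * C * ω δ / δ * ‖z - p‖ := hmax
    _ ≤ 3 * C * ω δ / δ * (2 * δ) := by gcongr
    _ = 6 * C * ω δ := by field_simp; ring

/-- A function continuous on the closed disk and analytic inside inherits, up to a constant, its
modulus of continuity from the circle. -/
lemma finiteLip_closedBall (hω : IsModulus ω) (hd : DifferentiableOn ℂ f (Metric.ball 0 1))
    (hc : ContinuousOn f (Metric.closedBall 0 1)) (hC : 0 ≤ C)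
    (hT : ∀ ξ ζ : Circle, ‖f ξ - f ζ‖ ≤ C * ω (dist ξ ζ)) :
    FiniteLip ω (Metric.closedBall (0 : ℂ) 1) f := by
  refine finiteLip_of_norm_sub_le hω (fun z hz w hw => dist_closedBall_le_two hz hw)
    (C := 30 * C) fun z hz w hw hzw => ?_
  have hone := fun (ζ : Circle) (x : ℂ) (hx : x ∈ Metric.closedBall (0 : ℂ) 1) =>
    norm_sub_le_of_circle hω hd hc hC hT ζ hx
  have hD0 : 0 < dist z w := dist_pos.2 hzw
  have hD2 := dist_closedBall_le_two hz hw
  set D := dist z w with hD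
  have hωD := hω.nonneg hD0.le hD2
  set ζ := Circle.exp z.arg with hζ
  have hζm : (ζ : ℂ) ∈ Metric.closedBall (0 : ℂ) 1 := circle_mem_closedBall ζ
  have hz' : ‖z‖ ≤ 1 := by simpa using hz
  set d := 1 - ‖z‖ with hd'
  have hd0 : 0 ≤ d := by linarith
  have hd1 : d ≤ 1 := by linarith [norm_nonneg z]
  have hzζ : dist z ζ = d := by
    have h1 := eq_norm_mul_exp_arg z
    have h2 : z - ζ = ((‖z‖ - 1 : ℝ) : ℂ) * ζ := by
      conv_lhs => rw [h1]
      rw [← hζ, Complex.ofReal_sub, Complex.ofReal_one]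
      ring
    rw [dist_eq_norm, h2, norm_mul, Circle.norm_coe, mul_one, Complex.norm_real,
      Real.norm_of_nonpos (by linarith)]
    linarith
  have hz1 := hone ζ z hz
  rw [hzζ] at hz1
  -- If `z` is near the circle relative to `D`, both points are compared with the boundary point
  -- `ζ`. Otherwise the Schwarz lemma on the disk of radius `d` about `z` gives the factor `D/d`,
  -- and `ω(d)D/d ≤ ω(D)`.
  rcases le_or_gt d (2 * D) with h1 | h1
  · have hw1 := hone ζ w hw
    have h2 : dist w ζ ≤ 3 * D := by
      have := dist_triangle w z ζ
      rw [dist_comm w z, ← hD, hzζ] at this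
      linarith
    have h3 : ω d ≤ 2 * ω D := hω.le_mul hD0.le hD2 hd0 (by linarith) (by norm_num) h1
    have h4 : ω (dist w ζ) ≤ 3 * ω D :=
      hω.le_mul hD0.le hD2 dist_nonneg (dist_closedBall_le_two hw hζm) (by norm_num) h2
    have h5 := norm_sub_le_norm_sub_add_norm_sub (f z) (f ζ) (f w)
    rw [norm_sub_rev (f ζ)] at h5
    calc ‖f z - f w‖ ≤ 6 * C * ω d + 6 * C * ω (dist w ζ) := h5.trans (add_le_add hz1 hw1)
      _ ≤ 6 * C * (2 * ω D) + 6 * C * (3 * ω D) := by gcongr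
      _ = 30 * C * ω D := by ring
  · have hdpos : 0 < d := by linarith
    have hωd := hω.nonneg hd0 (by linarith)
    have hball : Metric.ball z d ⊆ Metric.ball 0 1 := by
      intro x hx
      rw [mem_ball_zero_iff]
      have := norm_le_norm_add_norm_sub z x
      rw [mem_ball_iff_norm, norm_sub_rev] at hx
      rw [norm_sub_rev] at this
      rw [norm_sub_rev] at hx
      linarith
    have hmaps : MapsTo f (Metric.ball z d) (Metric.closedBall (f z) (18 * C * ω d)) := by
      intro x hx
      rw [mem_closedBall_iff_norm]
      have hx1 := hone ζ x (Metric.ball_subset_closedBall (hball hx))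
      have h2 : dist x ζ ≤ 2 * d := by
        have := dist_triangle x z ζ
        rw [Metric.mem_ball] at hx
        linarith
      have h4 : ω (dist x ζ) ≤ 2 * ω d := hω.le_mul hd0 (by linarith) dist_nonneg
        (dist_closedBall_le_two (Metric.ball_subset_closedBall (hball hx)) hζm) (by norm_num) h2
      have h5 := norm_sub_le_norm_sub_add_norm_sub (f x) (f ζ) (f z)
      rw [norm_sub_rev (f ζ)] at h5
      calc ‖f x - f z‖ ≤ 6 * C * ω (dist x ζ) + 6 * C * ω d := h5.trans (add_le_add hx1 hz1)
        _ ≤ 6 * C * (2 * ω d) + 6 * C * ω d := by gcongr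
        _ = 18 * C * ω d := by ring
    have hS := Complex.dist_le_div_mul_dist_of_mapsTo_ball (hd.mono hball) hmaps
      (z := w) (by rw [Metric.mem_ball, dist_comm, ← hD]; linarith)
    rw [dist_eq_norm, dist_comm w z, ← hD, norm_sub_rev] at hS
    have h6 := hω.mul_le hD0.le (show D ≤ d by linarith) (by linarith)
    have h7 : ω d * D / d ≤ ω D := by rwa [div_le_iff₀ hdpos]
    calc ‖f z - f w‖ ≤ 18 * C * ω d / d * D := hS
      _ = 18 * C * (ω d * D / d) := by ring
      _ ≤ 18 * C * ω D := by gcongr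
      _ ≤ 30 * C * ω D := by gcongr; norm_num

end Extension

/-! ### Recovering continuity of a function from its square. -/

section SquareRoot

/-- The square of a purely imaginary number is at most `0`, hence at distance at least `1` from `1`.
So a continuous `w` with `w²` near `1` cannot switch sign. -/
lemma re_ne_zero_of_norm_sq_sub_one_lt {w : ℂ} (hw : ‖w ^ 2 - 1‖ < 1) : w.re ≠ 0 := by
  intro hre
  have h1 := (Complex.abs_re_le_norm (w ^ 2 - 1)).trans_lt hw
  have h2 : (w ^ 2 - 1).re = -(w.im ^ 2) - 1 := by
    rw [pow_two, Complex.sub_re, Complex.mul_re, hre, Complex.one_re]; ring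
  rw [h2, abs_of_nonpos (by nlinarith [sq_nonneg w.im])] at h1
  nlinarith [sq_nonneg w.im]

lemma norm_sub_one_le {w : ℂ} (hw : 0 ≤ w.re) : ‖w - 1‖ ≤ ‖w ^ 2 - 1‖ := by
  have h1 : w ^ 2 - 1 = (w - 1) * (w + 1) := by ring
  rw [h1, norm_mul]
  have h2 : 1 ≤ ‖w + 1‖ := by
    have := (le_abs_self _).trans (Complex.abs_re_le_norm (w + 1))
    rw [Complex.add_re, Complex.one_re] at this
    linarith
  nlinarith [norm_nonneg (w - 1)]

/-- A function in the disk whose square extends continuously to the closed disk extends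
continuously itself, provided its boundary values are radial limits where they do not vanish. -/
lemma continuousOn_closedBall_of_sq {f : ℂ → ℂ} (hf : ContinuousOn f (Metric.ball 0 1))
    (hf2 : ContinuousOn (fun z => f z ^ 2) (Metric.closedBall 0 1))
    (hrad : ∀ ξ : Circle, f ξ ≠ 0 →
      Tendsto (fun r : ℝ => f (r * ξ)) (𝓝[<] 1) (𝓝 (f ξ))) :
    ContinuousOn f (Metric.closedBall 0 1) := by
  intro z hz
  have hz1 : ‖z‖ ≤ 1 := by simpa using hz
  rcases hz1.lt_or_eq with hz1 | hz1
  · exact (hf.continuousAt (Metric.isOpen_ball.mem_nhds (by simpa using hz1))).continuousWithinAt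
  obtain ⟨ξ, rfl⟩ := exists_circle_eq hz1
  by_cases h0 : f ξ = 0
  · have h1 := (hf2 ξ hz).tendsto.norm
    simp only [h0, norm_pow, norm_zero] at h1
    have h2 := (Real.continuous_sqrt.tendsto _).comp h1
    rw [ContinuousWithinAt, h0, tendsto_zero_iff_norm_tendsto_zero]
    simpa [Function.comp_def, Real.sqrt_sq] using h2
  set q : ℂ → ℂ := fun z => f z / f ξ with hq
  have hq2 : ContinuousWithinAt (fun z => q z ^ 2) (Metric.closedBall 0 1) ξ := by
    have := (hf2 ξ hz).div_const (f ξ ^ 2)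
    simpa only [hq, div_pow] using this
  have hqξ : q ξ = 1 := div_self h0
  have hnear : ∀ ε > 0, ∃ η > 0, ∀ w ∈ Metric.closedBall (0 : ℂ) 1, dist w ξ < η →
      ‖q w ^ 2 - 1‖ < ε := by
    intro ε hε
    obtain ⟨η, hη, h⟩ := Metric.continuousWithinAt_iff.1 hq2 ε hε
    refine ⟨η, hη, fun w hw hwη => ?_⟩
    have := h hw hwη
    rwa [hqξ, one_pow, dist_eq_norm] at this
  obtain ⟨η, hη, hη1⟩ := hnear 1 one_pos
  set S := Metric.ball (0 : ℂ) 1 ∩ Metric.ball (ξ : ℂ) η with hS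
  have hSpre : IsPreconnected S :=
    ((convex_ball (0 : ℂ) 1).inter (convex_ball (ξ : ℂ) η)).isPreconnected
  have hqc : ContinuousOn (fun w => (q w).re) S :=
    Complex.continuous_re.comp_continuousOn ((hf.mono inter_subset_left).div_const _)
  have hqne : ∀ w ∈ S, (q w).re ≠ 0 := fun w hw =>
    re_ne_zero_of_norm_sq_sub_one_lt (hη1 w (Metric.ball_subset_closedBall hw.1) hw.2)
  have hradq : ∀ ζ : Circle, f ζ ≠ 0 →
      Tendsto (fun r : ℝ => (q (r * ζ)).re) (𝓝[<] 1) (𝓝 (q ζ).re) := fun ζ hζ =>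
    (Complex.continuous_re.tendsto _).comp ((hrad ζ hζ).div_const _)
  have hradS : ∀ ζ : Circle, dist (ζ : ℂ) ξ < η → ∀ᶠ r : ℝ in 𝓝[<] 1, (r : ℂ) * ζ ∈ S := by
    intro ζ hζ
    have h1 := tendsto_radial ζ
    have h2 := h1.eventually (self_mem_nhdsWithin)
    have h3 := h1.eventually (nhdsWithin_le_nhds (Metric.isOpen_ball.mem_nhds
      (show (ζ : ℂ) ∈ Metric.ball (ξ : ℂ) η from hζ)))
    filter_upwards [h2, h3] with r h4 h5 using ⟨h4, h5⟩
  -- On the convex set `S` the real part never vanishes, so its sign is constant. The radial limit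
  -- `q → 1` at `ξ` makes it positive.
  have hpos : ∀ w ∈ S, 0 < (q w).re := by
    have h1 := hradq ξ h0
    rw [hqξ, Complex.one_re] at h1
    obtain ⟨r, hr1, hr2⟩ := ((h1.eventually (lt_mem_nhds one_pos)).and
      (hradS ξ (by simpa using hη))).exists
    intro w hw
    by_contra! hcon
    obtain ⟨x, hx, hx0⟩ := hSpre.intermediate_value hw hr2 hqc ⟨hcon, hr1.le⟩
    exact hqne x hx hx0
  -- At nearby circle points the sign is inherited through their own radial limits, available since
  -- `q² ≈ 1` prevents `f` from vanishing.
  have hnonneg : ∀ w ∈ Metric.closedBall (0 : ℂ) 1, dist w ξ < η → 0 ≤ (q w).re := by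
    intro w hw hwη
    have hw1 : ‖w‖ ≤ 1 := by simpa using hw
    rcases hw1.lt_or_eq with hw1 | hw1
    · exact (hpos w ⟨by simpa using hw1, hwη⟩).le
    obtain ⟨ζ, rfl⟩ := exists_circle_eq hw1
    have hζ : f ζ ≠ 0 := by
      intro hζ
      have := hη1 ζ hw hwη
      simp [hq, hζ] at this
    exact ge_of_tendsto (hradq ζ hζ) ((hradS ζ hwη).mono fun r hr => (hpos _ hr).le)
  have hqcont : ContinuousWithinAt q (Metric.closedBall 0 1) ξ := by
    rw [Metric.continuousWithinAt_iff]
    intro ε hε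
    obtain ⟨η₂, hη₂, h⟩ := hnear ε hε
    refine ⟨min η η₂, lt_min hη hη₂, fun w hw hwη => ?_⟩
    rw [hqξ, dist_eq_norm]
    exact (norm_sub_one_le (hnonneg w hw (hwη.trans_le (min_le_left _ _)))).trans_lt
      (h w hw (hwη.trans_le (min_le_right _ _)))
  have := hqcont.mul_const (f ξ)
  simpa only [hq, div_mul_cancel₀ _ h0] using this

end SquareRoot

/-! ### Passing from short arcs to the whole circle. -/

section Continuity

variable {ω : ℝ → ℝ} {E : Type*} [NormedAddCommGroup E] {C : ℝ}

lemma IsModulus.continuousWithinAt {X : Type*} [MetricSpace X] (hω : IsModulus ω) {F : X → E}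
    {S : Set X} {x : X} (hS : ∀ w ∈ S, dist w x ≤ 2)
    (hF : ∀ w ∈ S, ‖F w - F x‖ ≤ C * ω (dist w x)) : ContinuousWithinAt F S x := by
  have h1 : Tendsto (fun w => dist w x) (𝓝[S] x) (𝓝[Icc 0 2] 0) := by
    refine tendsto_nhdsWithin_iff.2 ⟨?_, ?_⟩
    · have : Continuous fun w => dist w x := by fun_prop
      simpa using (this.tendsto x).mono_left nhdsWithin_le_nhds
    · filter_upwards [self_mem_nhdsWithin] with w hw using ⟨dist_nonneg, hS w hw⟩
  have h2 := ((hω.continuousOn 0 ⟨le_rfl, zero_le_two⟩).tendsto.comp h1).const_mul C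
  rw [hω.map_zero, mul_zero] at h2
  rw [ContinuousWithinAt, tendsto_iff_norm_sub_tendsto_zero]
  refine squeeze_zero' (Eventually.of_forall fun _ => norm_nonneg _) ?_ h2
  filter_upwards [self_mem_nhdsWithin] with w hw using hF w hw

/-- A bound over short arcs that avoid the cut extends to the whole circle. -/
lemma norm_sub_le_of_short_arcs (hω : IsModulus ω) (hC : 0 ≤ C) {F : Circle → E}
    (hF : ∀ θ φ : ℝ, 0 ≤ θ → θ < φ → φ < 2 * Real.pi → φ - θ ≤ Real.pi →
      ‖F (Circle.exp θ) - F (Circle.exp φ)‖ ≤ C * ω (dist (Circle.exp θ) (Circle.exp φ)))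
    (hlim : Tendsto (fun s : ℝ => F (Circle.exp s)) (𝓝[<] (2 * Real.pi)) (𝓝 (F 1)))
    (ξ ζ : Circle) : ‖F ξ - F ζ‖ ≤ 2 * C * ω (dist ξ ζ) := by
  have hp := Real.pi_pos
  have hω0 : ∀ ξ ζ : Circle, 0 ≤ ω (dist ξ ζ) := fun ξ ζ =>
    hω.nonneg dist_nonneg (dist_circle_le_two _ _)
  have hleft : ∀ θ, 0 ≤ θ → θ ≤ Real.pi →
      ‖F (Circle.exp θ) - F 1‖ ≤ C * ω (dist 1 (Circle.exp θ)) := by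
    intro θ h1 h2
    rcases h1.eq_or_lt with rfl | h1
    · rw [Circle.exp_zero, sub_self, norm_zero]
      exact mul_nonneg hC (hω0 _ _)
    · have := hF 0 θ le_rfl h1 (by linarith) (by linarith)
      rwa [Circle.exp_zero, norm_sub_rev] at this
  have hright : ∀ φ, Real.pi ≤ φ → φ < 2 * Real.pi →
      ‖F (Circle.exp φ) - F 1‖ ≤ C * ω (dist (Circle.exp φ) (Circle.exp (2 * Real.pi))) := by
    intro φ h1 h2
    refine le_of_tendsto (hlim.const_sub (F (Circle.exp φ))).norm ?_
    filter_upwards [Ioo_mem_nhdsLT h2] with s hs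
    refine (hF φ s (by linarith) hs.1 hs.2 (by linarith [hs.2])).trans ?_
    gcongr
    exact hω.mono dist_nonneg (dist_left_le hs.1.le hs.2.le (by linarith))
      (dist_circle_le_two _ _)
  have key : ∀ θ φ, 0 ≤ θ → θ ≤ φ → φ < 2 * Real.pi →
      ‖F (Circle.exp θ) - F (Circle.exp φ)‖ ≤ 2 * C * ω (dist (Circle.exp θ) (Circle.exp φ)) := by
    intro θ φ h1 h2 h3
    have hω1 := hω0 (Circle.exp θ) (Circle.exp φ)
    rcases h2.eq_or_lt with rfl | h2
    · rw [sub_self, norm_zero]; positivity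
    -- For an arc longer than `π` the complementary arc contains `1`, and the triangle inequality
    -- through `1` costs the factor `2`.
    rcases le_or_gt (φ - θ) Real.pi with h4 | h4
    · refine (hF θ φ h1 h2 h3 h4).trans ?_
      nlinarith [mul_nonneg hC hω1]
    · have e : dist (Circle.exp θ) (Circle.exp φ) =
          dist (Circle.exp (θ + 2 * Real.pi)) (Circle.exp φ) := by rw [Circle.exp_add_two_pi]
      have hb : |θ + 2 * Real.pi - φ| = θ + 2 * Real.pi - φ := abs_of_nonneg (by linarith)
      have h5 := hleft θ h1 (by linarith)
      have h6 := hright φ (by linarith) h3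
      have h7 : dist 1 (Circle.exp θ) ≤ dist (Circle.exp θ) (Circle.exp φ) := by
        rw [e, ← Circle.exp_zero]
        refine dist_exp_mono ?_ ?_ <;> rw [hb]
        · rw [zero_sub, abs_neg, abs_of_nonneg h1]; linarith
        · linarith
      have h8 : dist (Circle.exp φ) (Circle.exp (2 * Real.pi)) ≤
          dist (Circle.exp θ) (Circle.exp φ) := by
        rw [e]
        refine dist_exp_mono ?_ ?_ <;> rw [hb]
        · rw [abs_of_nonpos (by linarith)]; linarith
        · linarith
      have h9 := norm_sub_le_norm_sub_add_norm_sub (F (Circle.exp θ)) (F 1) (F (Circle.exp φ))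
      rw [norm_sub_rev (F 1)] at h9
      calc _ ≤ _ := h9
        _ ≤ C * ω (dist (Circle.exp θ) (Circle.exp φ))
            + C * ω (dist (Circle.exp θ) (Circle.exp φ)) := by
          refine add_le_add (h5.trans ?_) (h6.trans ?_) <;> gcongr
          · exact hω.mono dist_nonneg h7 (dist_circle_le_two _ _)
          · exact hω.mono dist_nonneg h8 (dist_circle_le_two _ _)
        _ = _ := by ring
  obtain ⟨θ, h1, h2, rfl⟩ := exists_exp_eq ξ
  obtain ⟨φ, h3, h4, rfl⟩ := exists_exp_eq ζ
  rcases le_total θ φ with h5 | h5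
  · exact key θ φ h1 h5 h4
  · rw [norm_sub_rev, dist_comm]
    exact key φ θ h3 h5 h2

end Continuity

/-! ### No jump at the cut. -/

section Cut

lemma pIntegral_two_pi_sub {E : Type*} [NormedAddCommGroup E] [NormedSpace ℝ E] (q : ℝ → E)
    {r : ℝ} (h0 : 0 ≤ r) (h1 : r < 1) :
    pIntegral (fun s => q (2 * Real.pi - s)) ((r : ℂ) * (1 : Circle)) =
      pIntegral q ((r : ℂ) * (1 : Circle)) := by
  have hk : ∀ s, pKernel ((r : ℂ) * (1 : Circle)) s =
      pKernel ((r : ℂ) * (1 : Circle)) (2 * Real.pi - s) := by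
    intro s
    have e1 := pKernel_polar h0 h1 0 s
    have e2 := pKernel_polar h0 h1 0 (2 * Real.pi - s)
    rw [Circle.exp_zero, zero_add] at e1 e2
    rw [e1, e2, Real.cos_two_pi_sub]
  have := intervalIntegral.integral_comp_sub_left (a := 0) (b := 2 * Real.pi)
    (fun s => pKernel ((r : ℂ) * (1 : Circle)) s • q s) (2 * Real.pi)
  rw [sub_self, sub_zero] at this
  rw [pIntegral, pIntegral, ← this]
  simp only [← hk]

/-- If the Poisson integral of a function with one-sided limits at the cut has a radial limit
there, and that limit is one of the two, then the one-sided limits agree. -/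
lemma eq_of_tendsto_pIntegral {q : ℝ → ℂ} (hq : IntervalIntegrable q volume 0 (2 * Real.pi))
    {a b : ℂ} (h0 : Tendsto q (𝓝[>] 0) (𝓝 b)) (h2 : Tendsto q (𝓝[<] (2 * Real.pi)) (𝓝 a))
    (hr : Tendsto (fun r : ℝ => pIntegral q (r * (1 : Circle))) (𝓝[<] 1) (𝓝 b)) : a = b := by
  have hp := Real.pi_pos
  have hq' : IntervalIntegrable (fun s => q (2 * Real.pi - s)) volume 0 (2 * Real.pi) := by
    have := hq.comp_sub_left (2 * Real.pi)
    rw [sub_self, sub_zero] at this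
    exact this.symm
  -- Symmetrizing about the cut removes the jump: the sum has limit `a + b` from both sides. On the
  -- radius its Poisson integral is twice that of `q`, whence `a + b = 2b`.
  have hS : SmallNear (fun s => ‖(q s + q (2 * Real.pi - s)) - (b + a)‖) 1 := by
    intro ε hε
    have e0 := (Metric.tendsto_nhds.1 h0) (ε / 2) (by linarith)
    have e2 := (Metric.tendsto_nhds.1 h2) (ε / 2) (by linarith)
    obtain ⟨u, hu, hu'⟩ := (mem_nhdsGT_iff_exists_Ioo_subset).1 e0
    obtain ⟨v, hv, hv'⟩ := (mem_nhdsLT_iff_exists_Ioo_subset).1 e2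
    rw [mem_Ioi] at hu
    rw [mem_Iio] at hv
    refine ⟨min (min u (2 * Real.pi - v)) 1 / 2, by
      have : 0 < min (min u (2 * Real.pi - v)) 1 :=
        lt_min (lt_min hu (by linarith)) one_pos
      linarith, fun s hs hd => ?_⟩
    have key : ∀ t, 0 < t → t < min (min u (2 * Real.pi - v)) 1 →
        ‖q t - b‖ < ε / 2 ∧ ‖q (2 * Real.pi - t) - a‖ < ε / 2 := by
      intro t ht0 ht
      have t1 := ht.trans_le ((min_le_left _ _).trans (min_le_left _ _))
      have t2 := ht.trans_le ((min_le_left _ _).trans (min_le_right _ _))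
      have a1 := hu' ⟨ht0, t1⟩
      have a2 := hv' (show 2 * Real.pi - t ∈ Ioo v (2 * Real.pi) from ⟨by linarith, by linarith⟩)
      rw [← dist_eq_norm, ← dist_eq_norm]
      exact ⟨a1, a2⟩
    rcases le_total s Real.pi with hs1 | hs1
    · have hd1 := abs_le_two_mul_dist_exp (a := s) (b := 0)
        (by rw [sub_zero, abs_of_pos hs.1]; exact hs1)
      rw [Circle.exp_zero, sub_zero, abs_of_pos hs.1] at hd1
      obtain ⟨k1, k2⟩ := key s hs.1 (by linarith)
      show ‖q s + q (2 * Real.pi - s) - (b + a)‖ ≤ ε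
      rw [add_sub_add_comm]
      exact (norm_add_le _ _).trans (by linarith)
    · have hd1 := abs_le_two_mul_dist_exp (a := s) (b := 2 * Real.pi)
        (by rw [abs_of_neg (by linarith [hs.2])]; linarith)
      rw [Circle.exp_two_pi, abs_of_neg (by linarith [hs.2])] at hd1
      obtain ⟨k1, k2⟩ := key (2 * Real.pi - s) (by linarith [hs.2]) (by linarith)
      rw [sub_sub_cancel] at k2
      show ‖q s + q (2 * Real.pi - s) - (b + a)‖ ≤ ε
      rw [add_comm (q s), add_sub_add_comm]
      exact (norm_add_le _ _).trans (by linarith)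
  have hl := (tendsto_pIntegral (hq.add hq') hS).comp (tendsto_radial 1)
  have hl2 := hl.congr' (f₂ := fun r : ℝ =>
      pIntegral q (r * (1 : Circle)) + pIntegral q (r * (1 : Circle))) (by
    filter_upwards [Ioo_mem_nhdsLT (show (0 : ℝ) < 1 by norm_num)] with r hr
    have := pIntegral_add (norm_radial_lt hr.1.le hr.2 1) hq hq'
    rw [pIntegral_two_pi_sub q hr.1.le hr.2] at this
    exact this)
  have := tendsto_nhds_unique hl2 (hr.add hr)
  exact add_left_cancel this

end Cut

/-! ### Sufficiency of the two bounds. -/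

section Sufficiency

variable {ψ ω : ℝ → ℝ} {h : Circle → ℝ} {ρ : ℝ}

lemma outerPow_circle_eq_mul (hρ : ρ ≠ 0) (ξ : Circle) :
    outerPow h ρ ξ = ((h ξ ^ ρ : ℝ) : ℂ) * (Circle.exp (ρ * vBdry h ξ) : ℂ) := by
  by_cases hξ : h ξ = 0
  · rw [outerPow_circle, if_pos hξ, hξ, Real.zero_rpow hρ, Complex.ofReal_zero, zero_mul]
  · exact outerPow_circle_eq hξ

lemma norm_exp_sq_sub (α β : ℝ) :
    ‖(Circle.exp α : ℂ) ^ 2 - (Circle.exp β : ℂ) ^ 2‖ = 2 * |Real.sin (α - β)| := by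
  have e : ∀ x : ℝ, (Circle.exp x : ℂ) ^ 2 = (Circle.exp (x + x) : ℂ) := fun x => by
    rw [Circle.exp_add, Circle.coe_mul, pow_two]
  rw [e, e, ← dist_eq_norm, ← dist_circle, dist_exp,
    show (α + α - (β + β)) / 2 = α - β by ring]

/-- The phase difference is the nonlocal error minus the phase in `A`; the radial bound pays for the
first and the arc bound for the second. -/
lemma ArcBound.infArc_mul_sin_le (ha : ArcBound ψ ω h ρ) (hb : RadialBound ψ ω h ρ)
    (hw : IsWeight ψ h) (hω : IsModulus ω) (hψω : ∀ t ∈ Icc (0 : ℝ) 2, ψ t ≤ ω t) (hρ : 1 ≤ ρ)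
    (hh : LogIntegrable h) (hv : ∀ ξ, h ξ ≠ 0 → VFinite h ξ) :
    ∃ C, 0 ≤ C ∧ ∀ θ φ : ℝ, 0 ≤ θ → θ < φ → φ < 2 * Real.pi → φ - θ ≤ Real.pi →
      infArc h θ φ ^ ρ *
        |Real.sin (ρ * vBdry h (Circle.exp θ) - ρ * vBdry h (Circle.exp φ))| ≤
        C * ω (dist (Circle.exp θ) (Circle.exp φ)) := by
  obtain ⟨C₁, hC₁, hN⟩ := hb.nonlocal_le hw hω hψω hρ hh
  obtain ⟨C₂, hC₂⟩ := ha
  refine ⟨C₁ + max C₂ 0, by positivity, fun θ φ hθ hθφ hφ hd => ?_⟩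
  have hDpos := dist_exp_pos hθφ (by linarith)
  have hD2 := dist_circle_le_two (Circle.exp θ) (Circle.exp φ)
  have h2 := (hC₂ θ φ hθ hθφ hφ).trans (le_max_left C₂ 0)
  rw [div_le_iff₀ (hω.pos hDpos hD2)] at h2
  set D := dist (Circle.exp θ) (Circle.exp φ) with hD
  have hωD := hω.nonneg hDpos.le hD2
  by_cases hm : infArc h θ φ = 0
  · rw [hm, Real.zero_rpow (by linarith), zero_mul]
    positivity
  obtain ⟨l, hl, hl0, hl1, hNl⟩ := hN θ φ hθφ hd hm
  have hmpos := (infArc_nonneg hw.nonneg θ φ).lt_of_ne (Ne.symm hm)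
  have hm0 := Real.rpow_nonneg hmpos.le ρ
  have hθ0 : h (Circle.exp θ) ≠ 0 :=
    (hmpos.trans_le (infArc_le hw.nonneg (exp_mem_arc (le_refl θ) hθφ.le))).ne'
  have hφ0 : h (Circle.exp φ) ≠ 0 :=
    (hmpos.trans_le (infArc_le hw.nonneg (exp_mem_arc hθφ.le (le_refl φ)))).ne'
  rw [AFun_eq hw.nonneg hh ρ (hv _ hθ0) (hv _ hφ0) hl hl0 (by linarith [Real.pi_gt_three])] at h2
  set x := ρ * (vTrunc h (Circle.exp θ) l - vTrunc h (Circle.exp φ) l) with hx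
  set y := ρ * ((vTrunc h (Circle.exp θ) l - vBdry h (Circle.exp θ))
        - (vTrunc h (Circle.exp φ) l - vBdry h (Circle.exp φ))) with hy
  have e1 : ρ * vBdry h (Circle.exp θ) - ρ * vBdry h (Circle.exp φ) = x - y := by
    rw [hx, hy]; ring
  have e2 : ρ * |vTrunc h (Circle.exp θ) l - vTrunc h (Circle.exp φ) l| = |x| := by
    rw [hx, abs_mul, abs_of_nonneg (show 0 ≤ ρ by linarith)]
  rw [e2] at hNl
  rw [e1]
  calc infArc h θ φ ^ ρ * |Real.sin (x - y)|
      ≤ infArc h θ φ ^ ρ * (|Real.sin y| + min 1 |x|) := by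
        gcongr; exact abs_sin_sub_le_add_min _ _
    _ = infArc h θ φ ^ ρ * min 1 |x| + infArc h θ φ ^ ρ * |Real.sin y| := by ring
    _ ≤ C₁ * ω D + max C₂ 0 * ω D := add_le_add hNl h2
    _ = _ := by ring

/-- Squaring doubles the phases, and `|e^{2iα} - e^{2iβ}| = 2|sin(α - β)|`. The weight `h(e^{iφ})^ρ`
exceeds the infimum on the arc by only `O(ω)`. The factor `h^ρ + h^ρ` is kept because it is divided
out when a root is taken. -/
lemma ArcBound.norm_sq_sub_sq_le (ha : ArcBound ψ ω h ρ) (hb : RadialBound ψ ω h ρ)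
    (hw : IsWeight ψ h) (hω : IsModulus ω) (hψω : ∀ t ∈ Icc (0 : ℝ) 2, ψ t ≤ ω t) (hρ : 1 ≤ ρ)
    (hh : LogIntegrable h) (hv : ∀ ξ, h ξ ≠ 0 → VFinite h ξ) :
    ∃ C, 0 ≤ C ∧ ∀ θ φ : ℝ, 0 ≤ θ → θ < φ → φ < 2 * Real.pi → φ - θ ≤ Real.pi →
      ‖outerPow h ρ (Circle.exp θ) ^ 2 - outerPow h ρ (Circle.exp φ) ^ 2‖ ≤
        C * (h (Circle.exp θ) ^ ρ + h (Circle.exp φ) ^ ρ) *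
          ω (dist (Circle.exp θ) (Circle.exp φ)) := by
  have hg := hw.rpow hρ
  obtain ⟨C, hC, hS⟩ := ha.infArc_mul_sin_le hb hw hω hψω hρ hh hv
  set K := lipConst ψ univ (fun σ => h σ ^ ρ) with hK
  have hK0 : 0 < K := hg.lipConst_pos
  refine ⟨3 * K + 2 * C, by positivity, fun θ φ hθ hθφ hφ hd => ?_⟩
  have h1 := hS θ φ hθ hθφ hφ hd
  have h2 := (hw.rpow_le_infArc_add hψω hω hρ hθφ.le hd).2
  have h3 := hg.abs_sub_le' hψω (Circle.exp θ) (Circle.exp φ)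
  have hωD := hω.nonneg (dist_nonneg (x := Circle.exp θ) (y := Circle.exp φ))
    (dist_circle_le_two _ _)
  have ha0 : 0 ≤ h (Circle.exp θ) ^ ρ := hg.nonneg _
  have hb0 : 0 ≤ h (Circle.exp φ) ^ ρ := hg.nonneg _
  rw [outerPow_circle_eq_mul (by linarith), outerPow_circle_eq_mul (by linarith)]
  rw [← hK] at h2 h3
  set W := ω (dist (Circle.exp θ) (Circle.exp φ))
  set a := h (Circle.exp θ) ^ ρ
  set b := h (Circle.exp φ) ^ ρ
  set α := ρ * vBdry h (Circle.exp θ)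
  set β := ρ * vBdry h (Circle.exp φ)
  set m := infArc h θ φ ^ ρ
  have e : ((a : ℂ) * Circle.exp α) ^ 2 - ((b : ℂ) * Circle.exp β) ^ 2 =
      (((a - b) * (a + b) : ℝ) : ℂ) * (Circle.exp α : ℂ) ^ 2 +
      ((b * b : ℝ) : ℂ) * ((Circle.exp α : ℂ) ^ 2 - (Circle.exp β : ℂ) ^ 2) := by
    rw [Complex.ofReal_mul, Complex.ofReal_mul, Complex.ofReal_sub, Complex.ofReal_add]
    ring
  rw [e]
  refine (norm_add_le _ _).trans ?_
  rw [norm_mul, norm_mul, norm_pow, Circle.norm_coe, one_pow, mul_one, norm_exp_sq_sub,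
    Complex.norm_real, Complex.norm_real, Real.norm_of_nonneg (mul_nonneg hb0 hb0),
    Real.norm_eq_abs, abs_mul, abs_of_nonneg (add_nonneg ha0 hb0)]
  set S := |Real.sin (α - β)|
  have hS0 : 0 ≤ S := abs_nonneg _
  have hS1 : S ≤ 1 := Real.abs_sin_le_one _
  have h4 : b * S ≤ (C + K) * W := by
    calc b * S ≤ (m + K * W) * S := by gcongr
      _ = m * S + K * W * S := by ring
      _ ≤ C * W + K * W * 1 := by gcongr
      _ = _ := by ring
  calc |a - b| * (a + b) + b * b * (2 * S) = |a - b| * (a + b) + 2 * b * (b * S) := by ring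
    _ ≤ K * W * (a + b) + 2 * (a + b) * ((C + K) * W) := by gcongr; linarith
    _ = _ := by ring

/-- The estimate on arcs within `[0, 2π)` gives a limit from the right at `0` and, by the Cauchy
criterion, one at `2π` from the left, but does not relate them. They agree because the Poisson
integral of the square has the right-hand one as radial limit. If `h(1) = 0`, continuity of `h`
suffices. -/
lemma tendsto_outerPow_sq_cut (hw : IsWeight ψ h) (hω : IsModulus ω) (hρ : 1 ≤ ρ)
    (hh : LogIntegrable h) (hv : ∀ ξ, h ξ ≠ 0 → VFinite h ξ) {C : ℝ}
    (hF : ∀ θ φ : ℝ, 0 ≤ θ → θ < φ → φ < 2 * Real.pi → φ - θ ≤ Real.pi →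
      ‖outerPow h ρ (Circle.exp θ) ^ 2 - outerPow h ρ (Circle.exp φ) ^ 2‖ ≤
        C * ω (dist (Circle.exp θ) (Circle.exp φ)))
    (hP : IntervalIntegrable (fun s => outerPow h ρ (Circle.exp s) ^ 2) volume 0 (2 * Real.pi) ∧
      ∀ z, ‖z‖ < 1 → outerPow h ρ z ^ 2 = pIntegral (fun s => outerPow h ρ (Circle.exp s) ^ 2) z) :
    Tendsto (fun s : ℝ => outerPow h ρ (Circle.exp s) ^ 2) (𝓝[<] (2 * Real.pi))
      (𝓝 (outerPow h ρ (1 : Circle) ^ 2)) := by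
  have hp := Real.pi_pos
  by_cases h1 : h 1 = 0
  · have e : outerPow h ρ (1 : Circle) ^ 2 = 0 := by
      rw [outerPow_circle, if_pos h1, zero_pow two_ne_zero]
    rw [e, tendsto_zero_iff_norm_tendsto_zero]
    simp only [norm_pow, norm_outerPow_circle (show ρ ≠ 0 by linarith) hw.nonneg]
    have hc : Continuous fun s : ℝ => (h (Circle.exp s) ^ ρ) ^ 2 :=
      (((hw.rpow hρ).cont).comp Circle.exp.continuous).pow 2
    have := (hc.tendsto (2 * Real.pi)).mono_left (nhdsWithin_le_nhds (s := Iio (2 * Real.pi)))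
    rwa [Circle.exp_two_pi, h1, Real.zero_rpow (by linarith), zero_pow two_ne_zero] at this
  have hsmall : ∀ ε > 0, ∃ η > 0, ∀ D, 0 ≤ D → D ≤ 2 → D < η → C * ω D < ε := by
    intro ε hε
    have h2 : Tendsto (fun D => C * ω D) (𝓝[Icc 0 2] 0) (𝓝 (C * ω 0)) :=
      (hω.continuousOn 0 ⟨le_rfl, zero_le_two⟩).tendsto.const_mul C
    rw [hω.map_zero, mul_zero] at h2
    obtain ⟨η, hη, hs⟩ := Metric.mem_nhdsWithin_iff.1 (h2.eventually (gt_mem_nhds hε))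
    refine ⟨η, hη, fun D h3 h4 h5 => hs ⟨?_, h3, h4⟩⟩
    rw [Metric.mem_ball, Real.dist_eq, sub_zero, abs_of_nonneg h3]
    exact h5
  set q : ℝ → ℂ := fun s => outerPow h ρ (Circle.exp s) ^ 2 with hq
  have hright : Tendsto q (𝓝[>] 0) (𝓝 (outerPow h ρ (1 : Circle) ^ 2)) := by
    rw [Metric.tendsto_nhds]
    intro ε hε
    obtain ⟨η, hη, hs⟩ := hsmall ε hε
    filter_upwards [Ioo_mem_nhdsGT (show 0 < min η Real.pi from lt_min hη hp)] with s hs'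
    have h2 := hF 0 s le_rfl hs'.1 (by linarith [hs'.2.trans_le (min_le_right _ _)])
      (by linarith [hs'.2.trans_le (min_le_right _ _)])
    have h3 := dist_exp_le 0 s
    rw [Circle.exp_zero] at h2 h3
    rw [dist_comm, dist_eq_norm]
    refine h2.trans_lt (hs _ dist_nonneg (dist_circle_le_two _ _) (h3.trans_lt ?_))
    rw [zero_sub, abs_neg, abs_of_pos hs'.1]
    exact hs'.2.trans_le (min_le_left _ _)
  obtain ⟨a, hleft⟩ : ∃ a, Tendsto q (𝓝[<] (2 * Real.pi)) (𝓝 a) := by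
    rw [← cauchy_map_iff_exists_tendsto, Metric.cauchy_iff]
    refine ⟨inferInstance, fun ε hε => ?_⟩
    obtain ⟨η, hη, hs⟩ := hsmall ε hε
    have hm : 0 < min η Real.pi := lt_min hη hp
    have key : ∀ s t, 2 * Real.pi - min η Real.pi < s → s < t → t < 2 * Real.pi →
        dist (q s) (q t) < ε := by
      intro s t h1 h2 h3
      have h4 := min_le_left η Real.pi
      have h5 := min_le_right η Real.pi
      rw [dist_eq_norm]
      refine (hF s t (by linarith) h2 h3 (by linarith)).trans_lt
        (hs _ dist_nonneg (dist_circle_le_two _ _) ((dist_exp_le s t).trans_lt ?_))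
      rw [abs_of_neg (by linarith)]
      linarith
    refine ⟨q '' Ioo (2 * Real.pi - min η Real.pi) (2 * Real.pi),
      image_mem_map (Ioo_mem_nhdsLT (by linarith)), ?_⟩
    rintro _ ⟨s, hs1, rfl⟩ _ ⟨t, ht1, rfl⟩
    rcases lt_trichotomy s t with h2 | h2 | h2
    · exact key s t hs1.1 h2 ht1.2
    · rw [h2, dist_self]; exact hε
    · rw [dist_comm]; exact key t s ht1.1 h2 hs1.2
  have hrad : Tendsto (fun r : ℝ => pIntegral q (r * (1 : Circle))) (𝓝[<] 1)
      (𝓝 (outerPow h ρ (1 : Circle) ^ 2)) := by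
    refine ((tendsto_outerPow_radial hw.cont hw.nonneg hh ρ h1 (hv 1 h1)).pow 2).congr' ?_
    filter_upwards [Ioo_mem_nhdsLT (show (0 : ℝ) < 1 by norm_num)] with r hr
    exact hP.2 _ (norm_radial_lt hr.1.le hr.2 1)
  rwa [eq_of_tendsto_pIntegral hP.1 hright hleft hrad] at hleft

lemma outerPow_sq_eq_pIntegral (hw : IsWeight ψ h) (hh : LogIntegrable h) (hρ : 1 ≤ ρ)
    (hv : ∀ ξ, h ξ ≠ 0 → VFinite h ξ) :
    IntervalIntegrable (fun s => outerPow h ρ (Circle.exp s) ^ 2) volume 0 (2 * Real.pi) ∧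
      ∀ z, ‖z‖ < 1 →
        outerPow h ρ z ^ 2 = pIntegral (fun s => outerPow h ρ (Circle.exp s) ^ 2) z := by
  refine eq_pIntegral_of_radial (F := fun z => outerPow h ρ z ^ 2)
    (M := Real.exp (ρ * Real.log (2 * lipConst ψ univ h)) ^ 2)
    ((differentiableOn_outerPow hh ρ).pow 2) (fun z hz => ?_) ?_
  · rw [norm_pow, norm_outerPow_disk hz]
    gcongr
    exact uDisk_le hh hw.nonneg hw.le_lipConst_mul hz
  · filter_upwards [hh.1] with s hs
    exact (tendsto_outerPow_radial hw.cont hw.nonneg hh ρ hs (hv _ hs)).pow 2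

/-- The square is shown continuous first, then the function. Only with continuity in hand can the
sign along an arc be followed and the estimate for squares be divided by `h^ρ`. -/
theorem memLambda_of_bounds (ha : ArcBound ψ ω h ρ) (hb : RadialBound ψ ω h ρ)
    (hw : IsWeight ψ h) (hω : IsModulus ω) (hψω : ∀ t ∈ Icc (0 : ℝ) 2, ψ t ≤ ω t) (hρ : 1 ≤ ρ)
    (hh : LogIntegrable h) (hv : ∀ ξ, h ξ ≠ 0 → VFinite h ξ) :
    MemLambda ω (outerPow h ρ) := by
  have hg := hw.rpow hρ
  have hρ0 : ρ ≠ 0 := by linarith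
  have hd := differentiableOn_outerPow hh ρ
  obtain ⟨C, hC, hS⟩ := ha.norm_sq_sub_sq_le hb hw hω hψω hρ hh hv
  set K := lipConst ψ univ (fun σ => h σ ^ ρ) with hK
  have hK0 : 0 < K := hg.lipConst_pos
  have hgK : ∀ ξ, h ξ ^ ρ ≤ 2 * K := hg.le_lipConst_mul
  have hP := outerPow_sq_eq_pIntegral hw hh hρ hv
  have hF : ∀ θ φ : ℝ, 0 ≤ θ → θ < φ → φ < 2 * Real.pi → φ - θ ≤ Real.pi →
      ‖outerPow h ρ (Circle.exp θ) ^ 2 - outerPow h ρ (Circle.exp φ) ^ 2‖ ≤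
        4 * K * C * ω (dist (Circle.exp θ) (Circle.exp φ)) := by
    intro θ φ h1 h2 h3 h4
    have hωD := hω.nonneg (dist_nonneg (x := Circle.exp θ) (y := Circle.exp φ))
      (dist_circle_le_two _ _)
    refine (hS θ φ h1 h2 h3 h4).trans ?_
    have := add_le_add (hgK (Circle.exp θ)) (hgK (Circle.exp φ))
    calc _ ≤ C * (2 * K + 2 * K) * ω (dist (Circle.exp θ) (Circle.exp φ)) := by gcongr
      _ = _ := by ring
  have hsq := norm_sub_le_of_short_arcs (F := fun ξ : Circle => outerPow h ρ ξ ^ 2) hω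
    (by positivity) hF (tendsto_outerPow_sq_cut hw hω hρ hh hv hF hP)
  have hsqc : Continuous fun ξ : Circle => outerPow h ρ ξ ^ 2 := continuous_iff_continuousAt.2
    fun ξ => (continuousWithinAt_univ _ _).1 (hω.continuousWithinAt
      (fun w _ => dist_circle_le_two w ξ) fun w _ => hsq w ξ)
  have hcl2 : ContinuousOn (fun z => outerPow h ρ z ^ 2) (Metric.closedBall 0 1) := by
    intro z hz
    have hz1 : ‖z‖ ≤ 1 := by simpa using hz
    rcases hz1.lt_or_eq with hz1 | hz1
    · exact ((hd.continuousOn.continuousAt (Metric.isOpen_ball.mem_nhds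
        (by simpa using hz1))).pow 2).continuousWithinAt
    obtain ⟨ξ, rfl⟩ := exists_circle_eq hz1
    rw [← Metric.ball_union_sphere, continuousWithinAt_union]
    constructor
    · refine (tendsto_pIntegral hP.1 (smallNear_of_continuousAt hsqc.continuousAt)).congr' ?_
      filter_upwards [self_mem_nhdsWithin] with w hw
      exact (hP.2 w (by simpa using hw)).symm
    · refine hω.continuousWithinAt (C := 2 * (4 * K * C)) (fun w hw =>
        dist_closedBall_le_two (Metric.sphere_subset_closedBall hw) hz) fun w hw => ?_
      rw [mem_sphere_zero_iff_norm] at hw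
      obtain ⟨ζ, rfl⟩ := exists_circle_eq hw
      exact hsq ζ ξ
  have hcl : ContinuousOn (outerPow h ρ) (Metric.closedBall 0 1) := by
    refine continuousOn_closedBall_of_sq hd.continuousOn hcl2 fun ξ hξ => ?_
    have hξ0 : h ξ ≠ 0 := fun h0 => hξ (by rw [outerPow_circle, if_pos h0])
    exact tendsto_outerPow_radial hw.cont hw.nonneg hh ρ hξ0 (hv ξ hξ0)
  have hcirc : Continuous fun ξ : Circle => outerPow h ρ ξ :=
    hcl.comp_continuous (by fun_prop) circle_mem_closedBall
  -- When `N > L ω(D)`, this choice yields `K ω(D) ≤ N`, so `h^ρ ≤ 2N` along the arc, and `3C ω(D) <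
  -- N`, so `w²` stays within distance less than `1` of `1`.
  set L := 3 * C + K with hL
  have hL0 : 0 < L := by positivity
  have hf : ∀ θ φ : ℝ, 0 ≤ θ → θ < φ → φ < 2 * Real.pi → φ - θ ≤ Real.pi →
      ‖outerPow h ρ (Circle.exp θ) - outerPow h ρ (Circle.exp φ)‖ ≤
        (2 * L + K) * ω (dist (Circle.exp θ) (Circle.exp φ)) := by
    intro θ φ h1 h2 h3 h4
    set D := dist (Circle.exp θ) (Circle.exp φ) with hD
    have hωD := hω.nonneg (dist_nonneg (x := Circle.exp θ) (y := Circle.exp φ))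
      (dist_circle_le_two _ _)
    rw [← hD] at hωD
    set N := h (Circle.exp θ) ^ ρ with hN
    have hN0 : 0 ≤ N := hg.nonneg (Circle.exp θ)
    have hDs : ∀ s, θ ≤ s → s ≤ φ → ω (dist (Circle.exp θ) (Circle.exp s)) ≤ ω D :=
      fun s hs1 hs2 => hω.mono dist_nonneg (dist_left_le hs1 hs2 h4) (dist_circle_le_two _ _)
    have hgs : ∀ s, θ ≤ s → s ≤ φ → h (Circle.exp s) ^ ρ ≤ N + K * ω D := by
      intro s hs1 hs2
      have h5 := (abs_le.1 (hg.abs_sub_le' hψω (Circle.exp θ) (Circle.exp s))).1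
      have h6 := mul_le_mul_of_nonneg_left (hDs s hs1 hs2) hK0.le
      linarith
    -- If `N` is small relative to `ω(D)`, the two moduli already bound the difference.
    rcases le_or_gt N (L * ω D) with hNL | hNL
    · have h5 := norm_sub_le (outerPow h ρ (Circle.exp θ)) (outerPow h ρ (Circle.exp φ))
      rw [norm_outerPow_circle hρ0 hw.nonneg, norm_outerPow_circle hρ0 hw.nonneg, ← hN] at h5
      have h6 := hgs φ h2.le le_rfl
      linarith
    have hCN : 3 * C * ω D < N := by
      have := mul_nonneg hK0.le hωD
      rw [hL, add_mul] at hNL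
      linarith
    have hKN : K * ω D ≤ N := by
      have := mul_nonneg hC hωD
      rw [hL, add_mul] at hNL
      nlinarith
    have hNpos : 0 < N := by
      have := mul_nonneg hC hωD
      linarith
    have hfN : ‖outerPow h ρ (Circle.exp θ)‖ = N := norm_outerPow_circle hρ0 hw.nonneg _
    have hfne : outerPow h ρ (Circle.exp θ) ≠ 0 := norm_pos_iff.1 (hfN ▸ hNpos)
    set w : ℝ → ℂ := fun s => outerPow h ρ (Circle.exp s) / outerPow h ρ (Circle.exp θ) with hwdef
    have hwθ : w θ = 1 := div_self hfne
    have hw1 : ∀ s, θ ≤ s → s ≤ φ → ‖w s ^ 2 - 1‖ ≤ 3 * C * ω D / N := by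
      intro s hs1 hs2
      rcases hs1.eq_or_lt with rfl | hs1
      · rw [hwθ, one_pow, sub_self, norm_zero]; positivity
      have h5 := hS θ s h1 hs1 (by linarith) (by linarith)
      have e : w s ^ 2 - 1 = (outerPow h ρ (Circle.exp s) ^ 2 - outerPow h ρ (Circle.exp θ) ^ 2) /
          outerPow h ρ (Circle.exp θ) ^ 2 := by
        rw [hwdef, sub_div, div_self (pow_ne_zero 2 hfne), div_pow]
      rw [e, norm_div, norm_pow, hfN, norm_sub_rev, div_le_div_iff₀ (by positivity) hNpos]
      have h6 := hgs s hs1.le hs2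
      have h7 := hDs s hs1.le hs2
      have h8 : 0 ≤ ω (dist (Circle.exp θ) (Circle.exp s)) :=
        hω.nonneg dist_nonneg (dist_circle_le_two _ _)
      calc _ ≤ C * (N + h (Circle.exp s) ^ ρ) * ω (dist (Circle.exp θ) (Circle.exp s)) * N := by
            gcongr
        _ ≤ C * (3 * N) * ω D * N := by gcongr; linarith
        _ = _ := by ring
    have hlt : 3 * C * ω D / N < 1 := (div_lt_one hNpos).2 hCN
    have hwc : ContinuousOn (fun s => (w s).re) (Icc θ φ) :=
      (Complex.continuous_re.comp
        ((hcirc.comp Circle.exp.continuous).div_const _)).continuousOn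
    -- The quotient `w` is continuous along the arc and equals `1` at `θ`; a sign change of its real
    -- part would pass through zero, which closeness of `w²` to `1` forbids.
    have hre : 0 ≤ (w φ).re := by
      by_contra! hneg
      obtain ⟨s, hs, hs0⟩ := intermediate_value_Icc' h2.le hwc
        (show (0 : ℝ) ∈ Icc (w φ).re (w θ).re from
          ⟨hneg.le, by rw [hwθ, Complex.one_re]; exact zero_le_one⟩)
      exact re_ne_zero_of_norm_sq_sub_one_lt ((hw1 s hs.1 hs.2).trans_lt hlt) hs0
    have h5 := (norm_sub_one_le hre).trans (hw1 φ h2.le le_rfl)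
    have e : outerPow h ρ (Circle.exp φ) - outerPow h ρ (Circle.exp θ) =
        (w φ - 1) * outerPow h ρ (Circle.exp θ) := by
      rw [sub_mul, one_mul, hwdef, div_mul_cancel₀ _ hfne]
    rw [norm_sub_rev, e, norm_mul, hfN]
    rw [le_div_iff₀ hNpos] at h5
    refine h5.trans ?_
    gcongr
    linarith
  have hlim : Tendsto (fun s : ℝ => outerPow h ρ (Circle.exp s)) (𝓝[<] (2 * Real.pi))
      (𝓝 (outerPow h ρ (1 : Circle))) := by
    have := ((hcirc.comp Circle.exp.continuous).tendsto (2 * Real.pi)).mono_left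
      (nhdsWithin_le_nhds (s := Iio (2 * Real.pi)))
    rwa [Function.comp_apply, Circle.exp_two_pi] at this
  have hlip := norm_sub_le_of_short_arcs (F := fun ξ : Circle => outerPow h ρ ξ) hω
    (by positivity) hf hlim
  exact ⟨hd, hcl, finiteLip_closedBall hω hd hcl (by positivity) hlip⟩

end Sufficiency

/-! ### Necessity of the two bounds. -/

section Necessity

variable {ψ ω : ℝ → ℝ} {h : Circle → ℝ} {ρ : ℝ}

/-- The radial bound uses only pairs on a common radius. It comes first because the arc bound needs
it to control the nonlocal phase. -/
theorem bounds_of_memLambda (hf : MemLambda ω (outerPow h ρ))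
    (hw : IsWeight ψ h) (hω : IsModulus ω) (hψω : ∀ t ∈ Icc (0 : ℝ) 2, ψ t ≤ ω t) (hρ : 1 ≤ ρ)
    (hh : LogIntegrable h) (hv : ∀ ξ, h ξ ≠ 0 → VFinite h ξ) :
    RadialBound ψ ω h ρ ∧ ArcBound ψ ω h ρ := by
  set C := lipConst ω (Metric.closedBall (0 : ℂ) 1) (outerPow h ρ) with hCdef
  have hlip : ∀ z ∈ Metric.closedBall (0 : ℂ) 1, ∀ w ∈ Metric.closedBall (0 : ℂ) 1,
      ‖outerPow h ρ z - outerPow h ρ w‖ ≤ C * ω (dist z w) := fun z hz w hw =>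
    hf.2.2.norm_sub_le hω (fun _ h1 _ h2 => dist_closedBall_le_two h1 h2) hz hw
  have hC0 : 0 ≤ C := by
    refine Real.sSup_nonneg ?_
    rintro _ ⟨z, hz, w, hw, -, rfl⟩
    exact div_nonneg (norm_nonneg _) (hω.nonneg dist_nonneg (dist_closedBall_le_two hz hw))
  have hr : RadialBound ψ ω h ρ := by
    refine radialBound_of_lip hw hω hψω hρ hh hC0 fun ξ δ hδ => ?_
    have hm : ((1 - δ : ℝ) : ℂ) * ξ ∈ Metric.closedBall (0 : ℂ) 1 := by
      rw [mem_closedBall_zero_iff]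
      exact (norm_radial_lt (by linarith [hδ.2]) (by linarith [hδ.1]) ξ).le
    have hd : dist (((1 - δ : ℝ) : ℂ) * ξ) (ξ : ℂ) = δ := by
      rw [dist_eq_norm, show ((1 - δ : ℝ) : ℂ) * ξ - ξ = -((δ : ℂ) * ξ) by push_cast; ring,
        norm_neg, norm_mul, Circle.norm_coe, mul_one, Complex.norm_real,
        Real.norm_of_nonneg hδ.1.le]
    have := hlip _ hm ξ (circle_mem_closedBall ξ)
    rwa [hd] at this
  exact ⟨hr, arcBound_of_lip hr hw hω hψω hρ hh hv hC0 fun ξ ζ =>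
    hlip ξ (circle_mem_closedBall ξ) ζ (circle_mem_closedBall ζ)⟩

end Necessity

end OuterLip

theorem proposition3p1 (ψ ω : ℝ → ℝ) (hψ : OuterLip.IsModulus ψ) (hω : OuterLip.IsModulus ω)
    (hψω : ∀ t ∈ Set.Icc (0 : ℝ) 2, ψ t ≤ ω t)
    (ρ : ℝ) (hρ : 1 ≤ ρ)
    (h : Circle → ℝ) (h_cont : Continuous h) (h_nonneg : ∀ ξ, 0 ≤ h ξ)
    (h_zero : ∃ ξ, h ξ = 0)
    (h_log : OuterLip.LogIntegrable h)
    (h_lip : OuterLip.FiniteLip ψ Set.univ h)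
    (h_v : ∀ ξ, h ξ ≠ 0 → OuterLip.VFinite h ξ) :
    OuterLip.MemLambda ω (OuterLip.outerPow h ρ) ↔
      (∃ C : ℝ, ∀ ξ : Circle, h ξ ≠ 0 →
        h ξ ^ ρ / ω (min 1 (OuterLip.aFun ψ h ξ)⁻¹) ≤ C) ∧
      (∃ C : ℝ, ∀ θ φ : ℝ, 0 ≤ θ → θ < φ → φ < 2 * Real.pi →
        OuterLip.infArc h θ φ ^ ρ * OuterLip.AFun ψ (fun σ => h σ ^ ρ) θ φ
          / ω (dist (Circle.exp θ) (Circle.exp φ)) ≤ C) := by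
  have hw : OuterLip.IsWeight ψ h :=
    -- Log-integrability supplies a point where `h` does not vanish, which makes the Lipschitz
    -- constant positive.
    ⟨hψ, h_cont, h_nonneg, h_zero, h_log.ae_ne_zero.exists.imp' _ fun _ h1 => h1, h_lip⟩
  exact ⟨fun hf => OuterLip.bounds_of_memLambda hf hw hω hψω hρ h_log h_v,
    fun hb => OuterLip.memLambda_of_bounds hb.2 hb.1 hw hω hψω hρ h_log h_v⟩
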